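/- Let $U\subseteq\mathbb R^n$ be an open coordinate domain with coordinates $u^1,\dots,u^n$, and let $g^{ij}(u)$ be smooth, symmetric and nondegenerate, the inverse of a (pseudo-Riemannian) metric $g_{ij}$ on $U$ for which the coordinates are flat, i.e. the Christoffel symbols $\Gamma^k_{ij}$ of its Levi-Civita connection vanish on $U$. Repeated indices are summed, a comma denotes partial differentiation, $f_{,k}=\partial f/\partial u^k$, and $c^{ij}_{(k,l)}=\tfrac12\big(c^{ij}_{k,l}+c^{ij}_{l,k}\big)$. On the space of smooth loops $u:S^1\to U$, with coordinate $x$ on $S^1$, consider the hydrodynamic operator $$P_1^{ij}=g^{ij}(u)\frac{d}{dx}+\Gamma^{ij}_k(u)\,u^k_x,\qquad \Gamma^{ij}_k=-g^{ir}\Gamma^j_{rk},$$ and the operator of degree 2 $$P_2^{ij}=a^{ij}(u)\Big(\frac{d}{dx}\Big)^2+b^{ij}_k(u)\,u^k_x\frac{d}{dx}+c^{ij}_{kl}(u)\,u^k_xu^l_x+c^{ij}_k(u)\,u^k_{xx},$$ whose coefficients are smooth on $U$, with $c^{ij}_{kl}=c^{ij}_{lk}$. Assume that $P_2$ is antisymmetric: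 $\int p_iP_2^{ij}(q_j)\,dx=-\int q_iP_2^{ij}(p_j)\,dx$ for all loops $u$ and all smooth $p,q:S^1\to\mathbb R^n$. For a matrix of operators $P$ and functionals $F,G$ of loops put $$\{F,G\}_P=\int_{S^1}\frac{\delta F}{\delta u^i}\,P^{ij}\Big(\frac{\delta G}{\delta u^j}\Big)\,dx .$$ Then $P_1+\varepsilon P_2$ satisfies the Jacobi identity to first order in $\varepsilon$, that is, for all local functionals $F,G,H$ (integrals over $S^1$ of smooth functions of $x$, $u$ and finitely many $x$-derivatives of $u$) and every loop $u$, $$\{\{F,G\},H\}+\{\{G,H\},F\}+\{\{H,F\},G\}=O(\varepsilon^2)\quad(\varepsilon\to0)$$ for the bracket of $P_1+\varepsilon P_2$, if and only if the following hold on $U$ for all values of the free indices: (I) $g^{ir}c^{jk}_r+g^{jr}c^{ik}_r=0$; (II) $c^{ij}_{kl}=c^{ij}_{(k,l)}$; (III) $g^{ir}c^{jk}_{l,r}=g^{jr}\big(c^{ik}_{l,r}-c^{ik}_{r,l}\big)$; (IV) $g^{ir}\big(a^{jk}_{,r}-c^{jk}_r\big)+g^{jr}\big(a^{ki}_{,r}-c^{ki}_r\big)+g^{kr}\big(a^{ij}_{,r}-c^{ij}_r\big)=0$.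 -/

import Mathlib

open scoped ContDiff Topology

noncomputable section

namespace LoopPoisson

/-- The partial derivative `∂f/∂u^k` at the point `u`. -/
def pd {n : ℕ} (k : Fin n) (f : (Fin n → ℝ) → ℝ) (u : Fin n → ℝ) : ℝ :=
  fderiv ℝ f u (Pi.single k 1)

/-! ### Loops and functionals -/

/-- Smooth `1`-periodic maps `ℝ → ℝⁿ`, i.e. smooth maps from the circle `S¹ = ℝ/ℤ`. These are used
both for variations of loops and for covector fields along loops. -/
structure SmoothPeriodic {n : ℕ} (p : ℝ → Fin n → ℝ) : Prop where
  smooth : ContDiff ℝ ∞ p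
  periodic : Function.Periodic p 1

/-- The loop space of the coordinate domain `U`: smooth maps `S¹ → U`. -/
structure IsLoop {n : ℕ} (U : Set (Fin n → ℝ)) (u : ℝ → Fin n → ℝ) : Prop
    extends SmoothPeriodic u where
  mem : ∀ x, u x ∈ U

/-- Functionals; only their values on loops matter. -/
abbrev Functional (n : ℕ) : Type := (ℝ → Fin n → ℝ) → ℝ

/-- Local functionals `F[u] = ∫ f(x, u, u_x, …, u^{(N)}) dx` on the loop space of `U`, with a smooth
density depending on finitely many derivatives (and possibly on `x ∈ S¹`). In the density, `v s`
stands for the `s`-th derivative of the loop. -/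
def IsLocal {n : ℕ} (U : Set (Fin n → ℝ)) (F : Functional n) : Prop :=
  ∃ (N : ℕ) (f : ℝ × (Fin (N + 1) → Fin n → ℝ) → ℝ),
    ContDiffOn ℝ ∞ f {z | z.2 0 ∈ U} ∧
    (∀ x v, f (x + 1, v) = f (x, v)) ∧
    ∀ u, IsLoop U u →
      F u = ∫ x in (0 : ℝ)..1, f (x, fun s => iteratedDeriv (s : ℕ) u x)

/-- `p` is the variational derivative `δF/δu` at the loop `u`:
`d/dτ F[u + τ φ] = ∫ p_i φ^i dx` at `τ = 0` for every variation `φ`. -/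
structure HasVarDeriv {n : ℕ} (F : Functional n) (u p : ℝ → Fin n → ℝ) : Prop where
  smoothPeriodic : SmoothPeriodic p
  hasDerivAt : ∀ φ : ℝ → Fin n → ℝ, SmoothPeriodic φ →
    HasDerivAt (fun τ : ℝ => F (u + τ • φ)) (∫ x in (0 : ℝ)..1, ∑ i, p x i * φ x i) 0

open Classical in
/-- The variational derivative `δF/δu` at `u` (it is unique; zero if there is none). -/
def varDeriv {n : ℕ} (F : Functional n) (u : ℝ → Fin n → ℝ) : ℝ → Fin n → ℝ :=
  if h : ∃ p, HasVarDeriv F u p then h.choose else 0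

/-! ### Operators and brackets -/

/-- A matrix `P^{ij}` of differential operators with coefficients depending on the loop:
`P u p x i` is `P^{ij}(p_j)` at the point `x`, along the loop `u`. -/
abbrev Operator (n : ℕ) : Type :=
  (ℝ → Fin n → ℝ) → (ℝ → Fin n → ℝ) → ℝ → Fin n → ℝ

/-- `{F, G} = ∫ (δF/δu^i) P^{ij} (δG/δu^j) dx`. -/
def bracket {n : ℕ} (P : Operator n) (F G : Functional n) : Functional n :=
  fun u => ∫ x in (0 : ℝ)..1, ∑ i, varDeriv F u x i * P u (varDeriv G u) x i

/-- `{{F, G}, H} + {{G, H}, F} + {{H, F}, G}`. -/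
def jacobiator {n : ℕ} (P : Operator n) (F G H : Functional n) : Functional n :=
  fun u => bracket P (bracket P F G) H u + bracket P (bracket P G H) F u
    + bracket P (bracket P H F) G u

/-- Antisymmetry of an operator on the loop space of `U`:
`∫ p_i P^{ij}(q_j) dx = - ∫ q_i P^{ij}(p_j) dx` for all covector fields `p`, `q` along all loops. -/
def IsAntisymm {n : ℕ} (U : Set (Fin n → ℝ)) (P : Operator n) : Prop :=
  ∀ u p q, IsLoop U u → SmoothPeriodic p → SmoothPeriodic q →
    ∫ x in (0 : ℝ)..1, ∑ i, p x i * P u q x i = -∫ x in (0 : ℝ)..1, ∑ i, q x i * P u p x i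

/-- `P₁ + ε P₂` satisfies the Jacobi identity to first order in `ε`: for all local functionals
and at every loop, the Jacobiator of its bracket is `O(ε²)` as `ε → 0`. -/
def JacobiToFirstOrder {n : ℕ} (U : Set (Fin n → ℝ)) (P₁ P₂ : Operator n) : Prop :=
  ∀ F G H : Functional n, IsLocal U F → IsLocal U G → IsLocal U H → ∀ u, IsLoop U u →
    (fun ε : ℝ => jacobiator (P₁ + ε • P₂) F G H u) =O[𝓝 0] (fun ε : ℝ => ε ^ 2)

/-! ### The metric and the hydrodynamic operator -/

/-- The covariant metric `g_{ij}`, the inverse of the matrix `g^{ij}`. -/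
def lower {n : ℕ} (g : Fin n → Fin n → (Fin n → ℝ) → ℝ) (i j : Fin n) (u : Fin n → ℝ) : ℝ :=
  (Matrix.of fun r s => g r s u)⁻¹ i j

/-- The Christoffel symbols `Γ^k_{ij}` of the Levi-Civita connection of the metric with
contravariant components `g^{ij}`. -/
def christoffel {n : ℕ} (g : Fin n → Fin n → (Fin n → ℝ) → ℝ) (k i j : Fin n)
    (u : Fin n → ℝ) : ℝ :=
  (1 / 2) * ∑ l, g k l u *
    (pd i (lower g l j) u + pd j (lower g l i) u - pd l (lower g i j) u)

/-- `Γ^{ij}_k = - g^{ir} Γ^j_{rk}`. -/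
def contraChristoffel {n : ℕ} (g : Fin n → Fin n → (Fin n → ℝ) → ℝ) (i j k : Fin n)
    (u : Fin n → ℝ) : ℝ :=
  -∑ r, g i r u * christoffel g j r k u

/-- `g^{ij}` are the contravariant components on `U` of a smooth pseudo-Riemannian metric. -/
structure IsMetric {n : ℕ} (U : Set (Fin n → ℝ)) (g : Fin n → Fin n → (Fin n → ℝ) → ℝ) :
    Prop where
  smooth : ∀ i j, ContDiffOn ℝ ∞ (g i j) U
  symm : ∀ i j, ∀ u ∈ U, g i j u = g j i u
  nondegenerate : ∀ u ∈ U, IsUnit (Matrix.of fun r s => g r s u).det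

/-- The coordinates on `U` are flat for the metric: the Christoffel symbols vanish. -/
def IsFlatCoord {n : ℕ} (U : Set (Fin n → ℝ)) (g : Fin n → Fin n → (Fin n → ℝ) → ℝ) : Prop :=
  ∀ i j k, ∀ u ∈ U, christoffel g k i j u = 0

/-- The hydrodynamic operator `P^{ij} = g^{ij}(u) d/dx + Γ^{ij}_k(u) u^k_x`. -/
def hydroOp {n : ℕ} (g : Fin n → Fin n → (Fin n → ℝ) → ℝ) : Operator n :=
  fun u p x i => ∑ j, (g i j (u x) * deriv (fun y => p y j) x
    + (∑ k, contraChristoffel g i j k (u x) * deriv (fun y => u y k) x) * p x j)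

/-- The operator of degree two
`P^{ij} = a^{ij} (d/dx)² + b^{ij}_k u^k_x d/dx + c^{ij}_{kl} u^k_x u^l_x + c^{ij}_k u^k_{xx}`.
Here `c i j k` is `c^{ij}_k` and `cc i j k l` is `c^{ij}_{kl}`. -/
def degreeTwoOp {n : ℕ} (a : Fin n → Fin n → (Fin n → ℝ) → ℝ)
    (b c : Fin n → Fin n → Fin n → (Fin n → ℝ) → ℝ)
    (cc : Fin n → Fin n → Fin n → Fin n → (Fin n → ℝ) → ℝ) : Operator n :=
  fun u p x i => ∑ j, (a i j (u x) * iteratedDeriv 2 (fun y => p y j) x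
    + (∑ k, b i j k (u x) * deriv (fun y => u y k) x) * deriv (fun y => p y j) x
    + ((∑ k, ∑ l, cc i j k l (u x) * deriv (fun y => u y k) x * deriv (fun y => u y l) x)
      + ∑ k, c i j k (u x) * iteratedDeriv 2 (fun y => u y k) x) * p x j)

end LoopPoisson

end

noncomputable section

namespace LoopPoisson

open Set Filter MeasureTheory

section

/-! ### Smooth periodic functions -/

/-! The Jacobiator is computed once and for all for an antisymmetric operator `P` whose pairing `∫
p_i P^{ij}(q_j) dx` equals the integral of a density `ℓ(u, u_x, p, p_x, q, q_x)`, bilinear in `(p,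
p_x)` and `(q, q_x)`. Varying `{F, G}` produces one term from the explicit dependence of `ℓ` on the
loop, and terms containing the second variations of `F` and `G`. In the cyclic sum the latter
cancel, because second variations are symmetric and `P` is antisymmetric (`hasDerivAt_bracket`,
`jacobiator_eq`). What is left is the cyclic sum of the variations of `ℓ` in the direction `P(r)`,
where `p`, `q`, `r` are the variational derivatives of `F`, `G`, `H`. The functionals enter only
through `IsRegular`, which local functionals satisfy by the Euler-Lagrange formula
(`IsLocal.isRegular`).

Flatness makes `g^{ij}` locally constant, so `P₁ = g d/dx` and its density does not vary with the
loop. Hence the Jacobiator of `P₁ + ε P₂` is `ε T + ε² R`, where `T` varies the density of `P₂` in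
the direction `P₁ r`. Since linear functionals realise all triples `p`, `q`, `r`, the Jacobi
identity to first order says that `T` vanishes identically (`jacobiToFirstOrder_iff`).

Integration by parts brings `P₂` to a first order density with coefficients `a`, `β = b - ∂a - c`,
`c` and the defect `d` of condition (II). Antisymmetry forces `β^{ij}_k = c^{ji}_k`
(`HasFormDensity.beta_eq`), so `b` disappears from the problem. A further integration by parts
(`cyclicVariation_eq`) turns `T` into the integral of a cubic form. Up to sign and cyclic
relabelling, its coefficients are the expression of (I) at `p_xx q r_x`, that of (III) contracted
with `u_x` at `p_x q r_x`, that of (IV) at `p_x q_x r_x`, and terms built from `d`. Sufficiency is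
then immediate. For necessity, trigonometric test functions and loops close to constant ones isolate
the coefficients one after another (`coeff_eq_zero_of_integral`,
`conditions_of_integral_cubicForm`). -/

/-- Smooth `1`-periodic real functions. -/
structure PeriodicSmooth (f : ℝ → ℝ) : Prop where
  smooth : ContDiff ℝ ∞ f
  periodic : Function.Periodic f 1

namespace PeriodicSmooth

variable {f h : ℝ → ℝ}

lemma differentiable (hf : PeriodicSmooth f) : Differentiable ℝ f :=
  hf.smooth.differentiable (by simp)

lemma hasDerivAt (hf : PeriodicSmooth f) (x : ℝ) : HasDerivAt f (deriv f x) x :=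
  (hf.differentiable x).hasDerivAt

lemma continuous (hf : PeriodicSmooth f) : Continuous f := hf.smooth.continuous

lemma const (r : ℝ) : PeriodicSmooth fun _ => r := ⟨contDiff_const, fun _ => rfl⟩

lemma add (hf : PeriodicSmooth f) (hh : PeriodicSmooth h) :
    PeriodicSmooth fun x => f x + h x :=
  ⟨hf.smooth.add hh.smooth, fun x => by simp only [hf.periodic x, hh.periodic x]⟩

lemma sub (hf : PeriodicSmooth f) (hh : PeriodicSmooth h) :
    PeriodicSmooth fun x => f x - h x :=
  ⟨hf.smooth.sub hh.smooth, fun x => by simp only [hf.periodic x, hh.periodic x]⟩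

lemma mul (hf : PeriodicSmooth f) (hh : PeriodicSmooth h) :
    PeriodicSmooth fun x => f x * h x :=
  ⟨hf.smooth.mul hh.smooth, fun x => by simp only [hf.periodic x, hh.periodic x]⟩

lemma sum {ι : Type*} {s : Finset ι} {f : ι → ℝ → ℝ} (hf : ∀ i ∈ s, PeriodicSmooth (f i)) :
    PeriodicSmooth fun x => ∑ i ∈ s, f i x :=
  ⟨ContDiff.sum fun i hi => (hf i hi).smooth,
    fun x => Finset.sum_congr rfl fun i hi => (hf i hi).periodic x⟩

lemma deriv (hf : PeriodicSmooth f) : PeriodicSmooth (deriv f) := by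
  refine ⟨(contDiff_infty_iff_deriv.1 hf.smooth).2, fun x => ?_⟩
  rw [← deriv_comp_add_const]
  exact congrArg (fun k => _root_.deriv k x) (funext hf.periodic)

lemma iteratedDeriv (hf : PeriodicSmooth f) (s : ℕ) : PeriodicSmooth (iteratedDeriv s f) := by
  induction s with
  | zero => simpa using hf
  | succ s ih => rw [iteratedDeriv_succ]; exact ih.deriv

end PeriodicSmooth

variable {n : ℕ}

lemma smoothPeriodic_iff {p : ℝ → Fin n → ℝ} :
    SmoothPeriodic p ↔ ∀ i, PeriodicSmooth fun x => p x i := by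
  refine ⟨fun h i => ⟨contDiff_pi.1 h.smooth i, fun x => congrFun (h.periodic x) i⟩,
    fun h => ⟨contDiff_pi.2 fun i => (h i).smooth, fun x => funext fun i => (h i).periodic x⟩⟩

lemma SmoothPeriodic.apply {p : ℝ → Fin n → ℝ} (hp : SmoothPeriodic p) (i : Fin n) :
    PeriodicSmooth fun x => p x i := smoothPeriodic_iff.1 hp i

lemma SmoothPeriodic.differentiable {p : ℝ → Fin n → ℝ} (hp : SmoothPeriodic p) :
    Differentiable ℝ p := hp.smooth.differentiable (by simp)

lemma SmoothPeriodic.deriv_apply {p : ℝ → Fin n → ℝ} (hp : SmoothPeriodic p) (x : ℝ) (i : Fin n) :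
    deriv p x i = deriv (fun y => p y i) x :=
  ((hasDerivAt_pi.1 (hp.differentiable x).hasDerivAt i).deriv).symm

lemma SmoothPeriodic.deriv {p : ℝ → Fin n → ℝ} (hp : SmoothPeriodic p) :
    SmoothPeriodic (deriv p) := by
  refine smoothPeriodic_iff.2 fun i => ?_
  simp only [hp.deriv_apply]
  exact (hp.apply i).deriv

lemma SmoothPeriodic.iteratedDeriv {p : ℝ → Fin n → ℝ} (hp : SmoothPeriodic p) (s : ℕ) :
    SmoothPeriodic (iteratedDeriv s p) := by
  induction s with
  | zero => simpa using hp
  | succ s ih => rw [iteratedDeriv_succ]; exact ih.deriv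

lemma SmoothPeriodic.iteratedDeriv_apply {p : ℝ → Fin n → ℝ} (hp : SmoothPeriodic p) (s : ℕ)
    (x : ℝ) (i : Fin n) :
    _root_.iteratedDeriv s p x i = _root_.iteratedDeriv s (fun y => p y i) x := by
  induction s generalizing x with
  | zero => simp
  | succ s ih =>
    rw [iteratedDeriv_succ, iteratedDeriv_succ, (hp.iteratedDeriv s).deriv_apply]
    exact congrArg (fun k => _root_.deriv k x) (funext ih)

/-- The integral over a period of a derivative of a periodic function vanishes. -/
lemma integral_deriv_eq_zero {f f' : ℝ → ℝ} (hf : Function.Periodic f 1)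
    (hd : ∀ x, HasDerivAt f (f' x) x) (hc : Continuous f') : ∫ x in (0 : ℝ)..1, f' x = 0 := by
  rw [intervalIntegral.integral_eq_sub_of_hasDerivAt (fun x _ => hd x)
    (hc.intervalIntegrable _ _)]
  have := hf 0
  simp only [zero_add] at this
  rw [this, sub_self]

/-- Integration by parts over a period. -/
lemma PeriodicSmooth.integral_mul_deriv {f h : ℝ → ℝ} (hf : PeriodicSmooth f)
    (hh : PeriodicSmooth h) :
    ∫ x in (0 : ℝ)..1, f x * _root_.deriv h x = -∫ x in (0 : ℝ)..1, _root_.deriv f x * h x := by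
  have h0 := integral_deriv_eq_zero (hf.mul hh).periodic
    (fun x => (hf.hasDerivAt x).mul (hh.hasDerivAt x))
    ((hf.deriv.mul hh).continuous.add (hf.mul hh.deriv).continuous)
  rw [intervalIntegral.integral_add ((hf.deriv.mul hh).continuous.intervalIntegrable _ _)
    ((hf.mul hh.deriv).continuous.intervalIntegrable _ _)] at h0
  linarith

lemma PeriodicSmooth.integral_mul_iteratedDeriv {f h : ℝ → ℝ} (hf : PeriodicSmooth f)
    (hh : PeriodicSmooth h) (s : ℕ) :
    ∫ x in (0 : ℝ)..1, f x * _root_.iteratedDeriv s h x =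
      ∫ x in (0 : ℝ)..1, (-1) ^ s * _root_.iteratedDeriv s f x * h x := by
  induction s generalizing f with
  | zero => simp
  | succ s ih =>
    simp only [iteratedDeriv_succ (f := h)]
    rw [hf.integral_mul_deriv (hh.iteratedDeriv s), ih hf.deriv, ← intervalIntegral.integral_neg]
    refine intervalIntegral.integral_congr fun x _ => ?_
    simp only [iteratedDeriv_succ' (f := f), pow_succ]
    ring

lemma PeriodicSmooth.integral_sum {ι : Type*} {s : Finset ι} {f : ι → ℝ → ℝ}
    (hf : ∀ i ∈ s, PeriodicSmooth (f i)) :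
    ∫ x in (0 : ℝ)..1, ∑ i ∈ s, f i x = ∑ i ∈ s, ∫ x in (0 : ℝ)..1, f i x :=
  intervalIntegral.integral_finsetSum fun i hi => (hf i hi).continuous.intervalIntegrable _ _

lemma PeriodicSmooth.intervalIntegrable {f : ℝ → ℝ} (hf : PeriodicSmooth f) (a b : ℝ) :
    IntervalIntegrable f volume a b :=
  hf.continuous.intervalIntegrable a b

/-- A smooth function on `U`, evaluated along a loop. -/
lemma IsLoop.comp_smooth {U : Set (Fin n → ℝ)} (hU : IsOpen U) {u : ℝ → Fin n → ℝ}
    (hu : IsLoop U u) {f : (Fin n → ℝ) → ℝ} (hf : ContDiffOn ℝ ∞ f U) :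
    PeriodicSmooth fun x => f (u x) := by
  refine ⟨contDiff_iff_contDiffAt.2 fun x => ?_, fun x => by simp only [hu.periodic x]⟩
  exact (hf.contDiffAt (hU.mem_nhds (hu.mem x))).comp x hu.smooth.contDiffAt

/-! ### Smooth families -/

/-- The open strip `(-δ, δ) × ℝ`. -/
def strip (δ : ℝ) : Set (ℝ × ℝ) := Ioo (-δ) δ ×ˢ univ

lemma isOpen_strip (δ : ℝ) : IsOpen (strip δ) := isOpen_Ioo.prod isOpen_univ

lemma mem_strip {δ : ℝ} {z : ℝ × ℝ} : z ∈ strip δ ↔ z.1 ∈ Ioo (-δ) δ := by simp [strip]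

lemma zero_mem_strip {δ : ℝ} (hδ : 0 < δ) (x : ℝ) : ((0 : ℝ), x) ∈ strip δ := by
  simp [mem_strip, hδ]

lemma strip_mono {δ δ' : ℝ} (h : δ ≤ δ') : strip δ ⊆ strip δ' := by
  intro z
  simp only [mem_strip, mem_Ioo]
  exact fun hz => ⟨by linarith, by linarith⟩

/-- The derivative of a family in the parameter. -/
def dt (h : ℝ × ℝ → ℝ) (z : ℝ × ℝ) : ℝ := fderiv ℝ h z (1, 0)

/-- The derivative of a family in the circle coordinate. -/
def dx (h : ℝ × ℝ → ℝ) (z : ℝ × ℝ) : ℝ := fderiv ℝ h z (0, 1)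

section families

variable {δ : ℝ} {h : ℝ × ℝ → ℝ}

lemma contDiffOn_fderiv_apply {E : Type*} [NormedAddCommGroup E] [NormedSpace ℝ E] {s : Set E}
    (hs : IsOpen s) {f : E → ℝ} (hf : ContDiffOn ℝ ∞ f s) (e : E) :
    ContDiffOn ℝ ∞ (fun z => fderiv ℝ f z e) s :=
  (hf.fderiv_of_isOpen hs (by simp)).clm_apply contDiffOn_const

/-- Schwarz's theorem, in the form that serves both to commute `dt` with `dx` and to make the second
variation symmetric. -/
lemma fderiv_fderiv_apply_comm {E : Type*} [NormedAddCommGroup E] [NormedSpace ℝ E] {s : Set E}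
    (hs : IsOpen s) {f : E → ℝ} (hf : ContDiffOn ℝ ∞ f s) {z : E} (hz : z ∈ s) (e e' : E) :
    fderiv ℝ (fun z => fderiv ℝ f z e) z e' = fderiv ℝ (fun z => fderiv ℝ f z e') z e := by
  have hca := hf.contDiffAt (hs.mem_nhds hz)
  have hsymm : IsSymmSndFDerivAt ℝ f z :=
    (hca.of_le (WithTop.coe_le_coe.2 (le_top (a := (2 : ℕ∞))))).isSymmSndFDerivAt (by simp)
  have hd : DifferentiableAt ℝ (fderiv ℝ f) z :=
    (hca.fderiv_right (m := ∞) (by simp)).differentiableAt (by simp)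
  have key : ∀ e e' : E, fderiv ℝ (fun z => fderiv ℝ f z e) z e' =
      fderiv ℝ (fderiv ℝ f) z e' e := by
    intro e e'
    rw [(hd.hasFDerivAt.clm_apply (hasFDerivAt_const e z)).fderiv]
    simp
  rw [key, key, hsymm.eq]

lemma contDiffOn_dt (hh : ContDiffOn ℝ ∞ h (strip δ)) : ContDiffOn ℝ ∞ (dt h) (strip δ) :=
  contDiffOn_fderiv_apply (isOpen_strip δ) hh _

lemma contDiffOn_dx (hh : ContDiffOn ℝ ∞ h (strip δ)) : ContDiffOn ℝ ∞ (dx h) (strip δ) :=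
  contDiffOn_fderiv_apply (isOpen_strip δ) hh _

lemma hasFDerivAt_of_strip (hh : ContDiffOn ℝ ∞ h (strip δ)) {z : ℝ × ℝ} (hz : z ∈ strip δ) :
    HasFDerivAt h (fderiv ℝ h z) z :=
  ((hh.contDiffAt ((isOpen_strip δ).mem_nhds hz)).differentiableAt (by simp)).hasFDerivAt

lemma hasDerivAt_dt (hh : ContDiffOn ℝ ∞ h (strip δ)) {τ x : ℝ} (hz : (τ, x) ∈ strip δ) :
    HasDerivAt (fun t => h (t, x)) (dt h (τ, x)) τ :=
  (hasFDerivAt_of_strip hh hz).comp_hasDerivAt τ ((hasDerivAt_id τ).prodMk (hasDerivAt_const τ x))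

lemma hasDerivAt_dx (hh : ContDiffOn ℝ ∞ h (strip δ)) {τ x : ℝ} (hz : (τ, x) ∈ strip δ) :
    HasDerivAt (fun y => h (τ, y)) (dx h (τ, x)) x :=
  (hasFDerivAt_of_strip hh hz).comp_hasDerivAt x ((hasDerivAt_const x τ).prodMk (hasDerivAt_id x))

lemma dt_dx_comm (hh : ContDiffOn ℝ ∞ h (strip δ)) {z : ℝ × ℝ} (hz : z ∈ strip δ) :
    dt (dx h) z = dx (dt h) z :=
  fderiv_fderiv_apply_comm (isOpen_strip δ) hh hz _ _

/-- Iterated derivatives of the slices give no joint smoothness by themselves; iterates of the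
planar derivative `dx` do. The two claims form one induction, since differentiating the next slice
needs smoothness of the previous iterate. -/
lemma iteratedDeriv_eq_iterate_dx (hh : ContDiffOn ℝ ∞ h (strip δ)) (s : ℕ) :
    ContDiffOn ℝ ∞ (dx^[s] h) (strip δ) ∧ ∀ τ x, (τ, x) ∈ strip δ →
      iteratedDeriv s (fun y => h (τ, y)) x = (dx^[s] h) (τ, x) := by
  induction s with
  | zero => exact ⟨hh, fun _ _ _ => by simp⟩
  | succ s ih =>
    rw [Function.iterate_succ_apply']
    refine ⟨contDiffOn_dx ih.1, fun τ x hz => ?_⟩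
    rw [iteratedDeriv_succ, ← (hasDerivAt_dx ih.1 hz).deriv]
    refine congrArg (fun k => deriv k x) (funext fun y => ih.2 τ y ?_)
    simpa [mem_strip] using hz

lemma contDiff_slice (hh : ContDiffOn ℝ ∞ h (strip δ)) {τ : ℝ} (hτ : τ ∈ Ioo (-δ) δ) :
    ContDiff ℝ ∞ fun x => h (τ, x) := by
  refine contDiffOn_univ.1 (hh.comp (contDiff_const.prodMk contDiff_id).contDiffOn ?_)
  intro x _
  exact mem_strip.2 hτ

/-- Differentiation under the integral sign. -/
lemma hasDerivAt_integral_strip (hδ : 0 < δ) (hh : ContDiffOn ℝ ∞ h (strip δ)) :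
    HasDerivAt (fun τ => ∫ x in (0 : ℝ)..1, h (τ, x)) (∫ x in (0 : ℝ)..1, dt h (0, x)) 0 := by
  have hcont : ∀ τ ∈ Ioo (-δ) δ, Continuous fun x => h (τ, x) :=
    fun τ hτ => (contDiff_slice hh hτ).continuous
  -- Halving the strip places the rectangle compactly inside it, so a constant dominates the
  -- parameter derivative.
  have hK : IsCompact (Icc (-(δ / 2)) (δ / 2) ×ˢ Icc (0 : ℝ) 1) := isCompact_Icc.prod isCompact_Icc
  have hKs : Icc (-(δ / 2)) (δ / 2) ×ˢ Icc (0 : ℝ) 1 ⊆ strip δ := by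
    rintro ⟨τ, x⟩ ⟨h1, -⟩
    simp only [mem_strip, mem_Ioo, mem_Icc] at h1 ⊢
    exact ⟨by linarith, by linarith⟩
  obtain ⟨B, hB⟩ := hK.exists_bound_of_continuousOn ((contDiffOn_dt hh).continuousOn.mono hKs)
  have hI : Ioo (-(δ / 2)) (δ / 2) ∈ 𝓝 (0 : ℝ) := Ioo_mem_nhds (by linarith) (by linarith)
  have hsub : Ioo (-(δ / 2)) (δ / 2) ⊆ Ioo (-δ) δ := Ioo_subset_Ioo (by linarith) (by linarith)
  refine (intervalIntegral.hasDerivAt_integral_of_dominated_loc_of_deriv_le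
    (F := fun τ x => h (τ, x)) (F' := fun τ x => dt h (τ, x)) (bound := fun _ => B)
    hI ?_ ?_ ?_ ?_ ?_ ?_).2
  · filter_upwards [hI] with τ hτ
    exact (hcont τ (hsub hτ)).aestronglyMeasurable
  · exact (hcont 0 (by simp [hδ])).intervalIntegrable _ _
  · exact (contDiff_slice (contDiffOn_dt hh) (τ := 0) (by simp [hδ])).continuous.aestronglyMeasurable
  · refine Eventually.of_forall fun x hx τ hτ => hB (τ, x) ⟨Ioo_subset_Icc_self hτ, ?_⟩
    rw [uIoc_of_le zero_le_one] at hx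
    exact Ioc_subset_Icc_self hx
  · exact intervalIntegrable_const
  · exact Eventually.of_forall fun x _ τ hτ => hasDerivAt_dt hh (mem_strip.2 (hsub hτ))

end families

lemma SmoothPeriodic.variation {u φ : ℝ → Fin n → ℝ} (hu : SmoothPeriodic u)
    (hφ : SmoothPeriodic φ) (τ : ℝ) : SmoothPeriodic (u + τ • φ) :=
  ⟨hu.smooth.add (hφ.smooth.const_smul τ), fun x => by
    simp only [Pi.add_apply, Pi.smul_apply, hu.periodic x, hφ.periodic x]⟩

/-- Small variations of a loop of an open set are loops of this set. -/
lemma IsLoop.exists_variation {U : Set (Fin n → ℝ)} (hU : IsOpen U) {u φ : ℝ → Fin n → ℝ}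
    (hu : IsLoop U u) (hφ : SmoothPeriodic φ) :
    ∃ δ : ℝ, 0 < δ ∧ ∀ τ ∈ Ioo (-δ) δ, IsLoop U (u + τ • φ) := by
  have hc : Continuous fun z : ℝ × ℝ => u z.2 + z.1 • φ z.2 :=
    (hu.smooth.continuous.comp continuous_snd).add
      (continuous_fst.smul (hφ.smooth.continuous.comp continuous_snd))
  -- The tube lemma over one period gives a `δ` uniform in `x`; periodicity carries the conclusion
  -- to the whole line through `Int.fract`.
  obtain ⟨V, W, hV, -, h0, h1, hVW⟩ := generalized_tube_lemma (isCompact_singleton (x := (0 : ℝ)))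
    (isCompact_Icc (a := (0 : ℝ)) (b := 1)) (hU.preimage hc) (by
      rintro ⟨τ, x⟩ ⟨hτ, -⟩
      obtain rfl : τ = 0 := hτ
      simpa using hu.mem x)
  obtain ⟨δ, hδ, hδV⟩ := Metric.isOpen_iff.1 hV 0 (h0 rfl)
  refine ⟨δ, hδ, fun τ hτ => ⟨hu.toSmoothPeriodic.variation hφ τ, fun x => ?_⟩⟩
  have hper := (hu.toSmoothPeriodic.variation hφ τ).periodic
  have hτV : τ ∈ V := hδV (by rw [Real.ball_eq_Ioo]; simpa using hτ)
  have h2 : u (Int.fract x) + τ • φ (Int.fract x) ∈ U :=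
    hVW (a := (τ, Int.fract x)) ⟨hτV, h1 ⟨Int.fract_nonneg x, (Int.fract_lt_one x).le⟩⟩
  have h3 : (u + τ • φ) (Int.fract x) = (u + τ • φ) x := by
    have := hper.sub_zsmul_eq (x := x) ⌊x⌋
    rwa [zsmul_one] at this
  rw [← h3]
  exact h2

/-! ### Variational derivatives -/

/-- Since covector fields and variations have the same regularity, the difference of two candidates
is itself an admissible variation. Testing against it shows that its square integrates to zero. -/
lemma HasVarDeriv.unique {F : Functional n} {u p q : ℝ → Fin n → ℝ} (hp : HasVarDeriv F u p)
    (hq : HasVarDeriv F u q) : p = q := by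
  have hsp := smoothPeriodic_iff.1 hp.smoothPeriodic
  have hsq := smoothPeriodic_iff.1 hq.smoothPeriodic
  set φ : ℝ → Fin n → ℝ := fun x i => p x i - q x i with hφ
  have hφs : SmoothPeriodic φ := smoothPeriodic_iff.2 fun i => (hsp i).sub (hsq i)
  have h1 := (hp.hasDerivAt φ hφs).unique (hq.hasDerivAt φ hφs)
  have hcp : Continuous fun x => ∑ i, p x i * φ x i :=
    (PeriodicSmooth.sum fun i _ => (hsp i).mul (hφs.apply i)).continuous
  have hcq : Continuous fun x => ∑ i, q x i * φ x i :=
    (PeriodicSmooth.sum fun i _ => (hsq i).mul (hφs.apply i)).continuous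
  have hc : PeriodicSmooth fun x => ∑ i, φ x i * φ x i :=
    PeriodicSmooth.sum fun i _ => (hφs.apply i).mul (hφs.apply i)
  have h2 : ∫ x in (0 : ℝ)..1, ∑ i, φ x i * φ x i = 0 := by
    rw [← sub_eq_zero, ← intervalIntegral.integral_sub (hcp.intervalIntegrable _ _)
      (hcq.intervalIntegrable _ _)] at h1
    refine Eq.trans ?_ h1
    refine intervalIntegral.integral_congr fun x _ => ?_
    simp only [← Finset.sum_sub_distrib, hφ]
    exact Finset.sum_congr rfl fun i _ => by ring
  have hnn : ∀ x, 0 ≤ ∑ i, φ x i * φ x i := fun x => Finset.sum_nonneg fun i _ => mul_self_nonneg _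
  have h3 : ∀ x ∈ Ico (0 : ℝ) 1, ∑ i, φ x i * φ x i = 0 := by
    intro x hx
    by_contra hne
    have hpos : 0 < ∫ x in (0 : ℝ)..1, ∑ i, φ x i * φ x i :=
      intervalIntegral.integral_pos zero_lt_one hc.continuous.continuousOn (fun x _ => hnn x)
        ⟨x, Ico_subset_Icc_self hx, lt_of_le_of_ne (hnn x) (Ne.symm hne)⟩
    exact hpos.ne' h2
  funext x i
  have h4 : ∑ i, φ x i * φ x i = 0 := by
    have := hc.periodic.sub_zsmul_eq (x := x) ⌊x⌋
    rw [zsmul_one] at this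
    rw [← this]
    exact h3 _ ⟨Int.fract_nonneg x, Int.fract_lt_one x⟩
  have h5 := (Finset.sum_eq_zero_iff_of_nonneg fun i _ => mul_self_nonneg (φ x i)).1 h4 i
    (Finset.mem_univ i)
  have h6 : φ x i = 0 := mul_self_eq_zero.1 h5
  exact sub_eq_zero.1 h6

lemma HasVarDeriv.varDeriv_eq {F : Functional n} {u p : ℝ → Fin n → ℝ} (hp : HasVarDeriv F u p) :
    varDeriv F u = p := by
  have h : ∃ p, HasVarDeriv F u p := ⟨p, hp⟩
  rw [varDeriv, dif_pos h]
  exact h.choose_spec.unique hp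

end

section

variable {n : ℕ}

/-! ### Variations of variational derivatives -/

/-- The variational derivative of `F` along the variation `u + τ φ`, as a function of `(τ, x)`. -/
def varFamily (F : Functional n) (u φ : ℝ → Fin n → ℝ) (i : Fin n) (z : ℝ × ℝ) : ℝ :=
  varDeriv F (u + z.1 • φ) z.2 i

/-- The derivative of the variational derivative of `F` at `u` in the direction `φ`. -/
def secondVar (F : Functional n) (u φ : ℝ → Fin n → ℝ) (x : ℝ) (i : Fin n) : ℝ :=
  dt (varFamily F u φ i) (0, x)

/-- Functionals whose variational derivatives exist and depend smoothly on the loop, with symmetric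
second variation. -/
structure IsRegular (U : Set (Fin n → ℝ)) (F : Functional n) : Prop where
  hasVarDeriv : ∀ u, IsLoop U u → HasVarDeriv F u (varDeriv F u)
  smooth : ∀ u φ, IsLoop U u → SmoothPeriodic φ → ∃ δ : ℝ, 0 < δ ∧
    (∀ τ ∈ Ioo (-δ) δ, IsLoop U (u + τ • φ)) ∧
      ∀ i, ContDiffOn ℝ ∞ (varFamily F u φ i) (strip δ)
  symm : ∀ u φ ψ, IsLoop U u → SmoothPeriodic φ → SmoothPeriodic ψ →
    ∫ x in (0 : ℝ)..1, ∑ i, secondVar F u φ x i * ψ x i =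
      ∫ x in (0 : ℝ)..1, ∑ i, secondVar F u ψ x i * φ x i

/-! ### Local functionals -/

section jets

variable {N : ℕ}

/-- The jet of order `N` of a loop. -/
def jet (N : ℕ) (u : ℝ → Fin n → ℝ) (x : ℝ) : Fin (N + 1) → Fin n → ℝ :=
  fun s => iteratedDeriv (s : ℕ) u x

lemma SmoothPeriodic.contDiff_jet {u : ℝ → Fin n → ℝ} (hu : SmoothPeriodic u) :
    ContDiff ℝ ∞ (jet N u) :=
  contDiff_pi.2 fun s => (hu.iteratedDeriv s).smooth

lemma SmoothPeriodic.jet_periodic {u : ℝ → Fin n → ℝ} (hu : SmoothPeriodic u) (x : ℝ) :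
    jet N u (x + 1) = jet N u x :=
  funext fun s => (hu.iteratedDeriv s).periodic x

lemma SmoothPeriodic.jet_apply {u : ℝ → Fin n → ℝ} (hu : SmoothPeriodic u) (x : ℝ)
    (s : Fin (N + 1)) (i : Fin n) :
    jet N u x s i = _root_.iteratedDeriv (s : ℕ) (fun y => u y i) x :=
  hu.iteratedDeriv_apply s x i

/-- Jets are linear in the loop, so a variation moves a jet along a straight line. This is what
makes the parameter derivative of a density a single value of its differential. -/
lemma jet_variation {u φ : ℝ → Fin n → ℝ} (hu : SmoothPeriodic u) (hφ : SmoothPeriodic φ)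
    (τ x : ℝ) : jet N (u + τ • φ) x = jet N u x + τ • jet N φ x := by
  funext s
  have h1 : ContDiffAt ℝ (s : ℕ) u x := hu.smooth.contDiffAt.of_le (by exact_mod_cast le_top)
  have h2 : ContDiffAt ℝ (s : ℕ) φ x := hφ.smooth.contDiffAt.of_le (by exact_mod_cast le_top)
  have h3 : ContDiffAt ℝ (s : ℕ) (τ • φ) x := h2.const_smul τ
  simp only [jet, Pi.add_apply, Pi.smul_apply]
  rw [iteratedDeriv_add h1 h3, iteratedDeriv_const_smul_field]

/-- The domain of the densities. -/
def jetDomain (N : ℕ) (U : Set (Fin n → ℝ)) : Set (ℝ × (Fin (N + 1) → Fin n → ℝ)) := {z | z.2 0 ∈ U}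

lemma isOpen_jetDomain {U : Set (Fin n → ℝ)} (hU : IsOpen U) : IsOpen (jetDomain N U) :=
  hU.preimage ((continuous_apply 0).comp continuous_snd)

lemma IsLoop.jet_mem {U : Set (Fin n → ℝ)} {u : ℝ → Fin n → ℝ} (hu : IsLoop U u) (x : ℝ) :
    (x, jet N u x) ∈ jetDomain N U := by
  simpa [jetDomain, jet] using hu.mem x

variable {U : Set (Fin n → ℝ)} {u φ : ℝ → Fin n → ℝ} {δ : ℝ}
  {f : ℝ × (Fin (N + 1) → Fin n → ℝ) → ℝ}

lemma contDiff_jet_family (hu : SmoothPeriodic u) (hφ : SmoothPeriodic φ) :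
    ContDiff ℝ ∞ fun z : ℝ × ℝ => (z.2, jet N (u + z.1 • φ) z.2) := by
  simp only [jet_variation hu hφ]
  exact contDiff_snd.prodMk ((hu.contDiff_jet.comp contDiff_snd).add
    (contDiff_fst.smul (hφ.contDiff_jet.comp contDiff_snd)))

lemma contDiffOn_comp_jet (hf : ContDiffOn ℝ ∞ f (jetDomain N U)) (hu : SmoothPeriodic u)
    (hφ : SmoothPeriodic φ) (hloop : ∀ τ ∈ Ioo (-δ) δ, IsLoop U (u + τ • φ)) :
    ContDiffOn ℝ ∞ (fun z : ℝ × ℝ => f (z.2, jet N (u + z.1 • φ) z.2)) (strip δ) :=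
  hf.comp (contDiff_jet_family hu hφ).contDiffOn
    fun z hz => (hloop z.1 (mem_strip.1 hz)).jet_mem z.2

lemma dt_comp_jet (hU : IsOpen U) (hf : ContDiffOn ℝ ∞ f (jetDomain N U)) (hu : SmoothPeriodic u)
    (hφ : SmoothPeriodic φ) (hloop : ∀ τ ∈ Ioo (-δ) δ, IsLoop U (u + τ • φ)) {τ x : ℝ}
    (hz : (τ, x) ∈ strip δ) :
    dt (fun z : ℝ × ℝ => f (z.2, jet N (u + z.1 • φ) z.2)) (τ, x) =
      fderiv ℝ f (x, jet N (u + τ • φ) x) (0, jet N φ x) := by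
  have h1 := hasDerivAt_dt (contDiffOn_comp_jet hf hu hφ hloop) hz
  have h2 : HasFDerivAt f (fderiv ℝ f (x, jet N (u + τ • φ) x)) (x, jet N (u + τ • φ) x) :=
    ((hf.contDiffAt ((isOpen_jetDomain hU).mem_nhds
      ((hloop τ (mem_strip.1 hz)).jet_mem x))).differentiableAt (by simp)).hasFDerivAt
  have h3 : HasDerivAt (fun t => (x, jet N (u + t • φ) x)) (0, jet N φ x) τ := by
    simp only [jet_variation hu hφ]
    refine (hasDerivAt_const τ x).prodMk ?_
    simpa using ((hasDerivAt_id τ).smul_const (jet N φ x)).const_add (jet N u x)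
  exact h1.unique (h2.comp_hasDerivAt τ h3)

/-- The partial derivative of a density with respect to the `s`-th derivative of `u^i`. -/
def jetPartial (f : ℝ × (Fin (N + 1) → Fin n → ℝ) → ℝ) (s : Fin (N + 1)) (i : Fin n)
    (z : ℝ × (Fin (N + 1) → Fin n → ℝ)) : ℝ :=
  fderiv ℝ f z (0, Pi.single s (Pi.single i 1))

lemma fderiv_eq_sum_jetPartial (f : ℝ × (Fin (N + 1) → Fin n → ℝ) → ℝ)
    (z : ℝ × (Fin (N + 1) → Fin n → ℝ)) (v : Fin (N + 1) → Fin n → ℝ) :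
    fderiv ℝ f z (0, v) = ∑ s, ∑ i, jetPartial f s i z * v s i := by
  have hv : ((0 : ℝ), v) = ∑ s, ∑ i, v s i • ((0 : ℝ),
      (Pi.single s (Pi.single i 1) : Fin (N + 1) → Fin n → ℝ)) := by
    refine Prod.ext (by simp [Prod.fst_sum]) ?_
    funext s i
    simp only [Prod.snd_sum, Prod.smul_snd, Finset.sum_apply, Pi.smul_apply, smul_eq_mul]
    rw [Finset.sum_eq_single s (fun t _ ht => Finset.sum_eq_zero fun j _ => by
      rw [Pi.single_eq_of_ne ht.symm]; simp) (by simp)]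
    simp [Pi.single_apply]
  rw [hv]
  simp only [map_sum, map_smul, smul_eq_mul, jetPartial]
  exact Finset.sum_congr rfl fun s _ => Finset.sum_congr rfl fun i _ => mul_comm _ _

lemma contDiffOn_jetPartial (hU : IsOpen U) (hf : ContDiffOn ℝ ∞ f (jetDomain N U))
    (s : Fin (N + 1)) (i : Fin n) : ContDiffOn ℝ ∞ (jetPartial f s i) (jetDomain N U) :=
  contDiffOn_fderiv_apply (isOpen_jetDomain hU) hf _

lemma jetPartial_periodic (hf : ∀ x v, f (x + 1, v) = f (x, v)) (s : Fin (N + 1)) (i : Fin n)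
    (x : ℝ) (v : Fin (N + 1) → Fin n → ℝ) : jetPartial f s i (x + 1, v) = jetPartial f s i (x, v) := by
  have h := fderiv_comp_add_right (𝕜 := ℝ) (f := f) (x := (x, v))
    (((1 : ℝ), 0) : ℝ × (Fin (N + 1) → Fin n → ℝ))
  have h2 : (fun z => f (z + ((1 : ℝ), 0))) = f := by
    funext z
    rw [show z + ((1 : ℝ), 0) = (z.1 + 1, z.2) from Prod.ext rfl (add_zero _)]
    exact hf z.1 z.2
  rw [h2] at h
  simp only [jetPartial]
  rw [h]
  simp

lemma periodicSmooth_comp_jet (hU : IsOpen U) (hf : ContDiffOn ℝ ∞ f (jetDomain N U))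
    (hp : ∀ x v, f (x + 1, v) = f (x, v)) (hu : IsLoop U u) :
    PeriodicSmooth fun x => f (x, jet N u x) := by
  refine ⟨contDiff_iff_contDiffAt.2 fun x => ?_, fun x => by
    simp only [hp, hu.toSmoothPeriodic.jet_periodic]⟩
  exact (hf.contDiffAt ((isOpen_jetDomain hU).mem_nhds (hu.jet_mem x))).comp x
    (contDiff_id.prodMk hu.toSmoothPeriodic.contDiff_jet).contDiffAt

/-- The Euler-Lagrange expression of a density. -/
def euler (f : ℝ × (Fin (N + 1) → Fin n → ℝ) → ℝ) (u : ℝ → Fin n → ℝ) (x : ℝ) (i : Fin n) : ℝ :=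
  ∑ s : Fin (N + 1), (-1) ^ (s : ℕ) *
    iteratedDeriv (s : ℕ) (fun y => jetPartial f s i (y, jet N u y)) x

lemma smoothPeriodic_euler (hU : IsOpen U) (hf : ContDiffOn ℝ ∞ f (jetDomain N U))
    (hp : ∀ x v, f (x + 1, v) = f (x, v)) (hu : IsLoop U u) : SmoothPeriodic (euler f u) :=
  smoothPeriodic_iff.2 fun i => PeriodicSmooth.sum fun s _ => (PeriodicSmooth.const _).mul
    ((periodicSmooth_comp_jet hU (contDiffOn_jetPartial hU hf s i)
      (jetPartial_periodic hp s i) hu).iteratedDeriv s)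

/-- The first variation formula. -/
lemma integral_fderiv_jet (hU : IsOpen U) (hf : ContDiffOn ℝ ∞ f (jetDomain N U))
    (hp : ∀ x v, f (x + 1, v) = f (x, v)) (hu : IsLoop U u) (hφ : SmoothPeriodic φ) :
    ∫ x in (0 : ℝ)..1, fderiv ℝ f (x, jet N u x) (0, jet N φ x) =
      ∫ x in (0 : ℝ)..1, ∑ i, euler f u x i * φ x i := by
  have h1 : ∀ s i, PeriodicSmooth fun x => jetPartial f s i (x, jet N u x) := fun s i =>
    periodicSmooth_comp_jet hU (contDiffOn_jetPartial hU hf s i) (jetPartial_periodic hp s i) hu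
  simp only [fderiv_eq_sum_jetPartial, hφ.jet_apply, euler, Finset.sum_mul]
  have h2 : ∀ s i, PeriodicSmooth fun x => jetPartial f s i (x, jet N u x) *
      iteratedDeriv (s : ℕ) (fun y => φ y i) x :=
    fun s i => (h1 s i).mul ((hφ.apply i).iteratedDeriv s)
  have h3 : ∀ (s : Fin (N + 1)) i, PeriodicSmooth fun x => (-1) ^ (s : ℕ) *
      iteratedDeriv (s : ℕ) (fun y => jetPartial f s i (y, jet N u y)) x * φ x i :=
    fun s i => ((PeriodicSmooth.const _).mul ((h1 s i).iteratedDeriv s)).mul (hφ.apply i)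
  rw [PeriodicSmooth.integral_sum fun s _ => PeriodicSmooth.sum fun i _ => h2 s i,
    PeriodicSmooth.integral_sum fun i _ => PeriodicSmooth.sum fun s _ => h3 s i,
    Finset.sum_congr rfl fun s _ => PeriodicSmooth.integral_sum fun i _ => h2 s i,
    Finset.sum_congr rfl fun i _ => PeriodicSmooth.integral_sum fun s _ => h3 s i,
    Finset.sum_comm]
  exact Finset.sum_congr rfl fun i _ => Finset.sum_congr rfl fun s _ =>
    (h1 s i).integral_mul_iteratedDeriv (hφ.apply i) s

lemma contDiffOn_euler_family (hU : IsOpen U) (hf : ContDiffOn ℝ ∞ f (jetDomain N U))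
    (hu : SmoothPeriodic u) (hφ : SmoothPeriodic φ)
    (hloop : ∀ τ ∈ Ioo (-δ) δ, IsLoop U (u + τ • φ)) (i : Fin n) :
    ContDiffOn ℝ ∞ (fun z : ℝ × ℝ => euler f (u + z.1 • φ) z.2 i) (strip δ) := by
  refine ContDiffOn.sum fun s _ => contDiffOn_const.mul ?_
  have h := iteratedDeriv_eq_iterate_dx
    (contDiffOn_comp_jet (contDiffOn_jetPartial hU hf s i) hu hφ hloop) s
  exact h.1.congr fun z hz => h.2 z.1 z.2 hz

lemma jetPartial_comm (hU : IsOpen U) (hf : ContDiffOn ℝ ∞ f (jetDomain N U))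
    {z : ℝ × (Fin (N + 1) → Fin n → ℝ)} (hz : z ∈ jetDomain N U) (s t : Fin (N + 1))
    (i j : Fin n) :
    jetPartial (jetPartial f s i) t j z = jetPartial (jetPartial f t j) s i z :=
  fderiv_fderiv_apply_comm (isOpen_jetDomain hU) hf hz _ _

/-- The second variation of the functional with density `f`. -/
def sndVariation (f : ℝ × (Fin (N + 1) → Fin n → ℝ) → ℝ) (u φ ψ : ℝ → Fin n → ℝ) (x : ℝ) : ℝ :=
  ∑ s, ∑ i, (∑ t, ∑ j, jetPartial (jetPartial f s i) t j (x, jet N u x) * jet N φ x t j) *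
    jet N ψ x s i

/-- Symmetry of the Hessian of the density in the jet variables, after exchanging the index pairs
`(s, i)` and `(t, j)`. -/
lemma sndVariation_comm (hU : IsOpen U) (hf : ContDiffOn ℝ ∞ f (jetDomain N U))
    (hu : IsLoop U u) (φ ψ : ℝ → Fin n → ℝ) (x : ℝ) :
    sndVariation f u φ ψ x = sndVariation f u ψ φ x := by
  simp only [sndVariation, Finset.sum_mul]
  have e1 : ∀ g : Fin (N + 1) → Fin n → Fin (N + 1) → Fin n → ℝ,
      ∑ s, ∑ i, ∑ t, ∑ j, g s i t j = ∑ s, ∑ i, ∑ t, ∑ j, g t j s i := by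
    intro g
    have h := Finset.sum_comm (s := Finset.univ ×ˢ Finset.univ)
      (t := Finset.univ ×ˢ Finset.univ) (f := fun a b => g a.1 a.2 b.1 b.2)
    simpa only [Finset.sum_product] using h
  rw [e1]
  refine Finset.sum_congr rfl fun s _ => Finset.sum_congr rfl fun i _ =>
    Finset.sum_congr rfl fun t _ => Finset.sum_congr rfl fun j _ => ?_
  rw [jetPartial_comm hU hf (hu.jet_mem x)]
  ring

/-- The first variation at `u + τ φ` in the direction `ψ` has two expressions, before and after
integration by parts. Differentiating both at `τ = 0` identifies the variation of the Euler-Lagrange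
expression with the Hessian of the density, where symmetry is visible. -/
lemma integral_dt_euler (hU : IsOpen U) (hf : ContDiffOn ℝ ∞ f (jetDomain N U))
    (hp : ∀ x v, f (x + 1, v) = f (x, v)) {ψ : ℝ → Fin n → ℝ} (hu : SmoothPeriodic u)
    (hφ : SmoothPeriodic φ) (hψ : SmoothPeriodic ψ) (hδ : 0 < δ)
    (hloop : ∀ τ ∈ Ioo (-δ) δ, IsLoop U (u + τ • φ)) :
    ∫ x in (0 : ℝ)..1, ∑ i, dt (fun z : ℝ × ℝ => euler f (u + z.1 • φ) z.2 i) (0, x) * ψ x i =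
      ∫ x in (0 : ℝ)..1, sndVariation f u φ ψ x := by
  have hsm := contDiffOn_euler_family hU hf hu hφ hloop
  have hpart : ∀ s i, ContDiffOn ℝ ∞ (fun z : ℝ × ℝ =>
      jetPartial f s i (z.2, jet N (u + z.1 • φ) z.2)) (strip δ) := fun s i =>
    contDiffOn_comp_jet (contDiffOn_jetPartial hU hf s i) hu hφ hloop
  have hψ' : ∀ s i, ContDiff ℝ ∞ fun z : ℝ × ℝ => jet N ψ z.2 s i := fun s i =>
    (contDiff_pi.1 (contDiff_pi.1 hψ.contDiff_jet s) i).comp contDiff_snd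
  have hc1 : ContDiffOn ℝ ∞ (fun z : ℝ × ℝ => ∑ i, euler f (u + z.1 • φ) z.2 i * ψ z.2 i)
      (strip δ) :=
    ContDiffOn.sum fun i _ => (hsm i).mul ((hψ.apply i).smooth.comp contDiff_snd).contDiffOn
  have hc2 : ContDiffOn ℝ ∞ (fun z : ℝ × ℝ => ∑ s, ∑ i,
      jetPartial f s i (z.2, jet N (u + z.1 • φ) z.2) * jet N ψ z.2 s i) (strip δ) :=
    ContDiffOn.sum fun s _ => ContDiffOn.sum fun i _ => (hpart s i).mul (hψ' s i).contDiffOn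
  have h1 := hasDerivAt_integral_strip hδ hc1
  have h2 := hasDerivAt_integral_strip hδ hc2
  have h3 : ∀ x, dt (fun z : ℝ × ℝ => ∑ i, euler f (u + z.1 • φ) z.2 i * ψ z.2 i) (0, x) =
      ∑ i, dt (fun z : ℝ × ℝ => euler f (u + z.1 • φ) z.2 i) (0, x) * ψ x i := fun x =>
    (hasDerivAt_dt hc1 (zero_mem_strip hδ x)).unique <| HasDerivAt.fun_sum fun i _ =>
      (hasDerivAt_dt (hsm i) (zero_mem_strip hδ x)).mul_const (ψ x i)
  have h4 : ∀ x, dt (fun z : ℝ × ℝ => ∑ s, ∑ i,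
      jetPartial f s i (z.2, jet N (u + z.1 • φ) z.2) * jet N ψ z.2 s i) (0, x) =
      sndVariation f u φ ψ x := fun x => by
    refine (hasDerivAt_dt hc2 (zero_mem_strip hδ x)).unique ?_
    refine HasDerivAt.fun_sum fun s _ => HasDerivAt.fun_sum fun i _ => ?_
    have h5 := (hasDerivAt_dt (hpart s i) (zero_mem_strip hδ x)).mul_const (jet N ψ x s i)
    rwa [dt_comp_jet hU (contDiffOn_jetPartial hU hf s i) hu hφ hloop (zero_mem_strip hδ x),
      fderiv_eq_sum_jetPartial, zero_smul, add_zero] at h5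
  simp only [h3] at h1
  simp only [h4] at h2
  refine h1.unique (h2.congr_of_eventuallyEq ?_)
  filter_upwards [Ioo_mem_nhds (neg_neg_of_pos hδ) hδ] with τ hτ
  rw [← integral_fderiv_jet hU hf hp (hloop τ hτ) hψ]
  simp only [fderiv_eq_sum_jetPartial]

/-- Local functionals are regular. -/
lemma IsLocal.isRegular (hU : IsOpen U) {F : Functional n} (hF : IsLocal U F) : IsRegular U F := by
  obtain ⟨N, f, hf, hp, hFf⟩ := hF
  replace hf : ContDiffOn ℝ ∞ f (jetDomain N U) := hf
  replace hFf : ∀ u, IsLoop U u → F u = ∫ x in (0 : ℝ)..1, f (x, jet N u x) := hFf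
  have hvar : ∀ u, IsLoop U u → HasVarDeriv F u (euler f u) := by
    refine fun u hu => ⟨smoothPeriodic_euler hU hf hp hu, fun φ hφ => ?_⟩
    obtain ⟨δ, hδ, hloop⟩ := hu.exists_variation hU hφ
    have h := hasDerivAt_integral_strip hδ
      (contDiffOn_comp_jet hf hu.toSmoothPeriodic hφ hloop)
    rw [← integral_fderiv_jet hU hf hp hu hφ]
    have h2 : ∀ x, dt (fun z : ℝ × ℝ => f (z.2, jet N (u + z.1 • φ) z.2)) (0, x) =
        fderiv ℝ f (x, jet N u x) (0, jet N φ x) := fun x => by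
      rw [dt_comp_jet hU hf hu.toSmoothPeriodic hφ hloop (zero_mem_strip hδ x)]
      simp
    simp only [h2] at h
    refine h.congr_of_eventuallyEq ?_
    filter_upwards [Ioo_mem_nhds (neg_neg_of_pos hδ) hδ] with τ hτ
    exact hFf _ (hloop τ hτ)
  have heq : ∀ u, IsLoop U u → varDeriv F u = euler f u := fun u hu => (hvar u hu).varDeriv_eq
  have hsm : ∀ u φ, IsLoop U u → SmoothPeriodic φ → ∃ δ : ℝ, 0 < δ ∧
    (∀ τ ∈ Ioo (-δ) δ, IsLoop U (u + τ • φ)) ∧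
      ∀ i, ContDiffOn ℝ ∞ (varFamily F u φ i) (strip δ) := by
    intro u φ hu hφ
    obtain ⟨δ, hδ, hloop⟩ := hu.exists_variation hU hφ
    refine ⟨δ, hδ, hloop, fun i => ?_⟩
    refine (contDiffOn_euler_family hU hf hu.toSmoothPeriodic hφ hloop i).congr fun z hz => ?_
    rw [varFamily, heq _ (hloop z.1 (mem_strip.1 hz))]
  have hsnd : ∀ u φ ψ, IsLoop U u → SmoothPeriodic φ → SmoothPeriodic ψ →
      ∫ x in (0 : ℝ)..1, ∑ i, secondVar F u φ x i * ψ x i =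
        ∫ x in (0 : ℝ)..1, sndVariation f u φ ψ x := by
    intro u φ ψ hu hφ hψ
    obtain ⟨δ, hδ, hloop⟩ := hu.exists_variation hU hφ
    rw [← integral_dt_euler hU hf hp hu.toSmoothPeriodic hφ hψ hδ hloop]
    refine intervalIntegral.integral_congr fun x _ => Finset.sum_congr rfl fun i _ => ?_
    -- The two families agree only where the varied curve stays in `U`; agreement on the open strip
    -- is enough for their derivatives to coincide.
    have h : varFamily F u φ i =ᶠ[𝓝 (0, x)] fun z : ℝ × ℝ => euler f (u + z.1 • φ) z.2 i := by
      filter_upwards [(isOpen_strip δ).mem_nhds (zero_mem_strip hδ x)] with z hz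
      rw [varFamily, heq _ (hloop z.1 (mem_strip.1 hz))]
    simp only [secondVar, dt, h.fderiv_eq]
  refine ⟨fun u hu => heq u hu ▸ hvar u hu, hsm, fun u φ ψ hu hφ hψ => ?_⟩
  rw [hsnd u φ ψ hu hφ hψ, hsnd u ψ φ hu hψ hφ]
  simp only [sndVariation_comm hU hf hu φ ψ]

end jets

end

/-! ### Componentwise derivatives of vector valued functions on the circle -/

section

variable {n : ℕ}

/-- The componentwise derivative of a vector valued function on the circle. -/
def ddx (p : ℝ → Fin n → ℝ) (x : ℝ) (i : Fin n) : ℝ := deriv (fun y => p y i) x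

lemma SmoothPeriodic.hasDerivAt_apply {p : ℝ → Fin n → ℝ} (hp : SmoothPeriodic p) (x : ℝ)
    (i : Fin n) : HasDerivAt (fun y => p y i) (ddx p x i) x :=
  (hp.apply i).hasDerivAt x

lemma SmoothPeriodic.ddx {p : ℝ → Fin n → ℝ} (hp : SmoothPeriodic p) : SmoothPeriodic (ddx p) :=
  smoothPeriodic_iff.2 fun i => (hp.apply i).deriv

lemma SmoothPeriodic.hasDerivAt {p : ℝ → Fin n → ℝ} (hp : SmoothPeriodic p) (x : ℝ) :
    HasDerivAt p (LoopPoisson.ddx p x) x :=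
  hasDerivAt_pi.2 fun i => hp.hasDerivAt_apply x i

lemma SmoothPeriodic.add {p q : ℝ → Fin n → ℝ} (hp : SmoothPeriodic p) (hq : SmoothPeriodic q) :
    SmoothPeriodic (p + q) :=
  smoothPeriodic_iff.2 fun i => (hp.apply i).add (hq.apply i)

lemma SmoothPeriodic.smul {p : ℝ → Fin n → ℝ} (hp : SmoothPeriodic p) (r : ℝ) :
    SmoothPeriodic (r • p) :=
  smoothPeriodic_iff.2 fun i => (PeriodicSmooth.const r).mul (hp.apply i)

lemma SmoothPeriodic.ddx_add {p q : ℝ → Fin n → ℝ} (hp : SmoothPeriodic p)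
    (hq : SmoothPeriodic q) : LoopPoisson.ddx (p + q) = LoopPoisson.ddx p + LoopPoisson.ddx q :=
  funext fun x => funext fun i =>
    ((hp.hasDerivAt_apply x i).add (hq.hasDerivAt_apply x i)).deriv

lemma SmoothPeriodic.ddx_smul {p : ℝ → Fin n → ℝ} (hp : SmoothPeriodic p) (r : ℝ) :
    LoopPoisson.ddx (r • p) = r • LoopPoisson.ddx p :=
  funext fun x => funext fun i => ((hp.hasDerivAt_apply x i).const_mul r).deriv

lemma SmoothPeriodic.dot {p q : ℝ → Fin n → ℝ} (hp : SmoothPeriodic p) (hq : SmoothPeriodic q) :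
    PeriodicSmooth fun x => ∑ i, p x i * q x i :=
  PeriodicSmooth.sum fun i _ => (hp.apply i).mul (hq.apply i)

lemma PeriodicSmooth.integral_add {f h : ℝ → ℝ} (hf : PeriodicSmooth f) (hh : PeriodicSmooth h) :
    ∫ x in (0 : ℝ)..1, (f x + h x) = (∫ x in (0 : ℝ)..1, f x) + ∫ x in (0 : ℝ)..1, h x :=
  intervalIntegral.integral_add (hf.intervalIntegrable _ _) (hh.intervalIntegrable _ _)

/-! ### Second variations along smooth families -/

lemma IsRegular.secondVar_smoothPeriodic {U : Set (Fin n → ℝ)} {F : Functional n}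
    (hF : IsRegular U F) {u φ : ℝ → Fin n → ℝ} (hu : IsLoop U u) (hφ : SmoothPeriodic φ) :
    SmoothPeriodic (secondVar F u φ) := by
  obtain ⟨δ, hδ, hloop, hsm⟩ := hF.smooth u φ hu hφ
  refine smoothPeriodic_iff.2 fun i => ⟨contDiff_slice (contDiffOn_dt (hsm i)) (by simp [hδ]),
    fun x => ?_⟩
  refine (hasDerivAt_dt (hsm i) (zero_mem_strip hδ (x + 1))).unique
    ((hasDerivAt_dt (hsm i) (zero_mem_strip hδ x)).congr_of_eventuallyEq ?_)
  filter_upwards [Ioo_mem_nhds (neg_neg_of_pos hδ) hδ] with τ hτ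
  exact ((hF.hasVarDeriv _ (hloop τ hτ)).smoothPeriodic.apply i).periodic x

/-! ### Operators given by first order densities -/

/-- The space of values `(u, u_x, p, p_x, q, q_x)`. -/
abbrev FormPoint (n : ℕ) : Type :=
  (Fin n → ℝ) × (Fin n → ℝ) × (Fin n → ℝ) × (Fin n → ℝ) × (Fin n → ℝ) × (Fin n → ℝ)

/-- The values `(u, u_x, p, p_x, q, q_x)` at a point of the circle. -/
def formPoint (u p q : ℝ → Fin n → ℝ) (x : ℝ) : FormPoint n :=
  (u x, ddx u x, p x, ddx p x, q x, ddx q x)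

/-- The points over `U`. -/
def formDomain (U : Set (Fin n → ℝ)) : Set (FormPoint n) := {z | z.1 ∈ U}

lemma isOpen_formDomain {U : Set (Fin n → ℝ)} (hU : IsOpen U) : IsOpen (formDomain U) :=
  hU.preimage continuous_fst

/-- Smooth densities on `U` which are bilinear in `(p, p_x)` and `(q, q_x)`. -/
structure IsFormDensity (U : Set (Fin n → ℝ)) (ℓ : FormPoint n → ℝ) : Prop where
  smooth : ContDiffOn ℝ ∞ ℓ (formDomain U)
  linear_left : ∀ w w' p p' s s' q q' : Fin n → ℝ, ∀ τ : ℝ,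
    ℓ (w, w', p + τ • s, p' + τ • s', q, q') = ℓ (w, w', p, p', q, q') + τ * ℓ (w, w', s, s', q, q')
  linear_right : ∀ w w' p p' q q' s s' : Fin n → ℝ, ∀ τ : ℝ,
    ℓ (w, w', p, p', q + τ • s, q' + τ • s') = ℓ (w, w', p, p', q, q') + τ * ℓ (w, w', p, p', s, s')

/-- The variation of the integral of a density in the direction `φ` of the loop. -/
def formVariation (ℓ : FormPoint n → ℝ) (u p q φ : ℝ → Fin n → ℝ) : ℝ :=
  ∫ x in (0 : ℝ)..1, fderiv ℝ ℓ (formPoint u p q x) (φ x, ddx φ x, 0, 0, 0, 0)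

/-- Antisymmetric operators `P` on the loop space of `U` with `∫ p_i P^{ij}(q_j) dx` given by a
density of first order. -/
structure HasFormDensity (U : Set (Fin n → ℝ)) (P : Operator n) (ℓ : FormPoint n → ℝ) : Prop
    extends IsFormDensity U ℓ where
  smoothPeriodic : ∀ u q, IsLoop U u → SmoothPeriodic q → SmoothPeriodic (P u q)
  integral_eq : ∀ u p q, IsLoop U u → SmoothPeriodic p → SmoothPeriodic q →
    ∫ x in (0 : ℝ)..1, ∑ i, p x i * P u q x i = ∫ x in (0 : ℝ)..1, ℓ (formPoint u p q x)
  antisymm : IsAntisymm U P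

/-! ### Variations of densities and brackets, and the Jacobiator -/

section density

variable {U : Set (Fin n → ℝ)} {ℓ : FormPoint n → ℝ} {u p q φ ψ : ℝ → Fin n → ℝ}

lemma IsLoop.formPoint_mem (hu : IsLoop U u) (p q : ℝ → Fin n → ℝ) (x : ℝ) :
    formPoint u p q x ∈ formDomain U := hu.mem x

lemma contDiff_formPoint (hu : SmoothPeriodic u) (hp : SmoothPeriodic p) (hq : SmoothPeriodic q) :
    ContDiff ℝ ∞ (formPoint u p q) :=
  hu.smooth.prodMk (hu.ddx.smooth.prodMk (hp.smooth.prodMk (hp.ddx.smooth.prodMk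
    (hq.smooth.prodMk hq.ddx.smooth))))

lemma periodicSmooth_comp_formPoint (hU : IsOpen U) (hℓ : ContDiffOn ℝ ∞ ℓ (formDomain U))
    (hu : IsLoop U u) (hp : SmoothPeriodic p) (hq : SmoothPeriodic q) :
    PeriodicSmooth fun x => ℓ (formPoint u p q x) := by
  refine ⟨contDiff_iff_contDiffAt.2 fun x => ?_, fun x => ?_⟩
  · exact (hℓ.contDiffAt ((isOpen_formDomain hU).mem_nhds (hu.formPoint_mem p q x))).comp x
      (contDiff_formPoint hu.toSmoothPeriodic hp hq).contDiffAt
  · simp only [formPoint, hu.periodic x, hp.periodic x, hq.periodic x,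
      hu.toSmoothPeriodic.ddx.periodic x, hp.ddx.periodic x, hq.ddx.periodic x]

lemma IsFormDensity.differentiableAt (hU : IsOpen U) (hℓ : IsFormDensity U ℓ) {z : FormPoint n}
    (hz : z ∈ formDomain U) : DifferentiableAt ℝ ℓ z :=
  (hℓ.smooth.contDiffAt ((isOpen_formDomain hU).mem_nhds hz)).differentiableAt (by simp)

/-- Along lines that change only `(p, p_x)` or only `(q, q_x)` the density is affine, so its
derivatives there are values of the density itself. Only the loop directions contribute a genuine
derivative. -/
lemma IsFormDensity.fderiv_eq (hU : IsOpen U) (hℓ : IsFormDensity U ℓ)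
    {w w' p p' q q' : Fin n → ℝ} (hw : w ∈ U) (v v' s s' t t' : Fin n → ℝ) :
    fderiv ℝ ℓ (w, w', p, p', q, q') (v, v', s, s', t, t') =
      fderiv ℝ ℓ (w, w', p, p', q, q') (v, v', 0, 0, 0, 0)
        + ℓ (w, w', s, s', q, q') + ℓ (w, w', p, p', t, t') := by
  have hd : HasFDerivAt ℓ (fderiv ℝ ℓ (w, w', p, p', q, q')) (w, w', p, p', q, q') :=
    (hℓ.differentiableAt hU (z := (w, w', p, p', q, q')) hw).hasFDerivAt
  have hline : ∀ e : FormPoint n,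
      HasDerivAt (fun τ : ℝ => (w, w', p, p', q, q') + τ • e) e 0 := fun e => by
    simpa using ((hasDerivAt_id (0 : ℝ)).smul_const e).const_add
      ((w, w', p, p', q, q') : FormPoint n)
  have hd' : ∀ e : FormPoint n, HasDerivAt (fun τ : ℝ => ℓ ((w, w', p, p', q, q') + τ • e))
      (fderiv ℝ ℓ (w, w', p, p', q, q') e) 0 := fun e =>
    HasFDerivAt.comp_hasDerivAt (0 : ℝ) (by simpa using hd) (hline e)
  have h1 : fderiv ℝ ℓ (w, w', p, p', q, q') (0, 0, s, s', 0, 0) = ℓ (w, w', s, s', q, q') := by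
    refine (hd' (0, 0, s, s', 0, 0)).unique ?_
    have : (fun τ : ℝ => ℓ ((w, w', p, p', q, q') + τ • (0, 0, s, s', 0, 0))) =
        fun τ => ℓ (w, w', p, p', q, q') + τ * ℓ (w, w', s, s', q, q') := by
      funext τ
      rw [← hℓ.linear_left]
      simp
    rw [this]
    simpa using ((hasDerivAt_id (0 : ℝ)).mul_const (ℓ (w, w', s, s', q, q'))).const_add
      (ℓ (w, w', p, p', q, q'))
  have h2 : fderiv ℝ ℓ (w, w', p, p', q, q') (0, 0, 0, 0, t, t') = ℓ (w, w', p, p', t, t') := by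
    refine (hd' (0, 0, 0, 0, t, t')).unique ?_
    have : (fun τ : ℝ => ℓ ((w, w', p, p', q, q') + τ • (0, 0, 0, 0, t, t'))) =
        fun τ => ℓ (w, w', p, p', q, q') + τ * ℓ (w, w', p, p', t, t') := by
      funext τ
      rw [← hℓ.linear_right]
      simp
    rw [this]
    simpa using ((hasDerivAt_id (0 : ℝ)).mul_const (ℓ (w, w', p, p', t, t'))).const_add
      (ℓ (w, w', p, p', q, q'))
  rw [← h1, ← h2, ← map_add, ← map_add]
  simp

lemma periodicSmooth_fderiv_formPoint (hU : IsOpen U) (hℓ : ContDiffOn ℝ ∞ ℓ (formDomain U))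
    (hu : IsLoop U u) (hp : SmoothPeriodic p) (hq : SmoothPeriodic q) (e : FormPoint n) :
    PeriodicSmooth fun x => fderiv ℝ ℓ (formPoint u p q x) e :=
  periodicSmooth_comp_formPoint hU (contDiffOn_fderiv_apply (isOpen_formDomain hU) hℓ e) hu hp hq

lemma fderiv_loop_eq_sum (L : FormPoint n →L[ℝ] ℝ) (v v' : Fin n → ℝ) :
    L (v, v', 0, 0, 0, 0) = ∑ i, L (Pi.single i 1, 0, 0, 0, 0, 0) * v i
      + ∑ i, L (0, Pi.single i 1, 0, 0, 0, 0) * v' i := by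
  have h1 : ((v, v', 0, 0, 0, 0) : FormPoint n) =
      ∑ i, v i • ((Pi.single i 1, 0, 0, 0, 0, 0) : FormPoint n)
        + ∑ i, v' i • ((0, Pi.single i 1, 0, 0, 0, 0) : FormPoint n) := by
    ext i <;> simp [Prod.fst_sum, Prod.snd_sum, Finset.sum_apply, Pi.single_apply]
  rw [h1]
  simp only [map_add, map_sum, map_smul, smul_eq_mul, mul_comm]

lemma periodicSmooth_formVariation (hU : IsOpen U) (hℓ : ContDiffOn ℝ ∞ ℓ (formDomain U))
    (hu : IsLoop U u) (hp : SmoothPeriodic p) (hq : SmoothPeriodic q) (hφ : SmoothPeriodic φ) :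
    PeriodicSmooth fun x =>
      fderiv ℝ ℓ (formPoint u p q x) (φ x, ddx φ x, 0, 0, 0, 0) := by
  rw [funext fun x => fderiv_loop_eq_sum (fderiv ℝ ℓ (formPoint u p q x)) (φ x) (ddx φ x)]
  exact (PeriodicSmooth.sum fun i _ =>
      (periodicSmooth_fderiv_formPoint hU hℓ hu hp hq _).mul (hφ.apply i)).add
    (PeriodicSmooth.sum fun i _ =>
      (periodicSmooth_fderiv_formPoint hU hℓ hu hp hq _).mul (hφ.ddx.apply i))

/-- The variation of a density has a formal adjoint. -/
lemma exists_formVariation_adjoint (hU : IsOpen U) (hℓ : ContDiffOn ℝ ∞ ℓ (formDomain U))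
    (hu : IsLoop U u) (hp : SmoothPeriodic p) (hq : SmoothPeriodic q) :
    ∃ B, SmoothPeriodic B ∧ ∀ φ, SmoothPeriodic φ →
      formVariation ℓ u p q φ = ∫ x in (0 : ℝ)..1, ∑ i, B x i * φ x i := by
  set α : ℝ → Fin n → ℝ := fun x i =>
    fderiv ℝ ℓ (formPoint u p q x) (Pi.single i 1, 0, 0, 0, 0, 0) with hα
  set γ : ℝ → Fin n → ℝ := fun x i =>
    fderiv ℝ ℓ (formPoint u p q x) (0, Pi.single i 1, 0, 0, 0, 0) with hγ
  have hαs : SmoothPeriodic α := smoothPeriodic_iff.2 fun i =>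
    periodicSmooth_fderiv_formPoint hU hℓ hu hp hq _
  have hγs : SmoothPeriodic γ := smoothPeriodic_iff.2 fun i =>
    periodicSmooth_fderiv_formPoint hU hℓ hu hp hq _
  -- This is the Euler operator in `u` with `p`, `q` held fixed: `α` is the partial derivative in
  -- `u`, and `γ`, the one in `u_x`, is integrated by parts.
  refine ⟨α + (-1 : ℝ) • ddx γ, hαs.add (hγs.ddx.smul _), fun φ hφ => ?_⟩
  have h1 : ∫ x in (0 : ℝ)..1, ∑ i, γ x i * ddx φ x i =
      ∫ x in (0 : ℝ)..1, ∑ i, ((-1 : ℝ) • ddx γ) x i * φ x i := by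
    rw [PeriodicSmooth.integral_sum fun i _ => (hγs.apply i).mul (hφ.ddx.apply i),
      PeriodicSmooth.integral_sum fun i _ => ((hγs.ddx.smul (-1)).apply i).mul (hφ.apply i)]
    refine Finset.sum_congr rfl fun i _ => ?_
    rw [show ∫ x in (0 : ℝ)..1, γ x i * ddx φ x i = -∫ x in (0 : ℝ)..1, ddx γ x i * φ x i from
      (hγs.apply i).integral_mul_deriv (hφ.apply i), ← intervalIntegral.integral_neg]
    simp
  calc formVariation ℓ u p q φ
      = ∫ x in (0 : ℝ)..1, (∑ i, α x i * φ x i + ∑ i, γ x i * ddx φ x i) :=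
        intervalIntegral.integral_congr fun x _ => fderiv_loop_eq_sum _ _ _
    _ = _ := by
        rw [(hαs.dot hφ).integral_add (hγs.dot hφ.ddx), h1,
          ← (hαs.dot hφ).integral_add ((hγs.ddx.smul (-1)).dot hφ)]
        simp only [Pi.add_apply, add_mul, Finset.sum_add_distrib]

/-- Needed to split the direction `P₁ r + ε P₂ r`. Linearity is inherited from the adjoint form of
the variation. -/
lemma formVariation_add_smul (hU : IsOpen U) (hℓ : ContDiffOn ℝ ∞ ℓ (formDomain U))
    (hu : IsLoop U u) (hp : SmoothPeriodic p) (hq : SmoothPeriodic q) (hφ : SmoothPeriodic φ)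
    (hψ : SmoothPeriodic ψ) (r : ℝ) :
    formVariation ℓ u p q (φ + r • ψ) =
      formVariation ℓ u p q φ + r * formVariation ℓ u p q ψ := by
  obtain ⟨B, hB, hBv⟩ := exists_formVariation_adjoint hU hℓ hu hp hq
  rw [hBv _ (hφ.add (hψ.smul r)), hBv _ hφ, hBv _ hψ, ← intervalIntegral.integral_const_mul,
    ← intervalIntegral.integral_add ((hB.dot hφ).intervalIntegrable _ _)
      (((PeriodicSmooth.const r).mul (hB.dot hψ)).intervalIntegrable _ _)]
  refine intervalIntegral.integral_congr fun x _ => ?_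
  simp only [Pi.add_apply, Pi.smul_apply, smul_eq_mul, Finset.mul_sum,
    ← Finset.sum_add_distrib]
  exact Finset.sum_congr rfl fun i _ => by ring

variable {P : Operator n} {F G H : Functional n}

lemma bracket_eq_integral (hP : HasFormDensity U P ℓ) (hF : IsRegular U F) (hG : IsRegular U G)
    (hu : IsLoop U u) : bracket P F G u =
      ∫ x in (0 : ℝ)..1, ℓ (formPoint u (varDeriv F u) (varDeriv G u) x) :=
  hP.integral_eq _ _ _ hu (hF.hasVarDeriv u hu).smoothPeriodic (hG.hasVarDeriv u hu).smoothPeriodic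

/-- The first variation of a bracket. -/
lemma hasDerivAt_bracket (hU : IsOpen U) (hP : HasFormDensity U P ℓ) (hF : IsRegular U F)
    (hG : IsRegular U G) (hu : IsLoop U u) (hφ : SmoothPeriodic φ) :
    HasDerivAt (fun τ : ℝ => bracket P F G (u + τ • φ))
      ((∫ x in (0 : ℝ)..1, ∑ i, secondVar F u (P u (varDeriv G u)) x i * φ x i)
        - (∫ x in (0 : ℝ)..1, ∑ i, secondVar G u (P u (varDeriv F u)) x i * φ x i)
        + formVariation ℓ u (varDeriv F u) (varDeriv G u) φ) 0 := by
  obtain ⟨δ₁, hδ₁, hloop₁, hF₁⟩ := hF.smooth u φ hu hφ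
  obtain ⟨δ₂, hδ₂, hloop₂, hG₂⟩ := hG.smooth u φ hu hφ
  set δ := min δ₁ δ₂
  have hδ : 0 < δ := lt_min hδ₁ hδ₂
  have hs₁ : strip δ ⊆ strip δ₁ := strip_mono (min_le_left _ _)
  have hs₂ : strip δ ⊆ strip δ₂ := strip_mono (min_le_right _ _)
  have hloop : ∀ τ ∈ Ioo (-δ) δ, IsLoop U (u + τ • φ) := fun τ hτ =>
    hloop₁ τ (mem_strip.1 (hs₁ (show (τ, (0 : ℝ)) ∈ strip δ from mem_strip.2 hτ)))
  have hFs : ∀ i, ContDiffOn ℝ ∞ (varFamily F u φ i) (strip δ) := fun i => (hF₁ i).mono hs₁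
  have hGs : ∀ i, ContDiffOn ℝ ∞ (varFamily G u φ i) (strip δ) := fun i => (hG₂ i).mono hs₂
  have hu' := hu.toSmoothPeriodic
  set p := varDeriv F u with hpdef
  set q := varDeriv G u with hqdef
  have hp : SmoothPeriodic p := (hF.hasVarDeriv u hu).smoothPeriodic
  have hq : SmoothPeriodic q := (hG.hasVarDeriv u hu).smoothPeriodic
  set s := secondVar F u φ with hsdef
  set t := secondVar G u φ with htdef
  have hs : SmoothPeriodic s := hF.secondVar_smoothPeriodic hu hφ
  have ht : SmoothPeriodic t := hG.secondVar_smoothPeriodic hu hφ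
  -- The arguments of the density along the variation, collected into one jointly smooth map so that
  -- differentiation under the integral applies.
  let Z : ℝ × ℝ → FormPoint n := fun z => (u z.2 + z.1 • φ z.2, ddx u z.2 + z.1 • ddx φ z.2,
    fun i => varFamily F u φ i z, fun i => dx (varFamily F u φ i) z,
    fun i => varFamily G u φ i z, fun i => dx (varFamily G u φ i) z)
  have hZ : ContDiffOn ℝ ∞ Z (strip δ) := by
    refine ContDiffOn.prodMk ?_ (ContDiffOn.prodMk ?_ (ContDiffOn.prodMk ?_ (ContDiffOn.prodMk ?_
      (ContDiffOn.prodMk ?_ ?_))))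
    · exact ((hu'.smooth.comp contDiff_snd).add
        (contDiff_fst.smul (hφ.smooth.comp contDiff_snd))).contDiffOn
    · exact ((hu'.ddx.smooth.comp contDiff_snd).add
        (contDiff_fst.smul (hφ.ddx.smooth.comp contDiff_snd))).contDiffOn
    · exact contDiffOn_pi.2 hFs
    · exact contDiffOn_pi.2 fun i => contDiffOn_dx (hFs i)
    · exact contDiffOn_pi.2 hGs
    · exact contDiffOn_pi.2 fun i => contDiffOn_dx (hGs i)
  have hZform : ∀ τ ∈ Ioo (-δ) δ, ∀ x, Z (τ, x) =
      formPoint (u + τ • φ) (varDeriv F (u + τ • φ)) (varDeriv G (u + τ • φ)) x := by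
    intro τ hτ x
    have h1 : ddx (u + τ • φ) x = ddx u x + τ • ddx φ x := by
      rw [hu'.ddx_add (hφ.smul τ), hφ.ddx_smul]; rfl
    have h2 : ddx (varDeriv F (u + τ • φ)) x = fun i => dx (varFamily F u φ i) (τ, x) :=
      funext fun i => (hasDerivAt_dx (hFs i) (mem_strip.2 hτ)).deriv
    have h3 : ddx (varDeriv G (u + τ • φ)) x = fun i => dx (varFamily G u φ i) (τ, x) :=
      funext fun i => (hasDerivAt_dx (hGs i) (mem_strip.2 hτ)).deriv
    simp only [formPoint, h1, h2, h3]
    rfl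
  have hZ0 : ∀ x, Z (0, x) = formPoint u p q x := fun x => by
    rw [hZform 0 (by simp [hδ]) x]
    simp [p, q]
  have hc : ContDiffOn ℝ ∞ (fun z => ℓ (Z z)) (strip δ) :=
    hP.smooth.comp hZ fun z hz => (hloop z.1 (mem_strip.1 hz)).mem z.2
  have hderZ : ∀ x, HasDerivAt (fun τ : ℝ => Z (τ, x))
      (φ x, ddx φ x, s x, ddx s x, t x, ddx t x) 0 := by
    intro x
    have h0 := zero_mem_strip hδ x
    have hx : ∀ K : Functional n, (∀ i, ContDiffOn ℝ ∞ (varFamily K u φ i) (strip δ)) →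
        HasDerivAt (fun τ : ℝ => fun i => dx (varFamily K u φ i) (τ, x))
          (ddx (secondVar K u φ) x) 0 := by
      refine fun K hK => hasDerivAt_pi.2 fun i => ?_
      have h1 := hasDerivAt_dt (contDiffOn_dx (hK i)) h0
      -- The parameter derivative of `p_x` is the `x`-derivative of the second variation.
      rw [dt_dx_comm (hK i) h0] at h1
      rwa [show ddx (secondVar K u φ) x i = dx (dt (varFamily K u φ i)) (0, x) from
        (hasDerivAt_dx (contDiffOn_dt (hK i)) h0).deriv]
    refine HasDerivAt.prodMk ?_ (HasDerivAt.prodMk ?_ (HasDerivAt.prodMk ?_ (HasDerivAt.prodMk ?_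
      (HasDerivAt.prodMk ?_ ?_))))
    · simpa using ((hasDerivAt_id (0 : ℝ)).smul_const (φ x)).const_add (u x)
    · simpa using ((hasDerivAt_id (0 : ℝ)).smul_const (ddx φ x)).const_add (ddx u x)
    · exact hasDerivAt_pi.2 fun i => hasDerivAt_dt (hFs i) h0
    · exact hx F hFs
    · exact hasDerivAt_pi.2 fun i => hasDerivAt_dt (hGs i) h0
    · exact hx G hGs
  have hdt : ∀ x, dt (fun z => ℓ (Z z)) (0, x) =
      fderiv ℝ ℓ (formPoint u p q x) (φ x, ddx φ x, 0, 0, 0, 0)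
        + ℓ (formPoint u s q x) + ℓ (formPoint u p t x) := by
    intro x
    have hd : HasFDerivAt ℓ (fderiv ℝ ℓ (formPoint u p q x)) (Z (0, x)) := by
      rw [hZ0]
      exact (hP.toIsFormDensity.differentiableAt hU (hu.formPoint_mem p q x)).hasFDerivAt
    rw [(hasDerivAt_dt hc (zero_mem_strip hδ x)).unique (hd.comp_hasDerivAt (0 : ℝ) (hderZ x))]
    exact hP.toIsFormDensity.fderiv_eq hU (hu.mem x) _ _ _ _ _ _
  have hmain := hasDerivAt_integral_strip hδ hc
  have hA := periodicSmooth_formVariation hU hP.smooth hu hp hq hφ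
  have hB := periodicSmooth_comp_formPoint hU hP.smooth hu hs hq
  have hC := periodicSmooth_comp_formPoint hU hP.smooth hu hp ht
  -- With `s`, `t` the variations of `p`, `q`, the integral of `ℓ` at `(s, q)` is the pairing of `s`
  -- with `P q`. At `(p, t)`, antisymmetry gives minus the pairing of `t` with `P p`. Symmetry of
  -- the second variations then releases `φ` from inside them.
  have hval : ∫ x in (0 : ℝ)..1, dt (fun z => ℓ (Z z)) (0, x) =
      (∫ x in (0 : ℝ)..1, ∑ i, secondVar F u (P u q) x i * φ x i)
        - (∫ x in (0 : ℝ)..1, ∑ i, secondVar G u (P u p) x i * φ x i)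
        + formVariation ℓ u p q φ := by
    simp only [hdt]
    rw [(hA.add hB).integral_add hC, hA.integral_add hB, ← hP.integral_eq u s q hu hs hq,
      ← hP.integral_eq u p t hu hp ht, hP.antisymm u p t hu hp ht,
      hF.symm u φ (P u q) hu hφ (hP.smoothPeriodic u q hu hq),
      hG.symm u φ (P u p) hu hφ (hP.smoothPeriodic u p hu hp), formVariation]
    ring
  rw [hval] at hmain
  refine hmain.congr_of_eventuallyEq ?_
  filter_upwards [Ioo_mem_nhds (neg_neg_of_pos hδ) hδ] with τ hτ
  rw [bracket_eq_integral hP hF hG (hloop τ hτ)]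
  exact intervalIntegral.integral_congr fun x _ => by simp only [hZform τ hτ x]

/-- The variational derivative of a bracket, paired with `φ`. -/
lemma integral_varDeriv_bracket (hU : IsOpen U) (hP : HasFormDensity U P ℓ) (hF : IsRegular U F)
    (hG : IsRegular U G) (hu : IsLoop U u) (hφ : SmoothPeriodic φ) :
    ∫ x in (0 : ℝ)..1, ∑ i, varDeriv (bracket P F G) u x i * φ x i =
      (∫ x in (0 : ℝ)..1, ∑ i, secondVar F u (P u (varDeriv G u)) x i * φ x i)
        - (∫ x in (0 : ℝ)..1, ∑ i, secondVar G u (P u (varDeriv F u)) x i * φ x i)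
        + formVariation ℓ u (varDeriv F u) (varDeriv G u) φ := by
  have hp : SmoothPeriodic (varDeriv F u) := (hF.hasVarDeriv u hu).smoothPeriodic
  have hq : SmoothPeriodic (varDeriv G u) := (hG.hasVarDeriv u hu).smoothPeriodic
  have h1 := hF.secondVar_smoothPeriodic hu (hP.smoothPeriodic u _ hu hq)
  have h2 := hG.secondVar_smoothPeriodic hu (hP.smoothPeriodic u _ hu hp)
  obtain ⟨B, hB, hBv⟩ := exists_formVariation_adjoint hU hP.smooth hu hp hq
  -- Since `varDeriv` defaults to zero, a smooth variational derivative of the bracket has to be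
  -- exhibited before the bracket can enter another one. The adjoint `B` supplies the part coming
  -- from the density.
  have key : HasVarDeriv (bracket P F G) u (secondVar F u (P u (varDeriv G u))
      + (-1 : ℝ) • secondVar G u (P u (varDeriv F u)) + B) := by
    refine ⟨(h1.add (h2.smul _)).add hB, fun ψ hψ => ?_⟩
    convert hasDerivAt_bracket hU hP hF hG hu hψ using 1
    rw [hBv ψ hψ, ← intervalIntegral.integral_sub ((h1.dot hψ).intervalIntegrable _ _)
      ((h2.dot hψ).intervalIntegrable _ _), ← intervalIntegral.integral_add
      (((h1.dot hψ).sub (h2.dot hψ)).intervalIntegrable _ _) ((hB.dot hψ).intervalIntegrable _ _)]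
    refine intervalIntegral.integral_congr fun x _ => ?_
    simp only [Pi.add_apply, Pi.smul_apply, smul_eq_mul, ← Finset.sum_sub_distrib,
      ← Finset.sum_add_distrib]
    exact Finset.sum_congr rfl fun i _ => by ring
  have h3 := key.hasDerivAt φ hφ
  rw [← key.varDeriv_eq] at h3
  exact h3.unique (hasDerivAt_bracket hU hP hF hG hu hφ)

/-- The Jacobiator only depends on the variation of the operator. -/
theorem jacobiator_eq (hU : IsOpen U) (hP : HasFormDensity U P ℓ) (hF : IsRegular U F)
    (hG : IsRegular U G) (hH : IsRegular U H) (hu : IsLoop U u) :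
    jacobiator P F G H u =
      formVariation ℓ u (varDeriv F u) (varDeriv G u) (P u (varDeriv H u))
        + formVariation ℓ u (varDeriv G u) (varDeriv H u) (P u (varDeriv F u))
        + formVariation ℓ u (varDeriv H u) (varDeriv F u) (P u (varDeriv G u)) := by
  have hs : ∀ K : Functional n, IsRegular U K → SmoothPeriodic (P u (varDeriv K u)) := fun K hK =>
    hP.smoothPeriodic u _ hu (hK.hasVarDeriv u hu).smoothPeriodic
  unfold jacobiator
  -- Each of `F`, `G`, `H` contributes two second variation terms, of opposite sign and with the two
  -- directions exchanged. The symmetry rewrites make these pairs cancel.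
  rw [bracket, integral_varDeriv_bracket hU hP hF hG hu (hs H hH),
    bracket, integral_varDeriv_bracket hU hP hG hH hu (hs F hF),
    bracket, integral_varDeriv_bracket hU hP hH hF hu (hs G hG),
    hF.symm u _ _ hu (hs G hG) (hs H hH), hG.symm u _ _ hu (hs H hH) (hs F hF),
    hH.symm u _ _ hu (hs F hF) (hs G hG)]
  ring

end density

/-! ### Linear functionals -/

/-- The functional `∫ p_i u^i dx`. -/
def linearFunctional (p : ℝ → Fin n → ℝ) : Functional n :=
  fun u => ∫ x in (0 : ℝ)..1, ∑ i, p x i * u x i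

/-- Densities may depend explicitly on `x`, so an arbitrary covector field `p` occurs as a
variational derivative already at jet order zero. -/
lemma isLocal_linearFunctional {U : Set (Fin n → ℝ)} {p : ℝ → Fin n → ℝ} (hp : SmoothPeriodic p) :
    IsLocal U (linearFunctional p) := by
  refine ⟨0, fun z => ∑ i, p z.1 i * z.2 0 i, ?_, fun x v => ?_, fun u _ => ?_⟩
  · refine (ContDiff.sum fun i _ => ((hp.apply i).smooth.comp contDiff_fst).mul ?_).contDiffOn
    exact contDiff_pi.1 (contDiff_pi.1 contDiff_snd 0) i
  · simp only [hp.periodic x]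
  · simp [linearFunctional]

lemma varDeriv_linearFunctional {u p : ℝ → Fin n → ℝ} (hp : SmoothPeriodic p)
    (hu : SmoothPeriodic u) : varDeriv (linearFunctional p) u = p := by
  refine HasVarDeriv.varDeriv_eq ⟨hp, fun φ hφ => ?_⟩
  have h1 : (fun τ : ℝ => linearFunctional p (u + τ • φ)) = fun τ =>
      (∫ x in (0 : ℝ)..1, ∑ i, p x i * u x i) + τ * ∫ x in (0 : ℝ)..1, ∑ i, p x i * φ x i := by
    funext τ
    rw [linearFunctional, ← intervalIntegral.integral_const_mul,
      ← intervalIntegral.integral_add ((hp.dot hu).intervalIntegrable _ _)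
        (((PeriodicSmooth.const τ).mul (hp.dot hφ)).intervalIntegrable _ _)]
    refine intervalIntegral.integral_congr fun x _ => ?_
    simp only [Pi.add_apply, Pi.smul_apply, smul_eq_mul, Finset.mul_sum,
      ← Finset.sum_add_distrib]
    exact Finset.sum_congr rfl fun i _ => by ring
  rw [h1]
  simpa using ((hasDerivAt_id (0 : ℝ)).mul_const
    (∫ x in (0 : ℝ)..1, ∑ i, p x i * φ x i)).const_add (∫ x in (0 : ℝ)..1, ∑ i, p x i * u x i)

end

section

variable {n : ℕ} {U : Set (Fin n → ℝ)}

/-! ### Partial derivatives -/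

lemma contDiffOn_pd (hU : IsOpen U) {f : (Fin n → ℝ) → ℝ} (hf : ContDiffOn ℝ ∞ f U) (k : Fin n) :
    ContDiffOn ℝ ∞ (pd k f) U :=
  contDiffOn_fderiv_apply hU hf _

/-- The chain rule in coordinates. -/
lemma hasDerivAt_comp_pd (hU : IsOpen U) {f : (Fin n → ℝ) → ℝ} (hf : ContDiffOn ℝ ∞ f U)
    {γ : ℝ → Fin n → ℝ} {v : Fin n → ℝ} {t : ℝ} (hγ : HasDerivAt γ v t) (ht : γ t ∈ U) :
    HasDerivAt (fun s => f (γ s)) (∑ k, pd k f (γ t) * v k) t := by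
  have hd : HasFDerivAt f (fderiv ℝ f (γ t)) (γ t) :=
    ((hf.contDiffAt (hU.mem_nhds ht)).differentiableAt (by simp)).hasFDerivAt
  have hv : v = ∑ k, v k • (Pi.single k 1 : Fin n → ℝ) := by
    funext i
    simp [Finset.sum_apply, Pi.single_apply]
  refine (hd.comp_hasDerivAt t hγ).congr_deriv ?_
  conv_lhs => rw [hv]
  simp only [map_sum, map_smul, smul_eq_mul, mul_comm, pd]

lemma IsLoop.hasDerivAt_comp (hU : IsOpen U) {f : (Fin n → ℝ) → ℝ} (hf : ContDiffOn ℝ ∞ f U)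
    {u : ℝ → Fin n → ℝ} (hu : IsLoop U u) (x : ℝ) :
    HasDerivAt (fun y => f (u y)) (∑ k, pd k f (u x) * ddx u x k) x :=
  hasDerivAt_comp_pd hU hf (hu.toSmoothPeriodic.hasDerivAt x) (hu.mem x)

lemma pd_congr (hU : IsOpen U) {f h : (Fin n → ℝ) → ℝ} (hfh : ∀ u ∈ U, f u = h u) {u : Fin n → ℝ}
    (hu : u ∈ U) (k : Fin n) : pd k f u = pd k h u := by
  have : f =ᶠ[𝓝 u] h := by
    filter_upwards [hU.mem_nhds hu] with v hv using hfh v hv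
  rw [pd, pd, this.fderiv_eq]

/-! ### Flat coordinates -/

lemma contDiffOn_det {m : ℕ} {A : Fin m → Fin m → (Fin n → ℝ) → ℝ}
    (hA : ∀ i j, ContDiffOn ℝ ∞ (A i j) U) :
    ContDiffOn ℝ ∞ (fun u => (Matrix.of fun r s => A r s u).det) U := by
  simp only [Matrix.det_apply', Matrix.of_apply]
  exact ContDiffOn.sum fun σ _ => contDiffOn_const.mul (contDiffOn_prod fun i _ => hA _ _)

/-- Cramer's rule writes each entry of the inverse as a quotient of determinants of smooth entries,
with nonvanishing denominator. -/
lemma IsMetric.contDiffOn_lower {g : Fin n → Fin n → (Fin n → ℝ) → ℝ} (hg : IsMetric U g)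
    (i j : Fin n) : ContDiffOn ℝ ∞ (lower g i j) U := by
  have h1 : ∀ u, lower g i j u = ((Matrix.of fun r s => g r s u).det)⁻¹ *
      (Matrix.of fun r s => if r = j then (Pi.single i 1 : Fin n → ℝ) s else g r s u).det := by
    intro u
    rw [lower, Matrix.inv_def, Ring.inverse_eq_inv', Matrix.smul_apply, Matrix.adjugate_apply,
      smul_eq_mul]
    congr 2
    ext r s
    simp [Matrix.updateRow_apply]
  have h2 : ContDiffOn ℝ ∞ (fun u => (Matrix.of fun r s =>
      if r = j then (Pi.single i 1 : Fin n → ℝ) s else g r s u).det) U := by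
    refine contDiffOn_det (A := fun r s u =>
      if r = j then (Pi.single i 1 : Fin n → ℝ) s else g r s u) fun r s => ?_
    by_cases h : r = j
    · simpa only [h, if_true] using contDiffOn_const
    · simpa only [h, if_false] using hg.smooth r s
  refine ContDiffOn.congr (((contDiffOn_det hg.smooth).inv fun u hu =>
    (hg.nondegenerate u hu).ne_zero).mul h2) fun u _ => h1 u

lemma IsMetric.sum_lower_mul {g : Fin n → Fin n → (Fin n → ℝ) → ℝ} (hg : IsMetric U g)
    {u : Fin n → ℝ} (hu : u ∈ U) (i j : Fin n) :
    ∑ k, lower g i k u * g k j u = if i = j then 1 else 0 := by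
  have h := congrFun (congrFun (Matrix.nonsing_inv_mul (Matrix.of fun r s => g r s u)
    (hg.nondegenerate u hu)) i) j
  rwa [Matrix.mul_apply, Matrix.one_apply] at h

/-- A covector annihilated by the contravariant metric vanishes. -/
lemma IsMetric.eq_zero_of_sum {g : Fin n → Fin n → (Fin n → ℝ) → ℝ} (hg : IsMetric U g)
    {u : Fin n → ℝ} (hu : u ∈ U) {v : Fin n → ℝ} (hv : ∀ k, ∑ l, g k l u * v l = 0) (i : Fin n) :
    v i = 0 := by
  calc v i = ∑ l, (if i = l then 1 else 0) * v l := by simp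
    _ = ∑ l, ∑ k, lower g i k u * (g k l u * v l) := by
        refine Finset.sum_congr rfl fun l _ => ?_
        rw [← hg.sum_lower_mul hu, Finset.sum_mul]
        exact Finset.sum_congr rfl fun k _ => by ring
    _ = ∑ k, lower g i k u * ∑ l, g k l u * v l := by
        rw [Finset.sum_comm]
        simp only [Finset.mul_sum]
    _ = 0 := by simp [hv]

lemma IsMetric.lower_symm {g : Fin n → Fin n → (Fin n → ℝ) → ℝ} (hg : IsMetric U g) (i j : Fin n) :
    ∀ u ∈ U, lower g i j u = lower g j i u := by
  intro u hu
  have h : (Matrix.of fun r s => g r s u).transpose = Matrix.of fun r s => g r s u := by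
    ext r s
    simpa using (hg.symm r s u hu).symm
  have h2 := Matrix.transpose_nonsing_inv (Matrix.of fun r s => g r s u)
  rw [h] at h2
  exact (congrFun (congrFun h2 j) i)

/-- Nondegeneracy removes the factor `g^{kl}`, so the Christoffel symbols of the first kind vanish;
the sum of two of them is, up to a factor, a single derivative of the metric. -/
lemma IsFlatCoord.pd_lower {g : Fin n → Fin n → (Fin n → ℝ) → ℝ} (hU : IsOpen U)
    (hg : IsMetric U g) (hflat : IsFlatCoord U g) {u : Fin n → ℝ} (hu : u ∈ U) (i l j : Fin n) :
    pd i (lower g l j) u = 0 := by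
  have h1 : ∀ l i j, pd i (lower g l j) u + pd j (lower g l i) u - pd l (lower g i j) u = 0 := by
    intro l i j
    refine hg.eq_zero_of_sum hu (v := fun l =>
      pd i (lower g l j) u + pd j (lower g l i) u - pd l (lower g i j) u) (fun k => ?_) l
    have := hflat i j k u hu
    rw [christoffel] at this
    linarith
  have h2 : ∀ k i j, pd k (lower g i j) u = pd k (lower g j i) u := fun k i j =>
    pd_congr hU (hg.lower_symm i j) hu k
  have e1 := h1 l i j
  have e2 := h1 j i l
  rw [h2 i j l, h2 l j i, h2 j i l] at e2
  linarith

/-- In flat coordinates the metric is locally constant. -/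
lemma IsFlatCoord.pd_eq_zero {g : Fin n → Fin n → (Fin n → ℝ) → ℝ} (hU : IsOpen U)
    (hg : IsMetric U g) (hflat : IsFlatCoord U g) {u : Fin n → ℝ} (hu : u ∈ U) (k i j : Fin n) :
    pd k (g i j) u = 0 := by
  have hline : HasDerivAt (fun t : ℝ => u + t • (Pi.single k 1 : Fin n → ℝ)) (Pi.single k 1) 0 := by
    simpa using ((hasDerivAt_id (0 : ℝ)).smul_const (Pi.single k 1 : Fin n → ℝ)).const_add u
  have hpd : ∀ f : (Fin n → ℝ) → ℝ, ContDiffOn ℝ ∞ f U →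
      HasDerivAt (fun t : ℝ => f (u + t • (Pi.single k 1 : Fin n → ℝ))) (pd k f u) 0 := by
    intro f hf
    simpa [Pi.single_apply] using hasDerivAt_comp_pd hU hf hline (by simpa using hu)
  -- Differentiate the identity "covariant metric times contravariant metric equals the unit matrix"
  -- along a coordinate line; the covariant factor is already known to have zero derivative.
  have hzero : ∀ r, ∑ l, lower g r l u * pd k (g l j) u = 0 := by
    intro r
    have h1 : HasDerivAt (fun t : ℝ => ∑ l, lower g r l (u + t • (Pi.single k 1 : Fin n → ℝ)) *
        g l j (u + t • (Pi.single k 1 : Fin n → ℝ))) (∑ l, lower g r l u * pd k (g l j) u) 0 := by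
      refine HasDerivAt.fun_sum fun l _ => ?_
      have := (hpd _ (hg.contDiffOn_lower r l)).fun_mul (hpd _ (hg.smooth l j))
      simpa [hflat.pd_lower hU hg hu] using this
    refine h1.unique ((hasDerivAt_const (0 : ℝ) (if r = j then (1 : ℝ) else 0)).congr_of_eventuallyEq
      ?_)
    have hc : Tendsto (fun t : ℝ => u + t • (Pi.single k 1 : Fin n → ℝ)) (𝓝 0) (𝓝 u) := by
      simpa using hline.continuousAt.tendsto
    filter_upwards [hc.eventually (hU.mem_nhds hu)] with t ht
    exact hg.sum_lower_mul ht r j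
  have h2 : ∑ r, g i r u * ∑ l, lower g r l u * pd k (g l j) u = pd k (g i j) u := by
    have h3 : ∀ l, ∑ r, g i r u * lower g r l u = if i = l then 1 else 0 := fun l => by
      have h := congrFun (congrFun (Matrix.mul_nonsing_inv (Matrix.of fun r s => g r s u)
        (hg.nondegenerate u hu)) i) l
      rwa [Matrix.mul_apply, Matrix.one_apply] at h
    simp only [Finset.mul_sum]
    rw [Finset.sum_comm]
    simp only [← mul_assoc, ← Finset.sum_mul, h3]
    simp
  rw [← h2]
  simp [hzero]

/-! ### The densities of the operators -/

/-- The density `g^{ij} p_i q_{j,x}`. -/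
def metricForm (g : Fin n → Fin n → (Fin n → ℝ) → ℝ) (z : FormPoint n) : ℝ :=
  ∑ i, ∑ j, g i j z.1 * z.2.2.1 i * z.2.2.2.2.2 j

/-- The density `- a^{ij} p_{i,x} q_{j,x} + β^{ij}_k u^k_x p_i q_{j,x} - c^{ij}_k u^k_x p_{i,x} q_j
+ d^{ij}_{kl} u^k_x u^l_x p_i q_j`. -/
def quadForm (a : Fin n → Fin n → (Fin n → ℝ) → ℝ) (β c : Fin n → Fin n → Fin n → (Fin n → ℝ) → ℝ)
    (d : Fin n → Fin n → Fin n → Fin n → (Fin n → ℝ) → ℝ) (z : FormPoint n) : ℝ :=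
  ∑ i, ∑ j, (-(a i j z.1 * z.2.2.2.1 i * z.2.2.2.2.2 j)
    + (∑ k, β i j k z.1 * z.2.1 k) * z.2.2.1 i * z.2.2.2.2.2 j
    - (∑ k, c i j k z.1 * z.2.1 k) * z.2.2.2.1 i * z.2.2.2.2.1 j
    + (∑ k, ∑ l, d i j k l z.1 * z.2.1 k * z.2.1 l) * z.2.2.1 i * z.2.2.2.2.1 j)

lemma isFormDensity_metricForm {g : Fin n → Fin n → (Fin n → ℝ) → ℝ}
    (hg : ∀ i j, ContDiffOn ℝ ∞ (g i j) U) : IsFormDensity U (metricForm g) where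
  smooth := by
    have hg' : ∀ i j, ContDiffOn ℝ ∞ (fun z : FormPoint n => g i j z.1) (formDomain U) := fun i j =>
      (hg i j).comp contDiffOn_fst fun z hz => hz
    refine ContDiffOn.sum fun i _ => ContDiffOn.sum fun j _ => ((hg' i j).mul ?_).mul ?_ <;>
    exact ContDiff.contDiffOn (by fun_prop)
  linear_left w w' p p' s s' q q' τ := by
    simp only [metricForm, Finset.mul_sum, ← Finset.sum_add_distrib, Pi.add_apply, Pi.smul_apply,
      smul_eq_mul]
    exact Finset.sum_congr rfl fun i _ => Finset.sum_congr rfl fun j _ => by ring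
  linear_right w w' p p' q q' s s' τ := by
    simp only [metricForm, Finset.mul_sum, ← Finset.sum_add_distrib, Pi.add_apply, Pi.smul_apply,
      smul_eq_mul]
    exact Finset.sum_congr rfl fun i _ => Finset.sum_congr rfl fun j _ => by ring

lemma isFormDensity_quadForm {a : Fin n → Fin n → (Fin n → ℝ) → ℝ}
    {β c : Fin n → Fin n → Fin n → (Fin n → ℝ) → ℝ}
    {d : Fin n → Fin n → Fin n → Fin n → (Fin n → ℝ) → ℝ}
    (ha : ∀ i j, ContDiffOn ℝ ∞ (a i j) U) (hβ : ∀ i j k, ContDiffOn ℝ ∞ (β i j k) U)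
    (hc : ∀ i j k, ContDiffOn ℝ ∞ (c i j k) U) (hd : ∀ i j k l, ContDiffOn ℝ ∞ (d i j k l) U) :
    IsFormDensity U (quadForm a β c d) where
  smooth := by
    have hcomp : ∀ f : (Fin n → ℝ) → ℝ, ContDiffOn ℝ ∞ f U →
        ContDiffOn ℝ ∞ (fun z : FormPoint n => f z.1) (formDomain U) := fun f hf =>
      hf.comp contDiffOn_fst fun z hz => hz
    have h1 : ∀ k, ContDiffOn ℝ ∞ (fun z : FormPoint n => z.2.1 k) (formDomain U) :=
      fun k => ContDiff.contDiffOn (by fun_prop)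
    have h2 : ∀ k, ContDiffOn ℝ ∞ (fun z : FormPoint n => z.2.2.1 k) (formDomain U) :=
      fun k => ContDiff.contDiffOn (by fun_prop)
    have h3 : ∀ k, ContDiffOn ℝ ∞ (fun z : FormPoint n => z.2.2.2.1 k) (formDomain U) :=
      fun k => ContDiff.contDiffOn (by fun_prop)
    have h4 : ∀ k, ContDiffOn ℝ ∞ (fun z : FormPoint n => z.2.2.2.2.1 k) (formDomain U) :=
      fun k => ContDiff.contDiffOn (by fun_prop)
    have h5 : ∀ k, ContDiffOn ℝ ∞ (fun z : FormPoint n => z.2.2.2.2.2 k) (formDomain U) :=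
      fun k => ContDiff.contDiffOn (by fun_prop)
    exact ContDiffOn.sum fun i _ => ContDiffOn.sum fun j _ =>
      ((((((hcomp _ (ha i j)).mul (h3 i)).mul (h5 j)).neg).add
        (((ContDiffOn.sum fun k _ => (hcomp _ (hβ i j k)).mul (h1 k)).mul (h2 i)).mul (h5 j))).sub
        (((ContDiffOn.sum fun k _ => (hcomp _ (hc i j k)).mul (h1 k)).mul (h3 i)).mul (h4 j))).add
        (((ContDiffOn.sum fun k _ => ContDiffOn.sum fun l _ =>
          ((hcomp _ (hd i j k l)).mul (h1 k)).mul (h1 l)).mul (h2 i)).mul (h4 j))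
  linear_left w w' p p' s s' q q' τ := by
    rw [quadForm, quadForm, quadForm, Finset.mul_sum, ← Finset.sum_add_distrib]
    refine Finset.sum_congr rfl fun i _ => ?_
    rw [Finset.mul_sum, ← Finset.sum_add_distrib]
    refine Finset.sum_congr rfl fun j _ => ?_
    simp only [Pi.add_apply, Pi.smul_apply, smul_eq_mul]
    ring
  linear_right w w' p p' q q' s s' τ := by
    rw [quadForm, quadForm, quadForm, Finset.mul_sum, ← Finset.sum_add_distrib]
    refine Finset.sum_congr rfl fun i _ => ?_
    rw [Finset.mul_sum, ← Finset.sum_add_distrib]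
    refine Finset.sum_congr rfl fun j _ => ?_
    simp only [Pi.add_apply, Pi.smul_apply, smul_eq_mul]
    ring

lemma IsFormDensity.add_smul {ℓ₁ ℓ₂ : FormPoint n → ℝ} (h₁ : IsFormDensity U ℓ₁)
    (h₂ : IsFormDensity U ℓ₂) (ε : ℝ) : IsFormDensity U (ℓ₁ + ε • ℓ₂) where
  smooth := h₁.smooth.add (h₂.smooth.const_smul ε)
  linear_left w w' p p' s s' q q' τ := by
    simp only [Pi.add_apply, Pi.smul_apply, smul_eq_mul, h₁.linear_left, h₂.linear_left]
    ring
  linear_right w w' p p' q q' s s' τ := by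
    simp only [Pi.add_apply, Pi.smul_apply, smul_eq_mul, h₁.linear_right, h₂.linear_right]
    ring

/-- Linear combinations of operators given by densities. -/
lemma HasFormDensity.add_smul (hU : IsOpen U) {P₁ P₂ : Operator n} {ℓ₁ ℓ₂ : FormPoint n → ℝ}
    (h₁ : HasFormDensity U P₁ ℓ₁) (h₂ : HasFormDensity U P₂ ℓ₂) (ε : ℝ) :
    HasFormDensity U (P₁ + ε • P₂) (ℓ₁ + ε • ℓ₂) := by
  have hsplit : ∀ u p q, IsLoop U u → SmoothPeriodic p → SmoothPeriodic q →
      ∫ x in (0 : ℝ)..1, ∑ i, p x i * (P₁ + ε • P₂) u q x i =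
        (∫ x in (0 : ℝ)..1, ∑ i, p x i * P₁ u q x i)
          + ε * ∫ x in (0 : ℝ)..1, ∑ i, p x i * P₂ u q x i := by
    intro u p q hu hp hq
    rw [← intervalIntegral.integral_const_mul, ← intervalIntegral.integral_add
      ((hp.dot (h₁.smoothPeriodic u q hu hq)).intervalIntegrable _ _)
      (((PeriodicSmooth.const ε).mul (hp.dot (h₂.smoothPeriodic u q hu hq))).intervalIntegrable _ _)]
    refine intervalIntegral.integral_congr fun x _ => ?_
    simp only [Pi.add_apply, Pi.smul_apply, smul_eq_mul, Finset.mul_sum, ← Finset.sum_add_distrib]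
    exact Finset.sum_congr rfl fun i _ => by ring
  refine ⟨h₁.toIsFormDensity.add_smul h₂.toIsFormDensity ε, fun u q hu hq =>
    (h₁.smoothPeriodic u q hu hq).add ((h₂.smoothPeriodic u q hu hq).smul ε),
    fun u p q hu hp hq => ?_, fun u p q hu hp hq => ?_⟩
  · rw [hsplit u p q hu hp hq, h₁.integral_eq u p q hu hp hq, h₂.integral_eq u p q hu hp hq,
      ← intervalIntegral.integral_const_mul, ← intervalIntegral.integral_add
      ((periodicSmooth_comp_formPoint hU h₁.smooth hu hp hq).intervalIntegrable _ _)
      (((PeriodicSmooth.const ε).mul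
        (periodicSmooth_comp_formPoint hU h₂.smooth hu hp hq)).intervalIntegrable _ _)]
    rfl
  · rw [hsplit u p q hu hp hq, hsplit u q p hu hq hp, h₁.antisymm u p q hu hp hq,
      h₂.antisymm u p q hu hp hq]
    ring

lemma hydroOp_apply {g : Fin n → Fin n → (Fin n → ℝ) → ℝ} (hflat : IsFlatCoord U g)
    {u : ℝ → Fin n → ℝ} (hu : IsLoop U u) (p : ℝ → Fin n → ℝ) (x : ℝ) (i : Fin n) :
    hydroOp g u p x i = ∑ j, g i j (u x) * ddx p x j := by
  have h : ∀ j k, contraChristoffel g i j k (u x) = 0 := fun j k => by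
    simp [contraChristoffel, hflat _ _ _ _ (hu.mem x)]
  simp [hydroOp, h, ddx]

lemma IsFlatCoord.hasDerivAt_metric_loop {g : Fin n → Fin n → (Fin n → ℝ) → ℝ} (hU : IsOpen U)
    (hg : IsMetric U g) (hflat : IsFlatCoord U g) {u : ℝ → Fin n → ℝ} (hu : IsLoop U u) (x : ℝ)
    (i j : Fin n) : HasDerivAt (fun y => g i j (u y)) 0 x := by
  simpa [hflat.pd_eq_zero hU hg (hu.mem x)] using hu.hasDerivAt_comp hU (hg.smooth i j) x

lemma hasFormDensity_hydroOp {g : Fin n → Fin n → (Fin n → ℝ) → ℝ} (hU : IsOpen U)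
    (hg : IsMetric U g) (hflat : IsFlatCoord U g) : HasFormDensity U (hydroOp g) (metricForm g) := by
  have hsm : ∀ u q, IsLoop U u → SmoothPeriodic q → SmoothPeriodic (hydroOp g u q) := by
    refine fun u q hu hq => smoothPeriodic_iff.2 fun i => ?_
    simp only [hydroOp_apply hflat hu]
    exact PeriodicSmooth.sum fun j _ => (hu.comp_smooth hU (hg.smooth i j)).mul (hq.ddx.apply j)
  refine ⟨isFormDensity_metricForm hg.smooth, hsm, fun u p q hu hp hq => ?_,
    fun u p q hu hp hq => ?_⟩
  · refine intervalIntegral.integral_congr fun x _ => ?_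
    simp only [hydroOp_apply hflat hu, metricForm, formPoint, Finset.mul_sum]
    exact Finset.sum_congr rfl fun i _ => Finset.sum_congr rfl fun j _ => by ring
  -- With `g` symmetric and constant along the loop, `p_i P₁(q)^i + q_i P₁(p)^i` is the total
  -- derivative of `g^{ij} p_i q_j`.
  · have hW : PeriodicSmooth fun x => ∑ i, ∑ j, g i j (u x) * p x i * q x j :=
      PeriodicSmooth.sum fun i _ => PeriodicSmooth.sum fun j _ =>
        ((hu.comp_smooth hU (hg.smooth i j)).mul (hp.apply i)).mul (hq.apply j)
    have hd : ∀ x, HasDerivAt (fun x => ∑ i, ∑ j, g i j (u x) * p x i * q x j)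
        ((∑ i, p x i * hydroOp g u q x i) + ∑ i, q x i * hydroOp g u p x i) x := by
      intro x
      have h1 : HasDerivAt (fun x => ∑ i, ∑ j, g i j (u x) * p x i * q x j) (∑ i, ∑ j,
          (g i j (u x) * ddx p x i * q x j + g i j (u x) * p x i * ddx q x j)) x := by
        refine HasDerivAt.fun_sum fun i _ => HasDerivAt.fun_sum fun j _ => ?_
        simpa using ((hflat.hasDerivAt_metric_loop hU hg hu x i j).fun_mul
          (hp.hasDerivAt_apply x i)).fun_mul (hq.hasDerivAt_apply x j)
      refine h1.congr_deriv (Eq.symm ?_)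
      simp only [hydroOp_apply hflat hu, Finset.sum_add_distrib, Finset.mul_sum]
      rw [add_comm]
      congr 1
      · rw [Finset.sum_comm]
        refine Finset.sum_congr rfl fun i _ => Finset.sum_congr rfl fun j _ => ?_
        rw [hg.symm _ _ _ (hu.mem x)]
        ring
      · exact Finset.sum_congr rfl fun i _ => Finset.sum_congr rfl fun j _ => by ring
    have h := integral_deriv_eq_zero hW.periodic hd
      ((hp.dot (hsm u q hu hq)).add (hq.dot (hsm u p hu hp))).continuous
    rw [(hp.dot (hsm u q hu hq)).integral_add (hq.dot (hsm u p hu hp))] at h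
    linarith

/-! ### Integration by parts for the degree two operator -/

section degreeTwo

variable {a : Fin n → Fin n → (Fin n → ℝ) → ℝ} {b c : Fin n → Fin n → Fin n → (Fin n → ℝ) → ℝ}
  {cc : Fin n → Fin n → Fin n → Fin n → (Fin n → ℝ) → ℝ}

/-- The coefficient `b^{ij}_k - a^{ij}_{,k} - c^{ij}_k`. -/
def betaCoeff (a : Fin n → Fin n → (Fin n → ℝ) → ℝ)
    (b c : Fin n → Fin n → Fin n → (Fin n → ℝ) → ℝ) (i j k : Fin n) (u : Fin n → ℝ) : ℝ :=
  b i j k u - pd k (a i j) u - c i j k u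

/-- The coefficient `c^{ij}_{kl} - c^{ij}_{(k,l)}`. -/
def defectCoeff (c : Fin n → Fin n → Fin n → (Fin n → ℝ) → ℝ)
    (cc : Fin n → Fin n → Fin n → Fin n → (Fin n → ℝ) → ℝ) (i j k l : Fin n) (u : Fin n → ℝ) : ℝ :=
  cc i j k l u - (1 / 2) * (pd l (c i j k) u + pd k (c i j l) u)

lemma contDiffOn_betaCoeff (hU : IsOpen U) (ha : ∀ i j, ContDiffOn ℝ ∞ (a i j) U)
    (hb : ∀ i j k, ContDiffOn ℝ ∞ (b i j k) U) (hc : ∀ i j k, ContDiffOn ℝ ∞ (c i j k) U)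
    (i j k : Fin n) : ContDiffOn ℝ ∞ (betaCoeff a b c i j k) U :=
  ((hb i j k).sub (contDiffOn_pd hU (ha i j) k)).sub (hc i j k)

lemma contDiffOn_defectCoeff (hU : IsOpen U) (hc : ∀ i j k, ContDiffOn ℝ ∞ (c i j k) U)
    (hcc : ∀ i j k l, ContDiffOn ℝ ∞ (cc i j k l) U) (i j k l : Fin n) :
    ContDiffOn ℝ ∞ (defectCoeff c cc i j k l) U :=
  (hcc i j k l).sub (contDiffOn_const.mul
    ((contDiffOn_pd hU (hc i j k) l).add (contDiffOn_pd hU (hc i j l) k)))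

/-- Contraction with `v^k v^l` sees only the part symmetric in `k`, `l`; this is why the derivative
of `c^{ij}_k u^k_x` enters through `c^{ij}_{(k,l)}`. -/
lemma sum_defectCoeff (c : Fin n → Fin n → Fin n → (Fin n → ℝ) → ℝ)
    (cc : Fin n → Fin n → Fin n → Fin n → (Fin n → ℝ) → ℝ) (i j : Fin n) (u v : Fin n → ℝ) :
    ∑ k, ∑ l, defectCoeff c cc i j k l u * v k * v l =
      (∑ k, ∑ l, cc i j k l u * v k * v l) - ∑ k, (∑ l, pd l (c i j k) u * v l) * v k := by
  have h1 : ∑ k, (∑ l, pd l (c i j k) u * v l) * v k = ∑ k, ∑ l, pd l (c i j k) u * v k * v l := by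
    simp only [Finset.sum_mul]
    exact Finset.sum_congr rfl fun k _ => Finset.sum_congr rfl fun l _ => by ring
  have h2 : ∑ k, ∑ l, pd k (c i j l) u * v k * v l = ∑ k, ∑ l, pd l (c i j k) u * v k * v l := by
    rw [Finset.sum_comm]
    exact Finset.sum_congr rfl fun k _ => Finset.sum_congr rfl fun l _ => by ring
  have h3 : ∑ k, ∑ l, defectCoeff c cc i j k l u * v k * v l =
      (∑ k, ∑ l, cc i j k l u * v k * v l) - ((1 / 2) * (∑ k, ∑ l, pd l (c i j k) u * v k * v l)
        + (1 / 2) * ∑ k, ∑ l, pd k (c i j l) u * v k * v l) := by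
    simp only [Finset.mul_sum, ← Finset.sum_add_distrib, ← Finset.sum_sub_distrib, defectCoeff]
    exact Finset.sum_congr rfl fun k _ => Finset.sum_congr rfl fun l _ => by ring
  rw [h3, h2, h1]
  ring

lemma degreeTwoOp_apply (a : Fin n → Fin n → (Fin n → ℝ) → ℝ)
    (b c : Fin n → Fin n → Fin n → (Fin n → ℝ) → ℝ)
    (cc : Fin n → Fin n → Fin n → Fin n → (Fin n → ℝ) → ℝ) (u p : ℝ → Fin n → ℝ) (x : ℝ)
    (i : Fin n) : degreeTwoOp a b c cc u p x i =
      ∑ j, (a i j (u x) * ddx (ddx p) x j + (∑ k, b i j k (u x) * ddx u x k) * ddx p x j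
        + ((∑ k, ∑ l, cc i j k l (u x) * ddx u x k * ddx u x l)
          + ∑ k, c i j k (u x) * ddx (ddx u) x k) * p x j) := by
  simp only [degreeTwoOp, iteratedDeriv_succ, iteratedDeriv_zero, ddx]

lemma hasFormDensity_degreeTwoOp (hU : IsOpen U) (ha : ∀ i j, ContDiffOn ℝ ∞ (a i j) U)
    (hb : ∀ i j k, ContDiffOn ℝ ∞ (b i j k) U) (hc : ∀ i j k, ContDiffOn ℝ ∞ (c i j k) U)
    (hcc : ∀ i j k l, ContDiffOn ℝ ∞ (cc i j k l) U)
    (hanti : IsAntisymm U (degreeTwoOp a b c cc)) :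
    HasFormDensity U (degreeTwoOp a b c cc)
      (quadForm a (betaCoeff a b c) c (defectCoeff c cc)) := by
  have hdens := isFormDensity_quadForm ha (contDiffOn_betaCoeff hU ha hb hc) hc
    (contDiffOn_defectCoeff hU hc hcc)
  have hsm : ∀ u q, IsLoop U u → SmoothPeriodic q → SmoothPeriodic (degreeTwoOp a b c cc u q) := by
    refine fun u q hu hq => smoothPeriodic_iff.2 fun i => ?_
    have hu' := hu.toSmoothPeriodic
    simp only [degreeTwoOp_apply]
    exact PeriodicSmooth.sum fun j _ => (((hu.comp_smooth hU (ha i j)).mul (hq.ddx.ddx.apply j)).add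
      ((PeriodicSmooth.sum fun k _ => (hu.comp_smooth hU (hb i j k)).mul (hu'.ddx.apply k)).mul
        (hq.ddx.apply j))).add (((PeriodicSmooth.sum fun k _ => PeriodicSmooth.sum fun l _ =>
        ((hu.comp_smooth hU (hcc i j k l)).mul (hu'.ddx.apply k)).mul (hu'.ddx.apply l)).add
        (PeriodicSmooth.sum fun k _ => (hu.comp_smooth hU (hc i j k)).mul
          (hu'.ddx.ddx.apply k))).mul (hq.apply j))
  refine ⟨hdens, hsm, fun u p q hu hp hq => ?_, hanti⟩
  have hu' := hu.toSmoothPeriodic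
  have hθ : ∀ i j, PeriodicSmooth fun x => ∑ k, c i j k (u x) * ddx u x k := fun i j =>
    PeriodicSmooth.sum fun k _ => (hu.comp_smooth hU (hc i j k)).mul (hu'.ddx.apply k)
  -- The summand `a p q_x` is chosen to remove `q_xx` and the summand `c u_x p q` to remove `u_xx`;
  -- subtracting the total derivative leaves a first order density.
  have hW : PeriodicSmooth fun x => ∑ i, ∑ j, (a i j (u x) * p x i * ddx q x j
      + (∑ k, c i j k (u x) * ddx u x k) * p x i * q x j) :=
    PeriodicSmooth.sum fun i _ => PeriodicSmooth.sum fun j _ =>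
      (((hu.comp_smooth hU (ha i j)).mul (hp.apply i)).mul (hq.ddx.apply j)).add
        (((hθ i j).mul (hp.apply i)).mul (hq.apply j))
  have hL := hp.dot (hsm u q hu hq)
  have hR := periodicSmooth_comp_formPoint hU hdens.smooth hu hp hq
  have hd : ∀ x, HasDerivAt (fun x => ∑ i, ∑ j, (a i j (u x) * p x i * ddx q x j
      + (∑ k, c i j k (u x) * ddx u x k) * p x i * q x j))
      ((∑ i, p x i * degreeTwoOp a b c cc u q x i)
        - quadForm a (betaCoeff a b c) c (defectCoeff c cc) (formPoint u p q x)) x := by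
    intro x
    have h1 : ∀ i j, HasDerivAt (fun x => ∑ k, c i j k (u x) * ddx u x k)
        (∑ k, (∑ l, pd l (c i j k) (u x) * ddx u x l) * ddx u x k
          + ∑ k, c i j k (u x) * ddx (ddx u) x k) x := fun i j => by
      rw [← Finset.sum_add_distrib]
      exact HasDerivAt.fun_sum fun k _ =>
        (hu.hasDerivAt_comp hU (hc i j k) x).fun_mul (hu'.ddx.hasDerivAt_apply x k)
    have h2 := HasDerivAt.fun_sum (u := Finset.univ) fun i _ => HasDerivAt.fun_sum
      (u := Finset.univ) fun j _ =>
        (((hu.hasDerivAt_comp hU (ha i j) x).fun_mul (hp.hasDerivAt_apply x i)).fun_mul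
          (hq.ddx.hasDerivAt_apply x j)).fun_add
        (((h1 i j).fun_mul (hp.hasDerivAt_apply x i)).fun_mul (hq.hasDerivAt_apply x j))
    refine h2.congr_deriv (Eq.symm ?_)
    simp only [quadForm, formPoint, degreeTwoOp_apply]
    rw [← Finset.sum_sub_distrib]
    refine Finset.sum_congr rfl fun i _ => ?_
    rw [Finset.mul_sum, ← Finset.sum_sub_distrib]
    refine Finset.sum_congr rfl fun j _ => ?_
    rw [sum_defectCoeff]
    simp only [betaCoeff, sub_mul, Finset.sum_sub_distrib]
    ring
  have h := integral_deriv_eq_zero hW.periodic hd (hL.sub hR).continuous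
  rw [intervalIntegral.integral_sub (hL.intervalIntegrable _ _) (hR.intervalIntegrable _ _)] at h
  exact sub_eq_zero.1 h

end degreeTwo

end

section

variable {n : ℕ} {U : Set (Fin n → ℝ)}

/-! ### Test functions -/

lemma PeriodicSmooth.integral_mul_self_pos {f : ℝ → ℝ} (hf : PeriodicSmooth f) {x : ℝ}
    (hx : x ∈ Icc (0 : ℝ) 1) (hfx : f x ≠ 0) : 0 < ∫ x in (0 : ℝ)..1, f x * f x :=
  intervalIntegral.integral_pos zero_lt_one (hf.mul hf).continuous.continuousOn
    (fun _ _ => mul_self_nonneg _) ⟨x, hx, mul_self_pos.2 hfx⟩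

/-- Periodic functions whose derivatives have nonzero quadratic and cubic integrals. -/
lemma exists_test_functions : ∃ σ ρ η : ℝ → ℝ, PeriodicSmooth σ ∧ PeriodicSmooth ρ ∧
    PeriodicSmooth η ∧ deriv ρ = σ ∧ ∫ x in (0 : ℝ)..1, deriv σ x * deriv σ x ≠ 0 ∧
    ∫ x in (0 : ℝ)..1, deriv σ x * deriv σ x * deriv η x ≠ 0 := by
  have hπ := Real.pi_ne_zero
  have hlin : ∀ m x : ℝ, HasDerivAt (fun x : ℝ => m * x) m x := fun m x => by
    simpa using (hasDerivAt_id x).const_mul m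
  -- The normalisations give `σ_x² = 1/2 + η_x`, which reduces the cubic integral to that of `η_x²`.
  -- A single harmonic would not do, since the cube of the cosine has mean zero.
  have hσ : PeriodicSmooth fun x => Real.sin (2 * Real.pi * x) / (2 * Real.pi) := by
    refine ⟨by fun_prop, fun x => ?_⟩
    simp only [mul_add, mul_one, Real.sin_add_two_pi]
  have hρ : PeriodicSmooth fun x => -Real.cos (2 * Real.pi * x) / (2 * Real.pi) ^ 2 := by
    refine ⟨by fun_prop, fun x => ?_⟩
    simp only [mul_add, mul_one, Real.cos_add_two_pi]
  have hη : PeriodicSmooth fun x => Real.sin (2 * (2 * Real.pi * x)) / (8 * Real.pi) := by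
    refine ⟨by fun_prop, fun x => ?_⟩
    have : 2 * (2 * Real.pi * (x + 1)) = 2 * (2 * Real.pi * x) + 2 * Real.pi + 2 * Real.pi := by
      ring
    simp only [this, Real.sin_add_two_pi]
  have hσ' : deriv (fun x => Real.sin (2 * Real.pi * x) / (2 * Real.pi)) =
      fun x => Real.cos (2 * Real.pi * x) := by
    funext x
    rw [((hlin (2 * Real.pi) x).sin.div_const _).deriv]
    field_simp
  have hρ' : deriv (fun x => -Real.cos (2 * Real.pi * x) / (2 * Real.pi) ^ 2) =
      fun x => Real.sin (2 * Real.pi * x) / (2 * Real.pi) := by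
    funext x
    rw [((hlin (2 * Real.pi) x).cos.fun_neg.div_const _).deriv]
    field_simp
  have hη' : deriv (fun x => Real.sin (2 * (2 * Real.pi * x)) / (8 * Real.pi)) =
      fun x => Real.cos (2 * (2 * Real.pi * x)) / 2 := by
    funext x
    rw [(((hlin (2 * Real.pi) x).const_mul 2).sin.div_const _).deriv]
    field_simp
    ring
  refine ⟨_, _, _, hσ, hρ, hη, hρ', (hσ.deriv.integral_mul_self_pos (x := 0) (by simp)
    (by rw [hσ']; simp)).ne', ?_⟩
  have h1 := hη.deriv.integral_mul_self_pos (x := 0) (by simp) (by rw [hη']; simp)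
  have h2 := integral_deriv_eq_zero hη.periodic hη.hasDerivAt hη.deriv.continuous
  have h3 : ∀ x, deriv (fun x => Real.sin (2 * Real.pi * x) / (2 * Real.pi)) x *
      deriv (fun x => Real.sin (2 * Real.pi * x) / (2 * Real.pi)) x *
      deriv (fun x => Real.sin (2 * (2 * Real.pi * x)) / (8 * Real.pi)) x =
      1 / 2 * deriv (fun x => Real.sin (2 * (2 * Real.pi * x)) / (8 * Real.pi)) x
      + deriv (fun x => Real.sin (2 * (2 * Real.pi * x)) / (8 * Real.pi)) x *
        deriv (fun x => Real.sin (2 * (2 * Real.pi * x)) / (8 * Real.pi)) x := by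
    intro x
    simp only [hσ', hη', Real.cos_two_mul]
    ring
  simp only [h3]
  rw [((PeriodicSmooth.const _).mul hη.deriv).integral_add (hη.deriv.mul hη.deriv),
    intervalIntegral.integral_const_mul, h2, mul_zero, zero_add]
  exact h1.ne'

/-- The covector field with the only component `f` in position `j`. -/
def basisField (j : Fin n) (f : ℝ → ℝ) (x : ℝ) : Fin n → ℝ := Pi.single j (f x)

lemma smoothPeriodic_basisField (j : Fin n) {f : ℝ → ℝ} (hf : PeriodicSmooth f) :
    SmoothPeriodic (basisField j f) := by
  refine smoothPeriodic_iff.2 fun i => ?_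
  by_cases h : i = j
  · subst h; simpa [basisField] using hf
  · simpa [basisField, h] using PeriodicSmooth.const 0

lemma ddx_basisField (j : Fin n) (f : ℝ → ℝ) :
    ddx (basisField j f) = basisField j (deriv f) := by
  funext x i
  by_cases h : i = j
  · subst h; simp [basisField, ddx]
  · simp [basisField, ddx, h]

lemma isLoop_const {w : Fin n → ℝ} (hw : w ∈ U) : IsLoop U fun _ : ℝ => w :=
  ⟨⟨contDiff_const, fun _ => rfl⟩, fun _ => hw⟩

lemma ddx_const (w : Fin n → ℝ) : ddx (fun _ : ℝ => w) = 0 := by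
  funext x i
  simp [ddx]

lemma ddx_const_add_smul (w : Fin n → ℝ) {v : ℝ → Fin n → ℝ} (hv : SmoothPeriodic v) (t : ℝ) :
    ddx ((fun _ => w) + t • v) = t • ddx v := by
  have hw : SmoothPeriodic fun _ : ℝ => w := ⟨contDiff_const, fun _ => rfl⟩
  rw [hw.ddx_add (hv.smul t), ddx_const, hv.ddx_smul, zero_add]

/-- Allows an identity to be divided by `t` for `t ≠ 0` and then evaluated at `t = 0`, by continuity
of the integral in the parameter. -/
lemma integral_eq_zero_of_strip {δ : ℝ} {h : ℝ × ℝ → ℝ} (hδ : 0 < δ)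
    (hh : ContDiffOn ℝ ∞ h (strip δ))
    (h0 : ∀ t ∈ Ioo (-δ) δ, t ≠ 0 → ∫ x in (0 : ℝ)..1, h (t, x) = 0) :
    ∫ x in (0 : ℝ)..1, h (0, x) = 0 := by
  have hc := (hasDerivAt_integral_strip hδ hh).continuousAt.tendsto.mono_left
    (nhdsWithin_le_nhds (s := {0}ᶜ))
  refine tendsto_nhds_unique hc (tendsto_const_nhds.congr' ?_)
  filter_upwards [nhdsWithin_le_nhds (Ioo_mem_nhds (neg_neg_of_pos hδ) hδ),
    self_mem_nhdsWithin] with t ht ht0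
  exact (h0 t ht ht0).symm

lemma contDiffOn_comp_variation {f : (Fin n → ℝ) → ℝ} (hf : ContDiffOn ℝ ∞ f U)
    {u φ : ℝ → Fin n → ℝ} (hu : SmoothPeriodic u) (hφ : SmoothPeriodic φ) {δ : ℝ}
    (hloop : ∀ τ ∈ Ioo (-δ) δ, IsLoop U (u + τ • φ)) :
    ContDiffOn ℝ ∞ (fun z : ℝ × ℝ => f ((u + z.1 • φ) z.2)) (strip δ) :=
  hf.comp ((hu.smooth.comp contDiff_snd).add
    (contDiff_fst.smul (hφ.smooth.comp contDiff_snd))).contDiffOn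
    fun z hz => (hloop z.1 (mem_strip.1 hz)).mem z.2

/-- Linear terms in `u_x` of an identity valid for all loops can be separated. -/
lemma coeff_eq_zero_of_integral (hU : IsOpen U) {f : Fin n → (Fin n → ℝ) → ℝ}
    {e : Fin n → Fin n → (Fin n → ℝ) → ℝ} (hf : ∀ k, ContDiffOn ℝ ∞ (f k) U)
    (he : ∀ k l, ContDiffOn ℝ ∞ (e k l) U) {ψ χ η : ℝ → ℝ} (hψ : PeriodicSmooth ψ)
    (hχ : PeriodicSmooth χ) (hη : PeriodicSmooth η)
    (hne : ∫ x in (0 : ℝ)..1, ψ x * deriv η x ≠ 0)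
    (hint : ∀ u, IsLoop U u → ∫ x in (0 : ℝ)..1, ((∑ k, f k (u x) * ddx u x k) * ψ x
      + (∑ k, ∑ l, e k l (u x) * ddx u x k * ddx u x l) * χ x) = 0)
    (k : Fin n) : ∀ w ∈ U, f k w = 0 := by
  intro w hw
  -- On the loops `w + t v` the linear terms in `u_x` are of order `t` and the quadratic ones of
  -- order `t²`. Dividing by `t` and letting `t → 0` leaves `f_k(w) ∫ ψ η_x`.
  set v : ℝ → Fin n → ℝ := basisField k η
  have hv : SmoothPeriodic v := smoothPeriodic_basisField k hη
  have hw' := isLoop_const hw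
  obtain ⟨δ, hδ, hloop⟩ := hw'.exists_variation hU hv
  set u : ℝ → ℝ → Fin n → ℝ := fun t => (fun _ => w) + t • v
  have hcomp : ∀ f : (Fin n → ℝ) → ℝ, ContDiffOn ℝ ∞ f U →
      ContDiffOn ℝ ∞ (fun z : ℝ × ℝ => f (u z.1 z.2)) (strip δ) := fun f hf =>
    contDiffOn_comp_variation hf hw'.toSmoothPeriodic hv hloop
  have hsnd : ∀ r : ℝ → ℝ, PeriodicSmooth r →
      ContDiffOn ℝ ∞ (fun z : ℝ × ℝ => r z.2) (strip δ) := fun r hr =>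
    (hr.smooth.comp contDiff_snd).contDiffOn
  have hh : ContDiffOn ℝ ∞ (fun z : ℝ × ℝ => (∑ k, f k (u z.1 z.2) * ddx v z.2 k) * ψ z.2
      + z.1 * ((∑ k, ∑ l, e k l (u z.1 z.2) * ddx v z.2 k * ddx v z.2 l) * χ z.2)) (strip δ) :=
    ((ContDiffOn.sum fun k _ => (hcomp _ (hf k)).mul (hsnd _ (hv.ddx.apply k))).mul
      (hsnd _ hψ)).add (contDiff_fst.contDiffOn.mul ((ContDiffOn.sum fun k _ =>
        ContDiffOn.sum fun l _ => ((hcomp _ (he k l)).mul (hsnd _ (hv.ddx.apply k))).mul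
          (hsnd _ (hv.ddx.apply l))).mul (hsnd _ hχ)))
  have h0 := integral_eq_zero_of_strip hδ hh fun t ht ht0 => by
    have h1 := hint (u t) (hloop t ht)
    refine ((mul_eq_zero (a := t)).1 ?_).resolve_left ht0
    rw [← intervalIntegral.integral_const_mul]
    refine Eq.trans ?_ h1
    refine intervalIntegral.integral_congr fun x _ => ?_
    simp only [u, ddx_const_add_smul w hv, Pi.smul_apply, smul_eq_mul, mul_add, Finset.mul_sum,
      Finset.sum_mul]
    congr 1
    · exact Finset.sum_congr rfl fun k _ => by ring
    · exact Finset.sum_congr rfl fun k _ => Finset.sum_congr rfl fun l _ => by ring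
  have h2 : ∀ x, (∑ k, f k (u 0 x) * ddx v x k) * ψ x = f k w * (ψ x * deriv η x) := by
    intro x
    simp only [u, v, ddx_basisField, basisField, zero_smul, add_zero, Pi.single_apply, mul_ite,
      mul_zero, Finset.sum_ite_eq', Finset.mem_univ, if_true]
    ring
  simp only [zero_mul, add_zero, h2] at h0
  rw [intervalIntegral.integral_const_mul] at h0
  exact (mul_eq_zero.1 h0).resolve_right hne

/-! ### Consequences of antisymmetry -/

section antisymm

variable {a : Fin n → Fin n → (Fin n → ℝ) → ℝ} {β c : Fin n → Fin n → Fin n → (Fin n → ℝ) → ℝ}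
  {d : Fin n → Fin n → Fin n → Fin n → (Fin n → ℝ) → ℝ}

lemma quadForm_single (i j : Fin n) (w w' : Fin n → ℝ) (p p' q q' : ℝ) :
    quadForm a β c d (w, w', Pi.single i p, Pi.single i p', Pi.single j q, Pi.single j q') =
      -(a i j w * p' * q') + (∑ k, β i j k w * w' k) * p * q'
        - (∑ k, c i j k w * w' k) * p' * q
        + (∑ k, ∑ l, d i j k l w * w' k * w' l) * p * q := by
  rw [quadForm, Finset.sum_eq_single i, Finset.sum_eq_single j]
  · simp
  · intro j' _ hj
    simp [Pi.single_eq_of_ne hj]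
  · simp
  · intro i' _ hi
    exact Finset.sum_eq_zero fun j' _ => by simp [Pi.single_eq_of_ne hi]
  · simp

lemma formPoint_basisField (u : ℝ → Fin n → ℝ) (i j : Fin n) (f h : ℝ → ℝ) (x : ℝ) :
    formPoint u (basisField i f) (basisField j h) x = (u x, ddx u x, Pi.single i (f x),
      Pi.single i (deriv f x), Pi.single j (h x), Pi.single j (deriv h x)) := by
  simp only [formPoint, ddx_basisField, basisField]

variable {P : Operator n}

lemma HasFormDensity.integral_symm_eq_zero (hU : IsOpen U) {ℓ : FormPoint n → ℝ}
    (hP : HasFormDensity U P ℓ) {u p q : ℝ → Fin n → ℝ} (hu : IsLoop U u) (hp : SmoothPeriodic p)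
    (hq : SmoothPeriodic q) :
    ∫ x in (0 : ℝ)..1, (ℓ (formPoint u p q x) + ℓ (formPoint u q p x)) = 0 := by
  rw [(periodicSmooth_comp_formPoint hU hP.smooth hu hp hq).integral_add
    (periodicSmooth_comp_formPoint hU hP.smooth hu hq hp), ← hP.integral_eq u p q hu hp hq,
    ← hP.integral_eq u q p hu hq hp, hP.antisymm u p q hu hp hq]
  ring

lemma HasFormDensity.quadForm_symm_eq_zero (hU : IsOpen U)
    (hP : HasFormDensity U P (quadForm a β c d)) {u : ℝ → Fin n → ℝ} (hu : IsLoop U u)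
    {f h : ℝ → ℝ} (hf : PeriodicSmooth f) (hh : PeriodicSmooth h) (i j : Fin n) :
    ∫ x in (0 : ℝ)..1, (-(a i j (u x) * deriv f x * deriv h x)
        + (∑ k, β i j k (u x) * ddx u x k) * f x * deriv h x
        - (∑ k, c i j k (u x) * ddx u x k) * deriv f x * h x
        + (∑ k, ∑ l, d i j k l (u x) * ddx u x k * ddx u x l) * f x * h x
      + (-(a j i (u x) * deriv h x * deriv f x)
        + (∑ k, β j i k (u x) * ddx u x k) * h x * deriv f x
        - (∑ k, c j i k (u x) * ddx u x k) * deriv h x * f x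
        + (∑ k, ∑ l, d j i k l (u x) * ddx u x k * ddx u x l) * h x * f x)) = 0 := by
  have := hP.integral_symm_eq_zero hU hu (smoothPeriodic_basisField i hf)
    (smoothPeriodic_basisField j hh)
  simpa only [formPoint_basisField, quadForm_single] using this

/-- Antisymmetry is tested with the constant `1` in position `i` and `σ` in position `j`. The
vanishing derivative of the constant removes `a` and half of the first order terms, leaving
`β^{ij}_k - c^{ji}_k` as the coefficient linear in `u_x`. -/
lemma HasFormDensity.beta_eq (hU : IsOpen U) (hP : HasFormDensity U P (quadForm a β c d))
    (hβ : ∀ i j k, ContDiffOn ℝ ∞ (β i j k) U) (hc : ∀ i j k, ContDiffOn ℝ ∞ (c i j k) U)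
    (hd : ∀ i j k l, ContDiffOn ℝ ∞ (d i j k l) U) (i j k : Fin n) :
    ∀ w ∈ U, β i j k w = c j i k w := by
  intro w hw
  obtain ⟨σ, -, -, hσ, -, -, -, hne, -⟩ := exists_test_functions
  have := coeff_eq_zero_of_integral hU (f := fun k w => β i j k w - c j i k w)
    (e := fun k l w => d i j k l w + d j i k l w)
    (fun k => (hβ i j k).sub (hc j i k)) (fun k l => (hd i j k l).add (hd j i k l)) hσ.deriv hσ hσ
    hne (fun u hu => ?_) k w hw
  · linarith
  · refine Eq.trans ?_ (hP.quadForm_symm_eq_zero hU hu (PeriodicSmooth.const 1) hσ i j)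
    refine intervalIntegral.integral_congr fun x _ => ?_
    simp only [add_mul, sub_mul, Finset.sum_add_distrib, Finset.sum_sub_distrib, deriv_const,
      mul_zero, mul_one, neg_zero, zero_mul, zero_add, sub_zero, add_zero]
    ring

end antisymm

end

section

variable {n : ℕ} {U : Set (Fin n → ℝ)} {g : Fin n → Fin n → (Fin n → ℝ) → ℝ}
  {a : Fin n → Fin n → (Fin n → ℝ) → ℝ} {β c : Fin n → Fin n → Fin n → (Fin n → ℝ) → ℝ}
  {d : Fin n → Fin n → Fin n → Fin n → (Fin n → ℝ) → ℝ} {u p q r : ℝ → Fin n → ℝ}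

/-! ### Variations of the densities -/

/-- Directional derivatives of densities in the directions of the loop. -/
lemma IsFormDensity.hasDerivAt_line (hU : IsOpen U) {ℓ : FormPoint n → ℝ}
    (hℓ : IsFormDensity U ℓ) {w : Fin n → ℝ} (hw : w ∈ U) (w' p p' q q' v v' : Fin n → ℝ) :
    HasDerivAt (fun τ : ℝ => ℓ (w + τ • v, w' + τ • v', p, p', q, q'))
      (fderiv ℝ ℓ (w, w', p, p', q, q') (v, v', 0, 0, 0, 0)) 0 := by
  have hd : HasFDerivAt ℓ (fderiv ℝ ℓ (w, w', p, p', q, q')) (w, w', p, p', q, q') :=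
    (hℓ.differentiableAt hU (z := (w, w', p, p', q, q')) hw).hasFDerivAt
  have hline : ∀ e f : Fin n → ℝ, HasDerivAt (fun τ : ℝ => e + τ • f) f 0 := fun e f => by
    simpa using ((hasDerivAt_id (0 : ℝ)).smul_const f).const_add e
  exact HasFDerivAt.comp_hasDerivAt (0 : ℝ) (by simpa using hd) ((hline w v).prodMk
    ((hline w' v').prodMk ((hasDerivAt_const _ p).prodMk ((hasDerivAt_const _ p').prodMk
      ((hasDerivAt_const _ q).prodMk (hasDerivAt_const _ q'))))))

lemma hasDerivAt_line_pd (hU : IsOpen U) {f : (Fin n → ℝ) → ℝ} (hf : ContDiffOn ℝ ∞ f U)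
    {w : Fin n → ℝ} (hw : w ∈ U) (v : Fin n → ℝ) :
    HasDerivAt (fun τ : ℝ => f (w + τ • v)) (∑ s, pd s f w * v s) 0 := by
  have hline : HasDerivAt (fun τ : ℝ => w + τ • v) v 0 := by
    simpa using ((hasDerivAt_id (0 : ℝ)).smul_const v).const_add w
  simpa using hasDerivAt_comp_pd hU hf hline (by simpa using hw)

/-- The density depends on the loop only through `g^{ij}`, which is locally constant in flat
coordinates. -/
lemma fderiv_metricForm (hU : IsOpen U) (hg : IsMetric U g) (hflat : IsFlatCoord U g)
    {w : Fin n → ℝ} (hw : w ∈ U) (w' p p' q q' v v' : Fin n → ℝ) :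
    fderiv ℝ (metricForm g) (w, w', p, p', q, q') (v, v', 0, 0, 0, 0) = 0 := by
  refine ((isFormDensity_metricForm hg.smooth).hasDerivAt_line hU hw w' p p' q q' v v').unique ?_
  have h : HasDerivAt (fun τ : ℝ => ∑ i, ∑ j, g i j (w + τ • v) * p i * q' j)
      (∑ i, ∑ j, (∑ s, pd s (g i j) w * v s) * p i * q' j) 0 :=
    HasDerivAt.fun_sum fun i _ => HasDerivAt.fun_sum fun j _ =>
      ((hasDerivAt_line_pd hU (hg.smooth i j) hw v).mul_const (p i)).mul_const (q' j)
  exact h.congr_deriv (by simp [hflat.pd_eq_zero hU hg hw])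

lemma fderiv_quadForm (hU : IsOpen U) (ha : ∀ i j, ContDiffOn ℝ ∞ (a i j) U)
    (hβ : ∀ i j k, ContDiffOn ℝ ∞ (β i j k) U) (hc : ∀ i j k, ContDiffOn ℝ ∞ (c i j k) U)
    (hd : ∀ i j k l, ContDiffOn ℝ ∞ (d i j k l) U) {w : Fin n → ℝ} (hw : w ∈ U)
    (w' p p' q q' v v' : Fin n → ℝ) :
    fderiv ℝ (quadForm a β c d) (w, w', p, p', q, q') (v, v', 0, 0, 0, 0) =
      ∑ i, ∑ j, (-((∑ s, pd s (a i j) w * v s) * p' i * q' j)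
        + (∑ k, ((∑ s, pd s (β i j k) w * v s) * w' k + β i j k w * v' k)) * p i * q' j
        - (∑ k, ((∑ s, pd s (c i j k) w * v s) * w' k + c i j k w * v' k)) * p' i * q j
        + (∑ k, ∑ l, (((∑ s, pd s (d i j k l) w * v s) * w' k + d i j k l w * v' k) * w' l
          + d i j k l w * w' k * v' l)) * p i * q j) := by
  refine ((isFormDensity_quadForm ha hβ hc hd).hasDerivAt_line hU hw w' p p' q q' v v').unique ?_
  have hl : ∀ k, HasDerivAt (fun τ : ℝ => (w' + τ • v') k) (v' k) 0 := fun k => by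
    simpa using ((hasDerivAt_id (0 : ℝ)).mul_const (v' k)).const_add (w' k)
  have h1 : ∀ f : (Fin n → ℝ) → ℝ, ContDiffOn ℝ ∞ f U → ∀ k,
      HasDerivAt (fun τ : ℝ => f (w + τ • v) * (w' + τ • v') k)
        ((∑ s, pd s f w * v s) * w' k + f w * v' k) 0 := fun f hf k => by
    simpa using (hasDerivAt_line_pd hU hf hw v).fun_mul (hl k)
  have h2 : ∀ f : (Fin n → ℝ) → ℝ, ContDiffOn ℝ ∞ f U → ∀ k l,
      HasDerivAt (fun τ : ℝ => f (w + τ • v) * (w' + τ • v') k * (w' + τ • v') l)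
        (((∑ s, pd s f w * v s) * w' k + f w * v' k) * w' l + f w * w' k * v' l) 0 :=
    fun f hf k l => by simpa using (h1 f hf k).fun_mul (hl l)
  exact HasDerivAt.fun_sum fun i _ => HasDerivAt.fun_sum fun j _ =>
    ((((((hasDerivAt_line_pd hU (ha i j) hw v).mul_const (p' i)).mul_const (q' j)).fun_neg).fun_add
      (((HasDerivAt.fun_sum fun k _ => h1 _ (hβ i j k) k).mul_const (p i)).mul_const
        (q' j))).fun_sub
      (((HasDerivAt.fun_sum fun k _ => h1 _ (hc i j k) k).mul_const (p' i)).mul_const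
        (q j))).fun_add
      (((HasDerivAt.fun_sum fun k _ => HasDerivAt.fun_sum fun l _ =>
        h2 _ (hd i j k l) k l).mul_const (p i)).mul_const (q j))

/-! ### Raised indices -/

/-- Raising an index: `g^{ms} f_s`. -/
def raise (g : Fin n → Fin n → (Fin n → ℝ) → ℝ) (m : Fin n) (f : Fin n → (Fin n → ℝ) → ℝ)
    (w : Fin n → ℝ) : ℝ :=
  ∑ s, g m s w * f s w

lemma contDiffOn_raise (hg : IsMetric U g) {f : Fin n → (Fin n → ℝ) → ℝ}
    (hf : ∀ s, ContDiffOn ℝ ∞ (f s) U) (m : Fin n) : ContDiffOn ℝ ∞ (raise g m f) U :=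
  ContDiffOn.sum fun s _ => (hg.smooth m s).mul (hf s)

/-- Moves the metric contained in `P₁ r` onto the coefficient contracted with it, turning variations
along `P₁ r` into coefficients with a raised index. -/
lemma IsMetric.sum_mul_sum (hg : IsMetric U g) {w : Fin n → ℝ} (hw : w ∈ U)
    (f : Fin n → (Fin n → ℝ) → ℝ) (v : Fin n → ℝ) :
    ∑ s, f s w * ∑ m, g s m w * v m = ∑ m, raise g m f w * v m := by
  simp only [raise, Finset.mul_sum, Finset.sum_mul]
  rw [Finset.sum_comm]
  refine Finset.sum_congr rfl fun m _ => Finset.sum_congr rfl fun s _ => ?_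
  rw [hg.symm s m w hw]
  ring

/-- `g^{ms} a^{ij}_{,s}` along a loop. -/
def aUp (g a : Fin n → Fin n → (Fin n → ℝ) → ℝ) (u : ℝ → Fin n → ℝ) (x : ℝ) (i j m : Fin n) : ℝ :=
  raise g m (fun s => pd s (a i j)) (u x)

/-- `g^{ms} c^{ij}_s` along a loop. -/
def cUp (g : Fin n → Fin n → (Fin n → ℝ) → ℝ) (c : Fin n → Fin n → Fin n → (Fin n → ℝ) → ℝ)
    (u : ℝ → Fin n → ℝ) (x : ℝ) (i j m : Fin n) : ℝ :=
  raise g m (c i j) (u x)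

/-- The derivative `g^{ms} c^{ij}_{s,k} u^k_x` of `g^{ms} c^{ij}_s` along a loop. -/
def cUpDeriv (g : Fin n → Fin n → (Fin n → ℝ) → ℝ) (c : Fin n → Fin n → Fin n → (Fin n → ℝ) → ℝ)
    (u : ℝ → Fin n → ℝ) (x : ℝ) (i j m : Fin n) : ℝ :=
  ∑ k, raise g m (fun s => pd k (c i j s)) (u x) * ddx u x k

/-- `g^{ms} c^{ij}_{k,s} u^k_x` along a loop. -/
def cDerivUp (g : Fin n → Fin n → (Fin n → ℝ) → ℝ) (c : Fin n → Fin n → Fin n → (Fin n → ℝ) → ℝ)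
    (u : ℝ → Fin n → ℝ) (x : ℝ) (i j m : Fin n) : ℝ :=
  ∑ k, raise g m (fun s => pd s (c i j k)) (u x) * ddx u x k

/-- `g^{ms} (d^{ij}_{sk} + d^{ij}_{ks}) u^k_x` along a loop. -/
def dUp (g : Fin n → Fin n → (Fin n → ℝ) → ℝ) (d : Fin n → Fin n → Fin n → Fin n → (Fin n → ℝ) → ℝ)
    (u : ℝ → Fin n → ℝ) (x : ℝ) (i j m : Fin n) : ℝ :=
  ∑ k, raise g m (fun s w => d i j s k w + d i j k s w) (u x) * ddx u x k

/-- `g^{ms} d^{ij}_{kl,s} u^k_x u^l_x` along a loop. -/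
def dDerivUp (g : Fin n → Fin n → (Fin n → ℝ) → ℝ)
    (d : Fin n → Fin n → Fin n → Fin n → (Fin n → ℝ) → ℝ)
    (u : ℝ → Fin n → ℝ) (x : ℝ) (i j m : Fin n) : ℝ :=
  ∑ k, ∑ l, raise g m (fun s => pd s (d i j k l)) (u x) * ddx u x k * ddx u x l

lemma ddx_hydroOp (hU : IsOpen U) (hg : IsMetric U g) (hflat : IsFlatCoord U g) (hu : IsLoop U u)
    (hr : SmoothPeriodic r) (x : ℝ) (i : Fin n) :
    ddx (hydroOp g u r) x i = ∑ m, g i m (u x) * ddx (ddx r) x m := by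
  have h : (fun y => hydroOp g u r y i) = fun y => ∑ m, g i m (u y) * ddx r y m :=
    funext fun y => hydroOp_apply hflat hu r y i
  rw [ddx, h]
  refine HasDerivAt.deriv (HasDerivAt.fun_sum fun m _ => ?_)
  simpa using (hflat.hasDerivAt_metric_loop hU hg hu x i m).fun_mul (hr.ddx.hasDerivAt_apply x m)

lemma hasDerivAt_cUp (hU : IsOpen U) (hg : IsMetric U g) (hflat : IsFlatCoord U g)
    (hc : ∀ i j k, ContDiffOn ℝ ∞ (c i j k) U) (hu : IsLoop U u) (x : ℝ) (i j m : Fin n) :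
    HasDerivAt (fun y => cUp g c u y i j m) (cUpDeriv g c u x i j m) x := by
  have h := HasDerivAt.fun_sum (u := Finset.univ) fun s _ =>
    (hflat.hasDerivAt_metric_loop hU hg hu x m s).fun_mul (hu.hasDerivAt_comp hU (hc i j s) x)
  refine h.congr_deriv ?_
  simp only [cUpDeriv, raise, zero_mul, zero_add, Finset.mul_sum, Finset.sum_mul]
  rw [Finset.sum_comm]
  exact Finset.sum_congr rfl fun k _ => Finset.sum_congr rfl fun s _ => by ring

/-- The variation of the density of the degree two operator along `P₁ r`. -/
lemma fderiv_quadForm_hydroOp (hU : IsOpen U) (hg : IsMetric U g) (hflat : IsFlatCoord U g)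
    (ha : ∀ i j, ContDiffOn ℝ ∞ (a i j) U) (hc : ∀ i j k, ContDiffOn ℝ ∞ (c i j k) U)
    (hd : ∀ i j k l, ContDiffOn ℝ ∞ (d i j k l) U) (hu : IsLoop U u) (hr : SmoothPeriodic r)
    (p q : ℝ → Fin n → ℝ) (x : ℝ) :
    fderiv ℝ (quadForm a (fun i j => c j i) c d) (formPoint u p q x)
        (hydroOp g u r x, ddx (hydroOp g u r) x, 0, 0, 0, 0) =
      ∑ i, ∑ j, ∑ m, (-(aUp g a u x i j m * ddx p x i * ddx q x j * ddx r x m)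
        + (cDerivUp g c u x j i m * ddx r x m + cUp g c u x j i m * ddx (ddx r) x m)
          * p x i * ddx q x j
        - (cDerivUp g c u x i j m * ddx r x m + cUp g c u x i j m * ddx (ddx r) x m)
          * ddx p x i * q x j
        + (dDerivUp g d u x i j m * ddx r x m + dUp g d u x i j m * ddx (ddx r) x m)
          * p x i * q x j) := by
  have hux := hu.mem x
  have hv : ∀ f : Fin n → (Fin n → ℝ) → ℝ, ∑ s, f s (u x) * hydroOp g u r x s =
      ∑ m, raise g m f (u x) * ddx r x m := fun f => by
    simp only [hydroOp_apply hflat hu, hg.sum_mul_sum hux]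
  have hv' : ∀ f : Fin n → (Fin n → ℝ) → ℝ, ∑ s, f s (u x) * ddx (hydroOp g u r) x s =
      ∑ m, raise g m f (u x) * ddx (ddx r) x m := fun f => by
    simp only [ddx_hydroOp hU hg hflat hu hr, hg.sum_mul_sum hux]
  have h1 : ∀ i j, ∑ k, ((∑ s, pd s (c i j k) (u x) * hydroOp g u r x s) * ddx u x k
      + c i j k (u x) * ddx (hydroOp g u r) x k) =
      ∑ m, (cDerivUp g c u x i j m * ddx r x m + cUp g c u x i j m * ddx (ddx r) x m) := by
    intro i j
    rw [Finset.sum_add_distrib, hv', Finset.sum_add_distrib]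
    congr 1
    simp only [hv fun s => pd s (c i j _), cDerivUp, Finset.sum_mul]
    rw [Finset.sum_comm]
    exact Finset.sum_congr rfl fun m _ => Finset.sum_congr rfl fun k _ => by ring
  have h2 : ∀ i j, ∑ k, ∑ l, (((∑ s, pd s (d i j k l) (u x) * hydroOp g u r x s) * ddx u x k
        + d i j k l (u x) * ddx (hydroOp g u r) x k) * ddx u x l
        + d i j k l (u x) * ddx u x k * ddx (hydroOp g u r) x l) =
      ∑ m, (dDerivUp g d u x i j m * ddx r x m + dUp g d u x i j m * ddx (ddx r) x m) := by
    intro i j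
    have e1 : ∑ k, ∑ l, (∑ s, pd s (d i j k l) (u x) * hydroOp g u r x s) * ddx u x k
        * ddx u x l = ∑ m, dDerivUp g d u x i j m * ddx r x m := by
      simp only [hv fun s => pd s (d i j _ _), dDerivUp, Finset.sum_mul]
      rw [Finset.sum_congr rfl fun k _ => Finset.sum_comm, Finset.sum_comm]
      exact Finset.sum_congr rfl fun m _ => Finset.sum_congr rfl fun k _ =>
        Finset.sum_congr rfl fun l _ => by ring
    -- Either of the two factors `u_x` may be varied, hence the symmetrised combination `d_{sk} +
    -- d_{ks}` in `dUp`.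
    have e2 : ∑ k, ∑ l, d i j k l (u x) * ddx (hydroOp g u r) x k * ddx u x l
        + ∑ k, ∑ l, d i j k l (u x) * ddx u x k * ddx (hydroOp g u r) x l =
        ∑ m, dUp g d u x i j m * ddx (ddx r) x m := by
      have e3 : ∀ k, ∑ m, raise g m (fun s w => d i j s k w + d i j k s w) (u x)
          * ddx (ddx r) x m = ∑ s, (d i j s k (u x) + d i j k s (u x))
            * ddx (hydroOp g u r) x s := fun k =>
        (hv' fun s w => d i j s k w + d i j k s w).symm
      have e4 : ∑ m, dUp g d u x i j m * ddx (ddx r) x m = ∑ k, (∑ m, raise g m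
          (fun s w => d i j s k w + d i j k s w) (u x) * ddx (ddx r) x m) * ddx u x k := by
        simp only [dUp, Finset.sum_mul]
        rw [Finset.sum_comm]
        exact Finset.sum_congr rfl fun m _ => Finset.sum_congr rfl fun k _ => by ring
      rw [e4]
      simp only [e3, add_mul, Finset.sum_add_distrib, Finset.sum_mul]
      rw [Finset.sum_comm]
      congr 1
      exact Finset.sum_congr rfl fun m _ => Finset.sum_congr rfl fun k _ => by ring
    simp only [add_mul, Finset.sum_add_distrib]
    rw [e1, add_assoc, e2]
  rw [formPoint, fderiv_quadForm hU ha (fun i j k => hc j i k) hc hd hux]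
  refine Finset.sum_congr rfl fun i _ => Finset.sum_congr rfl fun j _ => ?_
  rw [h1 j i, h1 i j, h2 i j, hv fun s => pd s (a i j)]
  simp only [Finset.sum_mul, ← Finset.sum_neg_distrib, ← Finset.sum_add_distrib,
    ← Finset.sum_sub_distrib]
  exact Finset.sum_congr rfl fun m _ => by rw [aUp]; ring

/-! ### The first order Jacobiator -/

/-- The sum over cyclic permutations of the variations of the degree two operator. -/
def cyclicVariation (g a : Fin n → Fin n → (Fin n → ℝ) → ℝ)
    (c : Fin n → Fin n → Fin n → (Fin n → ℝ) → ℝ)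
    (d : Fin n → Fin n → Fin n → Fin n → (Fin n → ℝ) → ℝ) (u p q r : ℝ → Fin n → ℝ) : ℝ :=
  formVariation (quadForm a (fun i j => c j i) c d) u p q (hydroOp g u r)
    + formVariation (quadForm a (fun i j => c j i) c d) u q r (hydroOp g u p)
    + formVariation (quadForm a (fun i j => c j i) c d) u r p (hydroOp g u q)

/-- The coefficient of `p_{i,x} q_{j,x} r_{m,x}`. -/
def coeffCyclic (g a : Fin n → Fin n → (Fin n → ℝ) → ℝ)
    (c : Fin n → Fin n → Fin n → (Fin n → ℝ) → ℝ) (u : ℝ → Fin n → ℝ) (x : ℝ) (i j m : Fin n) : ℝ :=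
  aUp g a u x i j m + aUp g a u x j m i + aUp g a u x m i j
    - cUp g c u x i j m - cUp g c u x j m i - cUp g c u x m i j

/-- The coefficient of `p_{i,x} q_j r_{m,x}`. -/
def coeffClosed (g : Fin n → Fin n → (Fin n → ℝ) → ℝ) (c : Fin n → Fin n → Fin n → (Fin n → ℝ) → ℝ)
    (u : ℝ → Fin n → ℝ) (x : ℝ) (i j m : Fin n) : ℝ :=
  cDerivUp g c u x i j m - cDerivUp g c u x m j i - cUpDeriv g c u x i j m

/-- The coefficient of `p_{i,xx} q_j r_{m,x}`. -/
def coeffSymm (g : Fin n → Fin n → (Fin n → ℝ) → ℝ) (c : Fin n → Fin n → Fin n → (Fin n → ℝ) → ℝ)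
    (u : ℝ → Fin n → ℝ) (x : ℝ) (i j m : Fin n) : ℝ :=
  cUp g c u x i j m + cUp g c u x m j i

/-- The component with indices `i`, `j`, `m` of the first order Jacobiator, integrated by parts. -/
def cubicTerm (g a : Fin n → Fin n → (Fin n → ℝ) → ℝ)
    (c : Fin n → Fin n → Fin n → (Fin n → ℝ) → ℝ)
    (d : Fin n → Fin n → Fin n → Fin n → (Fin n → ℝ) → ℝ) (u : ℝ → Fin n → ℝ) (x : ℝ)
    (i j m : Fin n) (p p₁ p₂ q q₁ q₂ r r₁ r₂ : ℝ) : ℝ :=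
  -(coeffCyclic g a c u x i j m * p₁ * q₁ * r₁)
    - q * (coeffClosed g c u x i j m * p₁ * r₁ - coeffSymm g c u x i j m * p₂ * r₁)
    - r * (coeffClosed g c u x j m i * q₁ * p₁ - coeffSymm g c u x j m i * q₂ * p₁)
    - p * (coeffClosed g c u x m i j * r₁ * q₁ - coeffSymm g c u x m i j * r₂ * q₁)
    + (dDerivUp g d u x i j m * r₁ + dUp g d u x i j m * r₂) * p * q
    + (dDerivUp g d u x j m i * p₁ + dUp g d u x j m i * p₂) * q * r
    + (dDerivUp g d u x m i j * q₁ + dUp g d u x m i j * q₂) * r * p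

/-- The density of the first order Jacobiator. -/
def cubicForm (g a : Fin n → Fin n → (Fin n → ℝ) → ℝ)
    (c : Fin n → Fin n → Fin n → (Fin n → ℝ) → ℝ)
    (d : Fin n → Fin n → Fin n → Fin n → (Fin n → ℝ) → ℝ) (u p q r : ℝ → Fin n → ℝ) (x : ℝ) : ℝ :=
  ∑ i, ∑ j, ∑ m, cubicTerm g a c d u x i j m (p x i) (ddx p x i) (ddx (ddx p) x i)
    (q x j) (ddx q x j) (ddx (ddx q) x j) (r x m) (ddx r x m) (ddx (ddx r) x m)

/-- Relabelling that lets the three cyclic summands share the convention of index `i` for `p`, `j`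
for `q` and `m` for `r`. -/
lemma sum_rotate (f : Fin n → Fin n → Fin n → ℝ) :
    ∑ i, ∑ j, ∑ m, f i j m = ∑ i, ∑ j, ∑ m, f j m i := by
  rw [Finset.sum_comm, Finset.sum_congr rfl fun j _ => Finset.sum_comm, Finset.sum_comm]
  rw [Finset.sum_congr rfl fun j _ => Finset.sum_comm, Finset.sum_comm]

lemma PeriodicSmooth.integral_add_deriv {f h : ℝ → ℝ} (hf : PeriodicSmooth f)
    (hh : PeriodicSmooth h) :
    ∫ x in (0 : ℝ)..1, (f x + _root_.deriv h x) = ∫ x in (0 : ℝ)..1, f x := by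
  rw [hf.integral_add hh.deriv,
    integral_deriv_eq_zero hh.periodic hh.hasDerivAt hh.deriv.continuous, add_zero]

lemma cyclicVariation_eq (hU : IsOpen U) (hg : IsMetric U g) (hflat : IsFlatCoord U g)
    (ha : ∀ i j, ContDiffOn ℝ ∞ (a i j) U) (hc : ∀ i j k, ContDiffOn ℝ ∞ (c i j k) U)
    (hd : ∀ i j k l, ContDiffOn ℝ ∞ (d i j k l) U) (hu : IsLoop U u) (hp : SmoothPeriodic p)
    (hq : SmoothPeriodic q) (hr : SmoothPeriodic r) :
    cyclicVariation g a c d u p q r = ∫ x in (0 : ℝ)..1, cubicForm g a c d u p q r x := by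
  have hℓ := (isFormDensity_quadForm ha (fun i j k => hc j i k) hc hd).smooth
  have hsm : ∀ s, SmoothPeriodic s → SmoothPeriodic (hydroOp g u s) := fun s hs =>
    (hasFormDensity_hydroOp hU hg hflat).smoothPeriodic u s hu hs
  have h1 := periodicSmooth_formVariation hU hℓ hu hp hq (hsm r hr)
  have h2 := periodicSmooth_formVariation hU hℓ hu hq hr (hsm p hp)
  have h3 := periodicSmooth_formVariation hU hℓ hu hr hp (hsm q hq)
  have hcUp : ∀ i j m, PeriodicSmooth fun x => cUp g c u x i j m := fun i j m =>
    hu.comp_smooth hU (contDiffOn_raise hg (hc i j) m)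
  -- The derivative of `c p_x q r_x` cancels the term `-c p_x q r_xx` of the variation. It also
  -- feeds the `p_x q_x r_x` terms, and its `p_xx q r_x` term combines with a cyclic image of `c p
  -- q_x r_xx` into the symmetric sum of (I).
  have hW : PeriodicSmooth fun x => ∑ i, ∑ j, ∑ m,
      (cUp g c u x i j m * (ddx p x i * q x j * ddx r x m)
        + cUp g c u x j m i * (ddx q x j * r x m * ddx p x i)
        + cUp g c u x m i j * (ddx r x m * p x i * ddx q x j)) :=
    PeriodicSmooth.sum fun i _ => PeriodicSmooth.sum fun j _ => PeriodicSmooth.sum fun m _ =>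
      (((hcUp i j m).mul (((hp.ddx.apply i).mul (hq.apply j)).mul (hr.ddx.apply m))).add
        ((hcUp j m i).mul (((hq.ddx.apply j).mul (hr.apply m)).mul (hp.ddx.apply i)))).add
        ((hcUp m i j).mul (((hr.ddx.apply m).mul (hp.apply i)).mul (hq.ddx.apply j)))
  rw [cyclicVariation, formVariation, formVariation, formVariation, ← h1.integral_add h2,
    ← (h1.add h2).integral_add h3, ← ((h1.add h2).add h3).integral_add_deriv hW]
  refine intervalIntegral.integral_congr fun x _ => ?_
  have hprod : ∀ {f₁ f₂ f₃ : ℝ → ℝ} {e₁ e₂ e₃ : ℝ}, HasDerivAt f₁ e₁ x → HasDerivAt f₂ e₂ x →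
      HasDerivAt f₃ e₃ x → HasDerivAt (fun y => f₁ y * f₂ y * f₃ y)
        ((e₁ * f₂ x + f₁ x * e₂) * f₃ x + f₁ x * f₂ x * e₃) x := fun d₁ d₂ d₃ =>
    (d₁.fun_mul d₂).fun_mul d₃
  have hC := hasDerivAt_cUp hU hg hflat hc hu x
  have hder := (HasDerivAt.fun_sum (u := Finset.univ) fun i _ => HasDerivAt.fun_sum
    (u := Finset.univ) fun j _ => HasDerivAt.fun_sum (u := Finset.univ) fun m _ =>
      (((hC i j m).fun_mul (hprod (hp.ddx.hasDerivAt_apply x i) (hq.hasDerivAt_apply x j)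
          (hr.ddx.hasDerivAt_apply x m))).fun_add
        ((hC j m i).fun_mul (hprod (hq.ddx.hasDerivAt_apply x j) (hr.hasDerivAt_apply x m)
          (hp.ddx.hasDerivAt_apply x i)))).fun_add
        ((hC m i j).fun_mul (hprod (hr.ddx.hasDerivAt_apply x m) (hp.hasDerivAt_apply x i)
          (hq.ddx.hasDerivAt_apply x j)))).deriv
  simp only [fderiv_quadForm_hydroOp hU hg hflat ha hc hd hu hr,
    fderiv_quadForm_hydroOp hU hg hflat ha hc hd hu hp,
    fderiv_quadForm_hydroOp hU hg hflat ha hc hd hu hq]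
  rw [hder]
  clear hder hprod hC hW h1 h2 h3
  rw [cubicForm]
  -- The second variation is one rotation away from the common labelling, the third two.
  nth_rewrite 2 [sum_rotate]
  nth_rewrite 3 [sum_rotate]
  nth_rewrite 3 [sum_rotate]
  simp only [← Finset.sum_add_distrib]
  refine Finset.sum_congr rfl fun i _ => Finset.sum_congr rfl fun j _ =>
    Finset.sum_congr rfl fun m _ => ?_
  simp only [cubicTerm, coeffCyclic, coeffClosed, coeffSymm]
  ring

end

section

variable {n : ℕ} {U : Set (Fin n → ℝ)} {g : Fin n → Fin n → (Fin n → ℝ) → ℝ}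
  {a : Fin n → Fin n → (Fin n → ℝ) → ℝ} {β c : Fin n → Fin n → Fin n → (Fin n → ℝ) → ℝ}
  {d : Fin n → Fin n → Fin n → Fin n → (Fin n → ℝ) → ℝ} {u p q r : ℝ → Fin n → ℝ}
  {P : Operator n}

/-! ### Reduction of the Jacobi identity -/

/-- Equality over `U` suffices, which permits replacing `β` by the transposed `c` although the two
are compared only there. -/
lemma HasFormDensity.congr {ℓ ℓ' : FormPoint n → ℝ} (hP : HasFormDensity U P ℓ)
    (hℓ' : IsFormDensity U ℓ') (h : ∀ z ∈ formDomain U, ℓ z = ℓ' z) : HasFormDensity U P ℓ' where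
  toIsFormDensity := hℓ'
  smoothPeriodic := hP.smoothPeriodic
  integral_eq u p q hu hp hq := by
    rw [hP.integral_eq u p q hu hp hq]
    exact intervalIntegral.integral_congr fun x _ => h _ (hu.formPoint_mem p q x)
  antisymm := hP.antisymm

/-- After division by `|ε|` the bound reads `|T| ≤ C |ε|`, and `ε` tends to zero through nonzero
values. -/
lemma eq_zero_of_isBigO_sq {T R : ℝ}
    (h : (fun ε : ℝ => ε * T + ε ^ 2 * R) =O[𝓝 0] fun ε : ℝ => ε ^ 2) : T = 0 := by
  have h1 : (fun ε : ℝ => ε * T) =O[𝓝 0] fun ε : ℝ => ε ^ 2 := by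
    have h2 : (fun ε : ℝ => ε ^ 2 * R) =O[𝓝 0] fun ε : ℝ => ε ^ 2 := by
      simpa only [mul_comm] using
        (Asymptotics.isBigO_refl (fun ε : ℝ => ε ^ 2) (𝓝 0)).const_mul_left R
    simpa using h.sub h2
  obtain ⟨C, hC⟩ := h1.bound
  have h3 : ∀ᶠ ε : ℝ in 𝓝[≠] 0, |T| ≤ C * |ε| := by
    filter_upwards [nhdsWithin_le_nhds hC, self_mem_nhdsWithin] with ε hε hne
    have hpos : 0 < |ε| := abs_pos.2 hne
    rw [norm_mul, norm_pow, Real.norm_eq_abs, Real.norm_eq_abs] at hε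
    refine le_of_mul_le_mul_left ?_ hpos
    calc |ε| * |T| ≤ C * |ε| ^ 2 := hε
      _ = |ε| * (C * |ε|) := by ring
  have h4 : Tendsto (fun ε : ℝ => C * |ε|) (𝓝[≠] 0) (𝓝 0) := by
    have : Tendsto (fun ε : ℝ => C * |ε|) (𝓝 0) (𝓝 (C * |(0 : ℝ)|)) :=
      (continuous_const.mul continuous_abs).tendsto 0
    rw [abs_zero, mul_zero] at this
    exact this.mono_left nhdsWithin_le_nhds
  exact abs_nonpos_iff.1 (ge_of_tendsto h4 h3)

/-- The Jacobi identity to first order is the vanishing of the cyclic variation. -/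
theorem jacobiToFirstOrder_iff (hU : IsOpen U) (hg : IsMetric U g) (hflat : IsFlatCoord U g)
    (hP : HasFormDensity U P (quadForm a (fun i j => c j i) c d)) :
    JacobiToFirstOrder U (hydroOp g) P ↔ ∀ u p q r, IsLoop U u → SmoothPeriodic p →
      SmoothPeriodic q → SmoothPeriodic r → cyclicVariation g a c d u p q r = 0 := by
  set ℓ := quadForm a (fun i j => c j i) c d with hℓ
  have hP₁ := hasFormDensity_hydroOp hU hg hflat
  have hPε : ∀ ε : ℝ, HasFormDensity U (hydroOp g + ε • P) (metricForm g + ε • ℓ) :=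
    hP₁.add_smul hU hP
  have hvar : ∀ (ε : ℝ) u p q r, IsLoop U u → SmoothPeriodic p → SmoothPeriodic q →
      SmoothPeriodic r → formVariation (metricForm g + ε • ℓ) u p q ((hydroOp g + ε • P) u r) =
        ε * formVariation ℓ u p q (hydroOp g u r) + ε ^ 2 * formVariation ℓ u p q (P u r) := by
    intro ε u p q r hu hp hq hr
    -- The metric density has no variation along the loop, so a factor `ε` comes out; a second one
    -- appears only when the direction is `ε P₂ r`.
    have h1 : ∀ φ, formVariation (metricForm g + ε • ℓ) u p q φ = ε * formVariation ℓ u p q φ := by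
      intro φ
      rw [formVariation, formVariation, ← intervalIntegral.integral_const_mul]
      refine intervalIntegral.integral_congr fun x _ => ?_
      have hd₁ := (isFormDensity_metricForm hg.smooth).differentiableAt hU
        (hu.formPoint_mem p q x)
      have hd₂ := hP.toIsFormDensity.differentiableAt hU (hu.formPoint_mem p q x)
      simp only [fderiv_add hd₁ (hd₂.const_smul ε), fderiv_const_smul hd₂,
        add_apply, smul_apply, smul_eq_mul]
      rw [formPoint, fderiv_metricForm hU hg hflat (hu.mem x), zero_add]
    rw [h1, show (hydroOp g + ε • P) u r = hydroOp g u r + ε • P u r from rfl,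
      formVariation_add_smul hU hP.smooth hu hp hq (hP₁.smoothPeriodic u r hu hr)
        (hP.smoothPeriodic u r hu hr)]
    ring
  have hjac : ∀ F G H u, IsRegular U F → IsRegular U G → IsRegular U H → IsLoop U u → ∃ R : ℝ,
      (fun ε : ℝ => jacobiator (hydroOp g + ε • P) F G H u) = fun ε => ε *
        cyclicVariation g a c d u (varDeriv F u) (varDeriv G u) (varDeriv H u) + ε ^ 2 * R := by
    intro F G H u hF hG hH hu
    have hp := (hF.hasVarDeriv u hu).smoothPeriodic
    have hq := (hG.hasVarDeriv u hu).smoothPeriodic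
    have hr := (hH.hasVarDeriv u hu).smoothPeriodic
    refine ⟨formVariation ℓ u (varDeriv F u) (varDeriv G u) (P u (varDeriv H u))
      + formVariation ℓ u (varDeriv G u) (varDeriv H u) (P u (varDeriv F u))
      + formVariation ℓ u (varDeriv H u) (varDeriv F u) (P u (varDeriv G u)), funext fun ε => ?_⟩
    rw [jacobiator_eq hU (hPε ε) hF hG hH hu, hvar ε u _ _ _ hu hp hq hr,
      hvar ε u _ _ _ hu hq hr hp, hvar ε u _ _ _ hu hr hp hq, cyclicVariation]
    ring
  constructor
  · intro h u p q r hu hp hq hr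
    -- Linear functionals have the prescribed fields `p`, `q`, `r` as variational derivatives at
    -- every loop.
    have hF : ∀ {s}, SmoothPeriodic s → IsLocal U (linearFunctional s) := fun hs =>
      isLocal_linearFunctional hs
    obtain ⟨R, hR⟩ := hjac _ _ _ u ((hF hp).isRegular hU) ((hF hq).isRegular hU)
      ((hF hr).isRegular hU) hu
    have h1 := h _ _ _ (hF hp) (hF hq) (hF hr) u hu
    rw [hR, varDeriv_linearFunctional hp hu.toSmoothPeriodic,
      varDeriv_linearFunctional hq hu.toSmoothPeriodic,
      varDeriv_linearFunctional hr hu.toSmoothPeriodic] at h1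
    exact eq_zero_of_isBigO_sq h1
  · intro h F G H hF hG hH u hu
    replace hF := hF.isRegular hU
    replace hG := hG.isRegular hU
    replace hH := hH.isRegular hU
    obtain ⟨R, hR⟩ := hjac F G H u hF hG hH hu
    rw [hR, h u _ _ _ hu (hF.hasVarDeriv u hu).smoothPeriodic
      (hG.hasVarDeriv u hu).smoothPeriodic (hH.hasVarDeriv u hu).smoothPeriodic]
    simpa only [mul_zero, zero_add, mul_comm] using
      (Asymptotics.isBigO_refl (fun ε : ℝ => ε ^ 2) (𝓝 0)).const_mul_left R

/-! ### Vanishing of the cyclic variation -/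

lemma cubicForm_basisField (g a : Fin n → Fin n → (Fin n → ℝ) → ℝ)
    (c : Fin n → Fin n → Fin n → (Fin n → ℝ) → ℝ)
    (d : Fin n → Fin n → Fin n → Fin n → (Fin n → ℝ) → ℝ) (u : ℝ → Fin n → ℝ) (i j m : Fin n)
    (f h k : ℝ → ℝ) (x : ℝ) :
    cubicForm g a c d u (basisField i f) (basisField j h) (basisField m k) x =
      cubicTerm g a c d u x i j m (f x) (deriv f x) (deriv (deriv f) x) (h x) (deriv h x)
        (deriv (deriv h) x) (k x) (deriv k x) (deriv (deriv k) x) := by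
  simp only [cubicForm, ddx_basisField, basisField]
  rw [Finset.sum_eq_single i, Finset.sum_eq_single j, Finset.sum_eq_single m]
  · simp only [Pi.single_eq_same]
  · intro m' _ hm
    simp [Pi.single_eq_of_ne hm, cubicTerm]
  · simp
  · intro j' _ hj
    exact Finset.sum_eq_zero fun m' _ => by simp [Pi.single_eq_of_ne hj, cubicTerm]
  · simp
  · intro i' _ hi
    exact Finset.sum_eq_zero fun j' _ => Finset.sum_eq_zero fun m' _ => by
      simp [Pi.single_eq_of_ne hi, cubicTerm]
  · simp

section const

variable (g a c d) (w : Fin n → ℝ) (x : ℝ) (i j m : Fin n)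

lemma cUpDeriv_const : cUpDeriv g c (fun _ => w) x i j m = 0 := by
  simp [cUpDeriv, ddx_const]

lemma cDerivUp_const : cDerivUp g c (fun _ => w) x i j m = 0 := by
  simp [cDerivUp, ddx_const]

lemma dUp_const : dUp g d (fun _ => w) x i j m = 0 := by
  simp [dUp, ddx_const]

lemma dDerivUp_const : dDerivUp g d (fun _ => w) x i j m = 0 := by
  simp [dDerivUp, ddx_const]

end const

/-- The coefficients of the cubic form vanish if its integrals vanish. -/
theorem conditions_of_integral_cubicForm (hU : IsOpen U) (hg : IsMetric U g)
    (hc : ∀ i j k, ContDiffOn ℝ ∞ (c i j k) U)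
    (hd : ∀ i j k l, ContDiffOn ℝ ∞ (d i j k l) U)
    (hsymm : ∀ i j k l, ∀ w ∈ U, d i j k l w = d i j l k w)
    (hT : ∀ u p q r, IsLoop U u → SmoothPeriodic p → SmoothPeriodic q → SmoothPeriodic r →
      ∫ x in (0 : ℝ)..1, cubicForm g a c d u p q r x = 0) :
    (∀ i j m, ∀ w ∈ U, raise g m (c i j) w + raise g i (c m j) w = 0) ∧
    (∀ i j k l, ∀ w ∈ U, d i j k l w = 0) ∧
    (∀ i j m k, ∀ w ∈ U, raise g m (fun s => pd s (c i j k)) w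
      - raise g i (fun s => pd s (c m j k)) w - raise g m (fun s => pd k (c i j s)) w = 0) ∧
    (∀ i j m, ∀ w ∈ U, raise g m (fun s => pd s (a i j)) w + raise g i (fun s => pd s (a j m)) w
      + raise g j (fun s => pd s (a m i)) w - raise g m (c i j) w - raise g i (c j m) w
      - raise g j (c m i) w = 0) := by
  obtain ⟨σ, ρ, η, hσ, hρ, hη, hρσ, hne₂, hne₃⟩ := exists_test_functions
  have htest : ∀ u, IsLoop U u → ∀ (i j m : Fin n) {f h k : ℝ → ℝ}, PeriodicSmooth f →
      PeriodicSmooth h → PeriodicSmooth k → ∫ x in (0 : ℝ)..1, cubicTerm g a c d u x i j m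
        (f x) (deriv f x) (deriv (deriv f) x) (h x) (deriv h x)
        (deriv (deriv h) x) (k x) (deriv k x) (deriv (deriv k) x) = 0 := by
    intro u hu i j m f h k hf hh hk
    simpa only [cubicForm_basisField] using hT u _ _ _ hu (smoothPeriodic_basisField i hf)
      (smoothPeriodic_basisField j hh) (smoothPeriodic_basisField m hk)
  have h1 : PeriodicSmooth fun _ => 1 := PeriodicSmooth.const 1
  have hI : ∀ i j m, ∀ w ∈ U, raise g m (c i j) w + raise g i (c m j) w = 0 := by
    intro i j m w hw
    -- On a constant loop all terms with `u_x` vanish, and the constant middle field removes those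
    -- with `q_x` or `q_xx`. Because `ρ_x = σ`, the remaining factor `p_xx r_x` is the square
    -- `σ_x²`.
    have h := htest _ (isLoop_const hw) i j m hρ h1 hσ
    have h2 : ∫ x in (0 : ℝ)..1, (raise g m (c i j) w + raise g i (c m j) w)
        * (deriv σ x * deriv σ x) = 0 := by
      refine Eq.trans (intervalIntegral.integral_congr fun x _ => ?_) h
      simp only [cubicTerm, coeffClosed, coeffSymm, cUpDeriv_const, cDerivUp_const, dUp_const,
        dDerivUp_const, deriv_const, deriv_const', hρσ, cUp]
      ring
    rw [intervalIntegral.integral_const_mul] at h2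
    exact (mul_eq_zero.1 h2).resolve_right hne₂
  have hd0 : ∀ i j k l, ∀ w ∈ U, d i j k l w = 0 := by
    intro i j k l w hw
    refine hg.eq_zero_of_sum hw (v := fun s => d i j s l w) (fun m => ?_) k
    -- Two constant fields leave only the terms in `d`. The part linear in `u_x` is `g^{ms}(d_{sk} +
    -- d_{ks})`, which symmetry of `d` doubles and nondegeneracy of `g` then inverts.
    have h := coeff_eq_zero_of_integral hU
      (f := fun k => raise g m fun s w => d i j s k w + d i j k s w)
      (e := fun k l => raise g m fun s => pd s (d i j k l))
      (fun k => contDiffOn_raise hg (fun s => (hd i j s k).add (hd i j k s)) m)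
      (fun k l => contDiffOn_raise hg (fun s => contDiffOn_pd hU (hd i j k l) s) m)
      hσ.deriv hρ.deriv hσ hne₂ (fun u hu => by
        refine Eq.trans (intervalIntegral.integral_congr fun x _ => ?_) (htest u hu i j m h1 h1 hρ)
        simp only [cubicTerm, deriv_const, deriv_const', hρσ, dUp, dDerivUp]
        ring) l w hw
    have h2 : raise g m (fun s w => d i j s l w + d i j l s w) w = 2 * ∑ s, g m s w * d i j s l w := by
      simp only [raise, Finset.mul_sum]
      exact Finset.sum_congr rfl fun s _ => by rw [hsymm i j l s w hw]; ring
    linarith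
  have hpd0 : ∀ i j k l s, ∀ w ∈ U, pd s (d i j k l) w = 0 := by
    intro i j k l s w hw
    rw [pd_congr hU (h := fun _ => 0) (hd0 i j k l) hw]
    simp [pd]
  have hdUp : ∀ u, IsLoop U u → ∀ x i j m, dUp g d u x i j m = 0 := fun u hu x i j m => by
    simp [dUp, raise, hd0 _ _ _ _ _ (hu.mem x)]
  have hdDerivUp : ∀ u, IsLoop U u → ∀ x i j m, dDerivUp g d u x i j m = 0 := fun u hu x i j m => by
    simp [dDerivUp, raise, hpd0 _ _ _ _ _ _ (hu.mem x)]
  have hsymm0 : ∀ u, IsLoop U u → ∀ x i j m, coeffSymm g c u x i j m = 0 := fun u hu x i j m =>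
    hI i j m (u x) (hu.mem x)
  refine ⟨hI, hd0, fun i j m => ?_, fun i j m w hw => ?_⟩
  · refine coeff_eq_zero_of_integral hU (f := fun k w => raise g m (fun s => pd s (c i j k)) w
      - raise g i (fun s => pd s (c m j k)) w - raise g m (fun s => pd k (c i j s)) w)
      (e := fun _ _ _ => 0) (fun k => ((contDiffOn_raise hg (fun s => contDiffOn_pd hU (hc i j k) s)
        m).sub (contDiffOn_raise hg (fun s => contDiffOn_pd hU (hc m j k) s) i)).sub
        (contDiffOn_raise hg (fun s => contDiffOn_pd hU (hc i j s) k) m))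
      (fun _ _ => contDiffOn_const) (hσ.deriv.mul hσ.deriv) h1 hη hne₃ (fun u hu => ?_)
    -- With (I) and (II) known, a constant middle field leaves only the `p_x q r_x` coefficient,
    -- which is linear in `u_x`; now `σ_x²` plays the role of `ψ`.
    have h := htest u hu i j m hσ h1 hσ
    rw [← neg_eq_zero, ← intervalIntegral.integral_neg]
    refine Eq.trans (intervalIntegral.integral_congr fun x _ => ?_) h
    simp only [cubicTerm, hsymm0 u hu, hdUp u hu, hdDerivUp u hu, deriv_const, deriv_const',
      coeffClosed, cDerivUp, cUpDeriv, sub_mul, Finset.sum_sub_distrib, zero_mul,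
      Finset.sum_const_zero]
    ring
  -- On constant loops the coefficients of (III) drop out for lack of `u_x` and those of (I) are
  -- already zero, so the cubic integral of the test functions isolates (IV).
  · have h := htest _ (isLoop_const hw) i j m hσ hσ hη
    have h2 : ∫ x in (0 : ℝ)..1, -(raise g m (fun s => pd s (a i j)) w
        + raise g i (fun s => pd s (a j m)) w
        + raise g j (fun s => pd s (a m i)) w - raise g m (c i j) w - raise g i (c j m) w
        - raise g j (c m i) w) * (deriv σ x * deriv σ x * deriv η x) = 0 := by
      refine Eq.trans (intervalIntegral.integral_congr fun x _ => ?_) h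
      simp only [cubicTerm, coeffClosed, hsymm0 _ (isLoop_const hw), cUpDeriv_const,
        cDerivUp_const, dUp_const, dDerivUp_const, coeffCyclic, cUp, aUp]
      ring
    rw [intervalIntegral.integral_const_mul] at h2
    exact neg_eq_zero.1 ((mul_eq_zero.1 h2).resolve_right hne₃)

/-- The cubic form vanishes if its coefficients do. -/
theorem cubicForm_eq_zero (hU : IsOpen U)
    (hI : ∀ i j m, ∀ w ∈ U, raise g m (c i j) w + raise g i (c m j) w = 0)
    (hII : ∀ i j k l, ∀ w ∈ U, d i j k l w = 0)
    (hIII : ∀ i j m k, ∀ w ∈ U, raise g m (fun s => pd s (c i j k)) w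
      - raise g i (fun s => pd s (c m j k)) w - raise g m (fun s => pd k (c i j s)) w = 0)
    (hIV : ∀ i j m, ∀ w ∈ U, raise g m (fun s => pd s (a i j)) w
      + raise g i (fun s => pd s (a j m)) w + raise g j (fun s => pd s (a m i)) w
      - raise g m (c i j) w - raise g i (c j m) w - raise g j (c m i) w = 0)
    (hu : IsLoop U u) (p q r : ℝ → Fin n → ℝ) (x : ℝ) : cubicForm g a c d u p q r x = 0 := by
  have hx := hu.mem x
  have hpd : ∀ i j k l s, pd s (d i j k l) (u x) = 0 := by
    intro i j k l s
    rw [pd_congr hU (h := fun _ => 0) (hII i j k l) hx]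
    simp [pd]
  have h1 : ∀ i j m, coeffSymm g c u x i j m = 0 := fun i j m => hI i j m _ hx
  have h2 : ∀ i j m, dUp g d u x i j m = 0 := fun i j m => by
    simp [dUp, raise, hII _ _ _ _ _ hx]
  have h3 : ∀ i j m, dDerivUp g d u x i j m = 0 := fun i j m => by
    simp [dDerivUp, raise, hpd]
  have h4 : ∀ i j m, coeffClosed g c u x i j m = 0 := fun i j m => by
    simp only [coeffClosed, cDerivUp, cUpDeriv, ← Finset.sum_sub_distrib, ← sub_mul]
    exact Finset.sum_eq_zero fun k _ => by rw [hIII i j m k _ hx, zero_mul]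
  have h5 : ∀ i j m, coeffCyclic g a c u x i j m = 0 := fun i j m => hIV i j m _ hx
  simp [cubicForm, cubicTerm, h1, h2, h3, h4, h5]

end

end LoopPoisson

end

/-! ### The equivalence with conditions (I)–(IV) -/

theorem mainTheorem6 {n : ℕ} (U : Set (Fin n → ℝ)) (hU : IsOpen U)
    (g : Fin n → Fin n → (Fin n → ℝ) → ℝ)
    (hg : LoopPoisson.IsMetric U g) (hflat : LoopPoisson.IsFlatCoord U g)
    (a : Fin n → Fin n → (Fin n → ℝ) → ℝ)
    (b c : Fin n → Fin n → Fin n → (Fin n → ℝ) → ℝ)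
    (cc : Fin n → Fin n → Fin n → Fin n → (Fin n → ℝ) → ℝ)
    (ha : ∀ i j, ContDiffOn ℝ ∞ (a i j) U)
    (hb : ∀ i j k, ContDiffOn ℝ ∞ (b i j k) U)
    (hc : ∀ i j k, ContDiffOn ℝ ∞ (c i j k) U)
    (hcc : ∀ i j k l, ContDiffOn ℝ ∞ (cc i j k l) U)
    (hcc_symm : ∀ i j k l, ∀ u ∈ U, cc i j k l u = cc i j l k u)
    (hanti : LoopPoisson.IsAntisymm U (LoopPoisson.degreeTwoOp a b c cc)) :
    LoopPoisson.JacobiToFirstOrder U (LoopPoisson.hydroOp g) (LoopPoisson.degreeTwoOp a b c cc) ↔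
      (∀ i j k, ∀ u ∈ U,
        ∑ r, g i r u * c j k r u + ∑ r, g j r u * c i k r u = 0) ∧
      (∀ i j k l, ∀ u ∈ U,
        cc i j k l u =
          (1 / 2) * (LoopPoisson.pd l (c i j k) u + LoopPoisson.pd k (c i j l) u)) ∧
      (∀ i j k l, ∀ u ∈ U,
        ∑ r, g i r u * LoopPoisson.pd r (c j k l) u =
          ∑ r, g j r u * (LoopPoisson.pd r (c i k l) u - LoopPoisson.pd l (c i k r) u)) ∧
      (∀ i j k, ∀ u ∈ U,
        ∑ r, g i r u * (LoopPoisson.pd r (a j k) u - c j k r u)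
          + ∑ r, g j r u * (LoopPoisson.pd r (a k i) u - c k i r u)
          + ∑ r, g k r u * (LoopPoisson.pd r (a i j) u - c i j r u) = 0) := by
  open LoopPoisson in
  have hβs := contDiffOn_betaCoeff hU ha hb hc
  have hds := contDiffOn_defectCoeff hU hc hcc
  have hP₀ := hasFormDensity_degreeTwoOp hU ha hb hc hcc hanti
  -- Antisymmetry eliminates `b`: from here on the density involves only `a`, `c` and the defect of
  -- (II).
  have hP : HasFormDensity U (degreeTwoOp a b c cc)
      (quadForm a (fun i j => c j i) c (defectCoeff c cc)) :=
    hP₀.congr (isFormDensity_quadForm ha (fun i j k => hc j i k) hc hds) fun z hz => by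
      simp only [quadForm, hP₀.beta_eq hU hβs hc hds _ _ _ z.1 hz]
  have hsymm : ∀ i j k l, ∀ w ∈ U, defectCoeff c cc i j k l w = defectCoeff c cc i j l k w := by
    intro i j k l w hw
    rw [defectCoeff, defectCoeff, hcc_symm i j k l w hw, add_comm (pd l _ w)]
  rw [jacobiToFirstOrder_iff hU hg hflat hP]
  constructor
  · intro h
    obtain ⟨hI, hII, hIII, hIV⟩ := conditions_of_integral_cubicForm (d := defectCoeff c cc) hU hg
      hc hds hsymm fun u p q r hu hp hq hr => by
        rw [← cyclicVariation_eq hU hg hflat ha hc hds hu hp hq hr]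
        exact h u p q r hu hp hq hr
    refine ⟨fun i j k u hu => hI j k i u hu, fun i j k l u hu => sub_eq_zero.1 (hII i j k l u hu),
      fun i j k l u hu => ?_, fun i j k u hu => ?_⟩
    -- The cubic form keeps the undifferentiated field in the middle slot, hence the exchange of `j`
    -- and `k`.
    · have := hIII i k j l u hu
      simp only [raise] at this
      simp only [mul_sub, Finset.sum_sub_distrib]
      linarith
    · have := hIV i j k u hu
      simp only [raise] at this
      simp only [mul_sub, Finset.sum_sub_distrib]
      linarith
  · rintro ⟨hI, hII, hIII, hIV⟩ u p q r hu hp hq hr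
    rw [cyclicVariation_eq hU hg hflat ha hc hds hu hp hq hr]
    have h0 := cubicForm_eq_zero (g := g) (a := a) (c := c) (d := defectCoeff c cc) hU
      (fun i j m w hw => hI m i j w hw) (fun i j k l w hw => sub_eq_zero.2 (hII i j k l w hw))
      (fun i j m k w hw => by
        have := hIII i m j k w hw
        simp only [mul_sub, Finset.sum_sub_distrib] at this
        simp only [raise]
        linarith)
      (fun i j m w hw => by
        have := hIV i j m w hw
        simp only [mul_sub, Finset.sum_sub_distrib] at this
        simp only [raise]
        linarith) hu p q r
    simp [h0]
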